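/- Let $CP^3(4)$ be complex projective $3$-space with complex structure $J$ and the Fubini–Study metric $\langle\cdot,\cdot\rangle$ of constant holomorphic sectional curvature $4$. Let $N$ be a real hypersurface of $CP^3(4)$, i.e. a smooth $5$-manifold with a smooth immersion into $CP^3(4)$, equipped with the induced metric. Let $Ric$ be the Ricci tensor of $N$, $\sigma$ its second fundamental form, $\overrightarrow{H}=\frac15\,\mathrm{trace}\,\sigma$ its mean curvature vector and $H^2=\langle\overrightarrow{H},\overrightarrow{H}\rangle$. Then, at every point of $N$ and for every unit normal vector $\xi$ of $N$ at that point (so that $J\xi$ is tangent to $N$), $$Ric(J\xi,J\xi)\le \frac{25}{2}H^2+4 .$$ Equality holds identically on $N$ (at every point, for every unit normal vector $\xi$ there) if and only if every point of $N$ has an open neighbourhood $U$ on which there exist a smooth unit normal field $\xi$, a smooth orthonormal frame $\{e_1,e_2,e_3,e_4,e_5\}$ of $TN$ with $e_3=Je_1$ and $e_4=Je_2$, and a nowhere zero smooth function $\lambda$ such that $$\sigma(e_1,e_1)=\lambda\xi,\quad \sigma(e_2,e_2)=-\lambda\xi,\quad \sigma(e_3,e_3)=\frac1\lambda\,\xi,\quad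 \sigma(e_4,e_4)=-\frac1\lambda\,\xi,$$ and $\sigma(e_a,e_b)=0$ for all other pairs $(a,b)$, $1\le a,b\le5$. -/

import Mathlib

open scoped Manifold ContDiff LinearAlgebra.Projectivization

noncomputable section

/-! ### Complex projective 3-space of constant holomorphic sectional curvature 4 -/

/-- The Hermitian space `ℂ⁴`. -/
abbrev C4 : Type := EuclideanSpace ℂ (Fin 4)

/-- Complex projective 3-space, as the set of complex lines of `ℂ⁴`. -/
abbrev CP3 : Type := ℙ ℂ C4

/-- The real normed space of all operators of `ℂ⁴`, which contains the Hermitian operators. -/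
abbrev Op4 : Type := C4 →L[ℂ] C4

namespace CP3

/-- The standard embedding of `CP³` into the space of Hermitian operators: a line is sent to the
orthogonal projection onto it. The image is the submanifold of Hermitian idempotents of trace one,
and the smooth structure of `CP³` is the one for which this is a smooth embedding. -/
def proj (p : CP3) : Op4 := p.submodule.starProjection

/-- The Euclidean inner product `½ Re tr (A* B)` on operators (`½ tr (A B)` on Hermitian ones).
Its restriction to the tangent spaces of `CP³` is the Fubini-Study metric of constant holomorphic
sectional curvature `4`; see `CP3.fubiniStudy_eq` for its expression in homogeneous coordinates. -/
def inner (A B : Op4) : ℝ :=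
  (1 / 2) * (LinearMap.trace ℂ C4 ((ContinuousLinearMap.adjoint A * B : Op4) : C4 →ₗ[ℂ] C4)).re

/-- The tangent space of `CP³` at `p`, inside the space of operators: differentiating `P * P = P`
and `P* = P` gives the Hermitian operators `A` with `A P + P A = A`. -/
def tangentSpace (p : CP3) : Submodule ℝ Op4 where
  carrier := {A | ContinuousLinearMap.adjoint A = A ∧ A * proj p + proj p * A = A}
  zero_mem' := by simp
  add_mem' := by
    rintro A B ⟨hA, hA'⟩ ⟨hB, hB'⟩
    refine ⟨by rw [map_add, hA, hB], ?_⟩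
    calc (A + B) * proj p + proj p * (A + B)
        = (A * proj p + proj p * A) + (B * proj p + proj p * B) := by
          rw [add_mul, mul_add]; abel
      _ = A + B := by rw [hA', hB']
  smul_mem' := by
    rintro c A ⟨hA, hA'⟩
    have h : (c • A : Op4) = (c : ℂ) • A := by
      ext v i; simp
    refine ⟨?_, ?_⟩
    · rw [h, LinearIsometryEquiv.map_smulₛₗ, hA, Complex.conj_ofReal]
    · rw [h, smul_mul_assoc, mul_smul_comm]
      exact (smul_add (c : ℂ) (A * proj p) (proj p * A)).symm.trans (congrArg _ hA')

/-- The complex structure `J` of `CP³` at `p`. Under the identification of `T_p CP³` with the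
complex vector space of linear maps from the line `p` to its orthogonal complement, given by
restricting `A` to `p`, it is the multiplication by `i`. -/
def J (p : CP3) (A : Op4) : Op4 := Complex.I • (A * proj p - proj p * A)

/-- The orthogonal projection of the Hermitian operators onto `T_p CP³`. -/
def tangentProj (p : CP3) (A : Op4) : Op4 :=
  proj p * A * (1 - proj p) + (1 - proj p) * A * proj p

theorem isBoundedBilinearMap_rankOne :
    IsBoundedBilinearMap ℝ (fun q : C4 × C4 => InnerProductSpace.rankOne ℂ q.1 q.2) where
  add_left _ _ _ := by simp
  smul_left c x y := by ext v i; simp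
  add_right _ _ _ := by simp
  smul_right c x y := by
    ext v i
    have h : Inner.inner ℂ (c • y) v = (c : ℂ) * Inner.inner ℂ y v := by
      rw [← Complex.coe_smul, inner_smul_left, Complex.conj_ofReal]
    simp [h, mul_assoc]
  bound := ⟨1, one_pos, fun x y => by simp⟩

theorem proj_mk (z : C4) (hz : z ≠ 0) :
    proj (Projectivization.mk ℂ z hz) = (‖z‖ ^ 2)⁻¹ • InnerProductSpace.rankOne ℂ z z := by
  have hz2 : ‖z‖ ^ 2 ≠ 0 := by simpa using hz
  ext w i
  have h := Submodule.smul_starProjection_singleton ℂ (v := z) w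
  rw [smul_apply, InnerProductSpace.rankOne_apply, ← h]
  erw [Complex.coe_smul, inv_smul_smul₀ hz2]
  rfl

/-- The Fubini-Study metric in homogeneous coordinates: a smooth curve `[z]` in `CP³` has squared
speed `(|z|² |z'|² - |⟨z, z'⟩|²) / |z|⁴`. In particular, the Hopf map from the unit sphere `S⁷` is a
Riemannian submersion. -/
theorem fubiniStudy_eq (z : ℝ → C4) (h0 : ∀ s, z s ≠ 0) (t : ℝ) (z' : C4)
    (hz : HasDerivAt z z' t) :
    ∃ A : Op4, HasDerivAt (fun s => proj (Projectivization.mk ℂ (z s) (h0 s))) A t ∧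
      inner A A = (‖z t‖ ^ 2 * ‖z'‖ ^ 2 - ‖Inner.inner ℂ (z t) z'‖ ^ 2) / ‖z t‖ ^ 4 := by
  have hz2 : ‖z t‖ ^ 2 ≠ 0 := by simpa using h0 t
  have h1 : HasDerivAt (fun s => ‖z s‖ ^ 2) (2 * (Inner.inner ℂ (z t) z').re) t := by
    have := hz.inner ℂ hz
    have h2 := (Complex.reCLM.hasFDerivAt (x := Inner.inner ℂ (z t) (z t))).comp_hasDerivAt t this
    have e : (fun s => ‖z s‖ ^ 2) = (Complex.reCLM ∘ fun s => Inner.inner ℂ (z s) (z s)) := by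
      funext s
      simp only [Function.comp, inner_self_eq_norm_sq_to_K, Complex.reCLM_apply]
      norm_cast
    have e2 : Complex.reCLM (Inner.inner ℂ (z t) z' + Inner.inner ℂ z' (z t)) =
        2 * (Inner.inner ℂ (z t) z').re := by
      have h := congrArg Complex.re (inner_conj_symm (𝕜 := ℂ) z' (z t))
      rw [Complex.conj_re] at h
      rw [Complex.reCLM_apply, Complex.add_re, ← h]; ring
    rw [e, ← e2]
    exact h2
  have h2 := (isBoundedBilinearMap_rankOne.hasFDerivAt (z t, z t)).comp_hasDerivAt t
    (hz.prodMk hz)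
  have h3 := (h1.fun_inv hz2).smul h2
  refine ⟨_, by simp only [proj_mk]; exact h3, ?_⟩
  have h4 : ‖z t‖ ≠ 0 := by simpa using h0 t
  set a := z t
  set c : ℝ := (‖a‖ ^ 2)⁻¹ with hc
  set d : ℝ := -(2 * (Inner.inner ℂ a z').re) / (‖a‖ ^ 2) ^ 2 with hd
  have hs : Inner.inner ℂ z' a = (starRingEnd ℂ) (Inner.inner ℂ a z') := (inner_conj_symm _ _).symm
  have hA : c • isBoundedBilinearMap_rankOne.deriv (a, a) (z', z') +
      d • InnerProductSpace.rankOne ℂ a a = (c : ℂ) • (InnerProductSpace.rankOne ℂ a z' +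
        InnerProductSpace.rankOne ℂ z' a) + (d : ℂ) • InnerProductSpace.rankOne ℂ a a := by
    rw [IsBoundedBilinearMap.deriv_apply]
    rfl
  change inner (c • isBoundedBilinearMap_rankOne.deriv (a, a) (z', z') +
      d • InnerProductSpace.rankOne ℂ a a) (c • isBoundedBilinearMap_rankOne.deriv (a, a) (z', z') +
      d • InnerProductSpace.rankOne ℂ a a) = _
  rw [hA]
  simp only [inner, map_add, LinearIsometryEquiv.map_smulₛₗ, Complex.conj_ofReal,
    InnerProductSpace.adjoint_rankOne, ContinuousLinearMap.mul_def, add_mul, mul_add, smul_mul_assoc,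
    mul_smul_comm, InnerProductSpace.rankOne_comp_rankOne, ContinuousLinearMap.toLinearMap_add,
    ContinuousLinearMap.toLinearMap_smul, map_smul, InnerProductSpace.trace_rankOne, hs,
    inner_self_eq_norm_sq_to_K]
  rw [Complex.sq_norm, Complex.normSq_apply]
  generalize Inner.inner ℂ a z' = s at *
  clear hA h3 h2 h1
  clear_value c d
  subst hc hd
  simp only [smul_eq_mul, ← Complex.ofReal_pow, Complex.coe_algebraMap, Complex.mul_re,
    Complex.mul_im, Complex.add_re, Complex.add_im, Complex.ofReal_re, Complex.ofReal_im,
    Complex.conj_re, Complex.conj_im]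
  field_simp
  ring

end CP3

/-! ### Curvature of a metric in coordinates -/

namespace CoordinateMetric

/-- The coordinate derivative `∂ᵢ h`. -/
def partialDeriv (i : Fin 5) (h : EuclideanSpace ℝ (Fin 5) → ℝ) (y : EuclideanSpace ℝ (Fin 5)) :
    ℝ :=
  fderiv ℝ h y (EuclideanSpace.single i 1)

variable (g : EuclideanSpace ℝ (Fin 5) → Matrix (Fin 5) (Fin 5) ℝ)

/-- The Christoffel symbols `Γᵏᵢⱼ` of the Levi-Civita connection of the metric `g`. -/
def christoffel (k i j : Fin 5) (y : EuclideanSpace ℝ (Fin 5)) : ℝ :=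
  (1 / 2) * ∑ l, (g y)⁻¹ k l * (partialDeriv i (fun z => g z j l) y
    + partialDeriv j (fun z => g z i l) y - partialDeriv l (fun z => g z i j) y)

/-- The components `Rˡₖᵢⱼ` of the curvature tensor
`R(∂ᵢ, ∂ⱼ) ∂ₖ = ∇_∂ᵢ ∇_∂ⱼ ∂ₖ - ∇_∂ⱼ ∇_∂ᵢ ∂ₖ = ∑ₗ Rˡₖᵢⱼ ∂ₗ` of the metric `g`. -/
def curvature (l k i j : Fin 5) (y : EuclideanSpace ℝ (Fin 5)) : ℝ :=
  partialDeriv i (christoffel g l j k) y - partialDeriv j (christoffel g l i k) y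
    + ∑ m, (christoffel g l i m y * christoffel g m j k y
      - christoffel g l j m y * christoffel g m i k y)

/-- The components `Ricⱼₖ = trace (X ↦ R(X, ∂ⱼ) ∂ₖ)` of the Ricci tensor of the metric `g`. -/
def ricci (j k : Fin 5) (y : EuclideanSpace ℝ (Fin 5)) : ℝ :=
  ∑ i, curvature g i k i j y

end CoordinateMetric

/-! ### Real hypersurfaces of `CP³` -/

namespace RealHypersurface

variable {N : Type*} [TopologicalSpace N] [ChartedSpace (EuclideanSpace ℝ (Fin 5)) N]

/-- `f` is a smooth immersion of the 5-manifold `N` into `CP³`, that is, `N` is an immersed real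
hypersurface. -/
structure IsHypersurface (f : N → CP3) : Prop where
  smooth : ContMDiff (𝓡 5) 𝓘(ℝ, Op4) ∞ (fun x => CP3.proj (f x))
  immersion : ∀ x, Function.Injective (mfderiv (𝓡 5) 𝓘(ℝ, Op4) (fun x => CP3.proj (f x)) x)

/-- The differential `df : T_x N → T_{f x} CP³`. -/
def differential (f : N → CP3) (x : N) (u : TangentSpace (𝓡 5) x) : Op4 :=
  mfderiv (𝓡 5) 𝓘(ℝ, Op4) (fun x => CP3.proj (f x)) x u

/-- The induced metric of the hypersurface. -/
def metric (f : N → CP3) (x : N) (u v : TangentSpace (𝓡 5) x) : ℝ :=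
  CP3.inner (differential f x u) (differential f x v)

/-- The immersion read in the preferred chart at `x`, as a map defined on an open set of `ℝ⁵`.
In Mathlib, `T_x N` is identified with `ℝ⁵` through this same chart. -/
def local_rep (f : N → CP3) (x : N) (y : EuclideanSpace ℝ (Fin 5)) : Op4 :=
  CP3.proj (f ((extChartAt (𝓡 5) x).symm y))

/-- The coordinate vector field `∂ᵢ` of the preferred chart at `x`, pushed forward by `f`. -/
def coordField (f : N → CP3) (x : N) (i : Fin 5) (y : EuclideanSpace ℝ (Fin 5)) : Op4 :=
  fderiv ℝ (local_rep f x) y (EuclideanSpace.single i 1)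

/-- The coefficients `gᵢⱼ` of the induced metric in the preferred chart at `x`. -/
def gram (f : N → CP3) (x : N) (y : EuclideanSpace ℝ (Fin 5)) : Matrix (Fin 5) (Fin 5) ℝ :=
  Matrix.of fun i j => CP3.inner (coordField f x i y) (coordField f x j y)

/-- The Ricci tensor of the induced metric. -/
def ricci (f : N → CP3) (x : N) (u v : TangentSpace (𝓡 5) x) : ℝ :=
  ∑ j : Fin 5, ∑ k : Fin 5,
    CoordinateMetric.ricci (gram f x) j k (extChartAt (𝓡 5) x x) *
      (show EuclideanSpace ℝ (Fin 5) from u) j * (show EuclideanSpace ℝ (Fin 5) from v) k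

/-- The covariant derivative `∇̃_u V` in `CP³`, for `V` the vector field along the immersion with
the constant coordinates `v` in the preferred chart at `x`. As `CP³` is a Riemannian submanifold of
the Euclidean space of Hermitian operators, its Levi-Civita connection is the tangential part of
the flat derivative. -/
def ambientCovDeriv (f : N → CP3) (x : N) (u v : TangentSpace (𝓡 5) x) : Op4 :=
  CP3.tangentProj (f x) (fderiv ℝ
    (fun y => fderiv ℝ (local_rep f x) y (show EuclideanSpace ℝ (Fin 5) from v))
    (extChartAt (𝓡 5) x x) (show EuclideanSpace ℝ (Fin 5) from u))

/-- The orthogonal projection of an operator to `df (T_x N)`. -/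
def tangentialPart (f : N → CP3) (x : N) (A : Op4) : Op4 :=
  ∑ i : Fin 5, ∑ j : Fin 5, ((gram f x (extChartAt (𝓡 5) x x))⁻¹ i j *
    CP3.inner A (coordField f x j (extChartAt (𝓡 5) x x))) •
      coordField f x i (extChartAt (𝓡 5) x x)

/-- The second fundamental form `σ(u, v)`: the component of `∇̃_u V` normal to `N`. It does not
depend on the extension `V` of `v`. -/
def sff (f : N → CP3) (x : N) (u v : TangentSpace (𝓡 5) x) : Op4 :=
  ambientCovDeriv f x u v - tangentialPart f x (ambientCovDeriv f x u v)

/-- The mean curvature vector `(1 / 5) trace σ`. -/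
def meanCurvatureVector (f : N → CP3) (x : N) : Op4 :=
  (1 / 5 : ℝ) • ∑ i : Fin 5, ∑ j : Fin 5, (gram f x (extChartAt (𝓡 5) x x))⁻¹ i j •
    sff f x (show TangentSpace (𝓡 5) x from EuclideanSpace.single i (1 : ℝ))
      (show TangentSpace (𝓡 5) x from EuclideanSpace.single j (1 : ℝ))

/-- The squared mean curvature `H²`. -/
def sqMeanCurvature (f : N → CP3) (x : N) : ℝ :=
  CP3.inner (meanCurvatureVector f x) (meanCurvatureVector f x)

/-- `ξ` is a unit normal vector of the hypersurface at `x`. -/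
structure IsUnitNormal (f : N → CP3) (x : N) (ξ : Op4) : Prop where
  tangent : ξ ∈ CP3.tangentSpace (f x)
  normal : ∀ u : TangentSpace (𝓡 5) x, CP3.inner ξ (differential f x u) = 0
  unit : CP3.inner ξ ξ = 1

/-- On the open set `U`, `ξ` is a smooth unit normal field and `e = (e₁, …, e₅)` is a smooth
orthonormal frame of `N` with `e₃ = J e₁` and `e₄ = J e₂`. Indices are shifted by one. -/
structure IsAdaptedFrameOn [IsManifold (𝓡 5) ∞ N] (f : N → CP3) (U : Set N) (ξ : N → Op4)
    (e : Fin 5 → (x : N) → TangentSpace (𝓡 5) x) : Prop where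
  smooth_normal : ContMDiffOn (𝓡 5) 𝓘(ℝ, Op4) ∞ ξ U
  unit_normal : ∀ x ∈ U, IsUnitNormal f x (ξ x)
  smooth_frame : ∀ a, ContMDiffOn (𝓡 5) (𝓡 5).tangent ∞
    (fun x => (⟨x, e a x⟩ : TangentBundle (𝓡 5) N)) U
  orthonormal : ∀ x ∈ U, ∀ a b, metric f x (e a x) (e b x) = if a = b then 1 else 0
  e₃_eq : ∀ x ∈ U, differential f x (e 2 x) = CP3.J (f x) (differential f x (e 0 x))
  e₄_eq : ∀ x ∈ U, differential f x (e 3 x) = CP3.J (f x) (differential f x (e 1 x))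

end RealHypersurface

end

/-! Let h be the second fundamental form relative to a unit normal ξ, T its trace (so 25 H² = T²)
and A the shape operator. `CP3` is studied inside the flat space of operators, and the Gauss
equation there gives Ric(Jξ, Jξ) = 4 + T h(Jξ, Jξ) - |h(Jξ, ·)|² (`ricci_structure_vector`). The
constant is 4 because the holomorphic plane through Jξ contains ξ: each of the four tangent
directions orthogonal to Jξ spans with it a plane of curvature 1. Since |h(Jξ, ·)|² ≥ h(Jξ, Jξ)²,
the bound T²/2 follows, and equality forces T = 0 and h(Jξ, ·) = 0 (`ricci_le`). Conversely, a frame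
as in the theorem has e₅ = ±Jξ, and its diagonal form shows both conditions at once
(`ricci_eq_of_frame`).

The remaining direction is local differential geometry. Choose a unitary frame Z₀, …, Z₃ of ℂ⁴ along
the hypersurface, with Z₀ a lift of the point and Z₁ the horizontal unit normal, and let Ω be its
connection forms. Then h(Jξ, ·) = 0 means Ω₁₁ = Ω₀₀. Differentiating this and Ω₀₁ = Ω₁₀ shows that A
is self-adjoint with AJA = J on the holomorphic distribution. Write A = S + T' there, with S complex
linear and T' antilinear. As A has trace zero, S² is a scalar function m, and T'² = m - 1.

The point is that m = 1. Where m ≠ 1, the map [Z₀ + Z₁] is a focal map onto a complex surface whose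
tangent space is spanned by Z₂, Z₃ and whose normal is Z₀ - Z₁. Its second fundamental form is, up
to sign, a complex matrix B with conj Q = B P, where P and Q are the differentials of the two focal
maps. The trace condition gives |det B| = 1. By Codazzi, the covariant derivative of det B is of
type (1,0); having constant modulus, det B is therefore parallel. But the bundle in which it lives
has curvature a nonzero multiple of the Kähler form of the hypersurface, a contradiction
(`fderiv_det`, `not_logDeriv`, `antilinear_eq_zero`).

So T' = 0, and A is a Hermitian trace-free involution commuting with J. Its smooth unitary
eigenframe gives the required frame, with λ = 1 (`exists_diagonal_frame`). The pointwise conditions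
do not depend on the chart, so the frame can be built in one chart and transported to N
(`exists_adaptedFrameOn`). -/

set_option linter.unusedSimpArgs false
set_option linter.unusedSectionVars false

/-! ### Tangent vectors of CP³ as vectors of ℂ⁴ orthogonal to a unit vector on the line -/

noncomputable section

namespace CP3

open ContinuousLinearMap InnerProductSpace

local notation "⟪" x ", " y "⟫" => Inner.inner ℂ x y

/-- The tangent vector `w z* + z w*` of `CP³` at the line of the unit vector `z`. -/
def tvec (z w : C4) : Op4 := rankOne ℂ w z + rankOne ℂ z w

theorem tvec_apply (z w v : C4) : tvec z w v = ⟪z, v⟫ • w + ⟪w, v⟫ • z := by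
  simp [tvec]

/-- Fixing a unit vector z on the line identifies the tangent space with the orthogonal complement
of z through A ↦ A z. Pointwise computations are carried out in that model. -/
theorem exists_unit (p : CP3) : ∃ z : C4, ‖z‖ = 1 ∧ proj p = rankOne ℂ z z := by
  induction p using Projectivization.ind with
  | h v hv =>
    have h0 : ‖v‖ ≠ 0 := by simpa using hv
    refine ⟨((‖v‖⁻¹ : ℝ) : ℂ) • v, ?_, ?_⟩
    · rw [norm_smul]; simp [h0]
    · rw [proj_mk]
      ext w i
      simp only [smul_apply, rankOne_apply, inner_smul_left, Complex.conj_ofReal, smul_smul,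
        PiLp.smul_apply, smul_eq_mul, Complex.real_smul]
      push_cast
      field_simp

theorem inner_self_one {z : C4} (hz : ‖z‖ = 1) : ⟪z, z⟫ = 1 := by
  rw [inner_self_eq_norm_sq_to_K, hz]; simp

theorem proj_apply_unit {p : CP3} {z : C4} (hz : ‖z‖ = 1) (hp : proj p = rankOne ℂ z z) :
    proj p z = z := by
  simp [hp, hz]

theorem op_mul_apply (A B : Op4) (v : C4) : (A * B) v = A (B v) := rfl

theorem inner_add_left (A B C : Op4) : inner (A + B) C = inner A C + inner B C := by
  simp [inner, add_mul, mul_add]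

theorem inner_add_right (A B C : Op4) : inner A (B + C) = inner A B + inner A C := by
  simp [inner, mul_add]

theorem real_smul_eq (c : ℝ) (A : Op4) : c • A = (c : ℂ) • A := by
  ext v i; simp

theorem inner_smul_right (c : ℝ) (A B : Op4) : inner A (c • B) = c * inner A B := by
  simp only [inner, real_smul_eq, mul_smul_comm, ContinuousLinearMap.toLinearMap_smul, map_smul,
    smul_eq_mul, Complex.re_ofReal_mul]
  ring

theorem inner_smul_left (c : ℝ) (A B : Op4) : inner (c • A) B = c * inner A B := by
  simp only [inner, real_smul_eq, LinearIsometryEquiv.map_smulₛₗ, Complex.conj_ofReal,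
    smul_mul_assoc, ContinuousLinearMap.toLinearMap_smul, map_smul,
    smul_eq_mul, Complex.re_ofReal_mul]
  ring

theorem inner_comm (A B : Op4) : inner A B = inner B A := by
  have h : LinearMap.trace ℂ C4 ((adjoint (adjoint A * B) : Op4) : C4 →ₗ[ℂ] C4) =
      (starRingEnd ℂ) (LinearMap.trace ℂ C4 ((adjoint A * B : Op4) : C4 →ₗ[ℂ] C4)) := by
    have e := fun T : Op4 => LinearMap.trace_eq_sum_inner (T : C4 →ₗ[ℂ] C4)
      (EuclideanSpace.basisFun (Fin 4) ℂ)
    rw [e, e, map_sum]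
    refine Finset.sum_congr rfl fun i _ => ?_
    simp only [coe_coe, adjoint_inner_right, inner_conj_symm]
  have h2 : adjoint (adjoint A * B) = adjoint B * A := by
    simp [ContinuousLinearMap.mul_def, adjoint_comp]
  rw [h2] at h
  simp only [inner, h, Complex.conj_re]

/-- The Euclidean inner product of operators as a bilinear map. -/
def innerB : Op4 →ₗ[ℝ] Op4 →ₗ[ℝ] ℝ :=
  LinearMap.mk₂ ℝ inner inner_add_left inner_smul_left inner_add_right inner_smul_right

theorem inner_rankOne (a b c d : C4) :
    inner (rankOne ℂ a b) (rankOne ℂ c d) = 1 / 2 * (⟪a, c⟫ * ⟪d, b⟫).re := by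
  simp only [inner, adjoint_rankOne, ContinuousLinearMap.mul_def, rankOne_comp_rankOne,
    ContinuousLinearMap.toLinearMap_smul, map_smul, trace_rankOne, smul_eq_mul]

theorem inner_zero_comm {z w : C4} (h : ⟪z, w⟫ = 0) : ⟪w, z⟫ = 0 := by
  rw [← inner_conj_symm, h, map_zero]

theorem inner_tvec {z w w' : C4} (hz : ‖z‖ = 1) (h : ⟪z, w⟫ = 0) (h' : ⟪z, w'⟫ = 0) :
    inner (tvec z w) (tvec z w') = (⟪w, w'⟫).re := by
  simp only [tvec, inner_add_left, inner_add_right, inner_rankOne, inner_self_one hz, h, h',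
    inner_zero_comm h, inner_zero_comm h']
  have := congrArg Complex.re (inner_conj_symm (𝕜 := ℂ) w w')
  rw [Complex.conj_re] at this
  simp [this]
  ring

theorem tvec_add (z w w' : C4) : tvec z (w + w') = tvec z w + tvec z w' := by
  simp only [tvec, map_add, add_apply]; abel

theorem tvec_smul (z w : C4) (c : ℝ) : tvec z (c • w) = c • tvec z w := by
  ext v i
  have h : ⟪c • w, v⟫ = (c : ℂ) * ⟪w, v⟫ := by
    rw [← Complex.coe_smul, _root_.inner_smul_left, Complex.conj_ofReal]
  simp [tvec_apply, h, mul_add, mul_comm, mul_assoc, mul_left_comm]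

theorem tvec_self {z w : C4} (hz : ‖z‖ = 1) (h : ⟪z, w⟫ = 0) : tvec z w z = w := by
  simp [tvec_apply, hz, inner_zero_comm h]

theorem tvec_mem {p : CP3} {z w : C4} (hz : ‖z‖ = 1) (hp : proj p = rankOne ℂ z z)
    (h : ⟪z, w⟫ = 0) : tvec z w ∈ tangentSpace p := by
  refine ⟨?_, ?_⟩
  · simp [tvec, adjoint_rankOne, add_comm]
  · rw [hp]
    ext v i
    simp [op_mul_apply, tvec_apply, hz, inner_zero_comm h, _root_.inner_smul_right, h,
      _root_.inner_add_right]

/-- Self-adjointness and A = AP + PA recover A from A z. Pairing the resulting formula at z with z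
gives ⟨z, Az⟩ = 2⟨z, Az⟩. -/
theorem eq_tvec_of_mem {p : CP3} {z : C4} {A : Op4} (hz : ‖z‖ = 1)
    (hp : proj p = rankOne ℂ z z) (hA : A ∈ tangentSpace p) :
    ⟪z, A z⟫ = 0 ∧ A = tvec z (A z) := by
  obtain ⟨h1, h2⟩ := hA
  have e : ∀ v, A v = ⟪z, v⟫ • A z + ⟪A z, v⟫ • z := by
    intro v
    have := congrArg (fun T : Op4 => T v) h2
    simp only [hp, add_apply, op_mul_apply, rankOne_apply, map_smul] at this
    rw [← this, ← adjoint_inner_right, h1]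
  constructor
  · have h3 := congrArg (fun x => ⟪z, x⟫) (e z)
    simp only [_root_.inner_add_right, _root_.inner_smul_right, inner_self_one hz] at h3
    have h4 : ⟪A z, z⟫ = ⟪z, A z⟫ := by rw [← adjoint_inner_right, h1]
    rw [h4] at h3
    linear_combination -h3
  · ext1 v
    rw [tvec_apply, ← e]

theorem J_tvec {p : CP3} {z w : C4} (hz : ‖z‖ = 1) (hp : proj p = rankOne ℂ z z)
    (h : ⟪z, w⟫ = 0) : J p (tvec z w) = tvec z (Complex.I • w) := by
  ext v i
  simp [J, hp, op_mul_apply, tvec_apply, hz, inner_zero_comm h, _root_.inner_smul_right,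
    _root_.inner_smul_left, h, _root_.inner_add_right]
  ring

theorem tangentProj_eq {p : CP3} {z : C4} {A : Op4}
    (hp : proj p = rankOne ℂ z z) (hA : adjoint A = A) :
    tangentProj p A = tvec z (A z - ⟪z, A z⟫ • z) := by
  ext1 v
  have h4 : ∀ v, ⟪z, A v⟫ = ⟪A z, v⟫ := fun v => by rw [← adjoint_inner_right, hA]
  simp only [tangentProj, hp, tvec_apply, add_apply, op_mul_apply, sub_apply, one_apply_eq_self,
    rankOne_apply, map_sub, map_smul, _root_.inner_sub_right, _root_.inner_smul_right,
    inner_sub_left, _root_.inner_smul_left, smul_sub, smul_smul, h4,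
    inner_conj_symm, sub_smul]
  module

end CP3
end

/-! ### Second derivatives and the second fundamental form of CP³ among operators -/

noncomputable section

/-- The second derivative of a map on `ℝ⁵`. -/
def secondDeriv {V : Type*} [NormedAddCommGroup V] [NormedSpace ℝ V]
    (F : EuclideanSpace ℝ (Fin 5) → V) (y u v : EuclideanSpace ℝ (Fin 5)) : V :=
  fderiv ℝ (fderiv ℝ F) y u v

section secondDeriv

variable {V : Type*} [NormedAddCommGroup V] [NormedSpace ℝ V]
  {F : EuclideanSpace ℝ (Fin 5) → V} {y : EuclideanSpace ℝ (Fin 5)}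

theorem differentiableAt_fderiv (hF : ContDiffAt ℝ ∞ F y) : DifferentiableAt ℝ (fderiv ℝ F) y :=
  (hF.fderiv_right (m := 1) (by norm_cast)).differentiableAt one_ne_zero

theorem fderiv_fderiv_apply (hF : ContDiffAt ℝ ∞ F y) (u v : EuclideanSpace ℝ (Fin 5)) :
    fderiv ℝ (fun x => fderiv ℝ F x v) y u = secondDeriv F y u v := by
  rw [fderiv_clm_apply (differentiableAt_fderiv hF) (differentiableAt_const v)]
  simp [secondDeriv]

theorem hasFDerivAt_fderiv_apply (hF : ContDiffAt ℝ ∞ F y) (v : EuclideanSpace ℝ (Fin 5)) :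
    DifferentiableAt ℝ (fun x => fderiv ℝ F x v) y :=
  (differentiableAt_fderiv hF).clm_apply (differentiableAt_const v)

theorem secondDeriv_comm (hF : ContDiffAt ℝ ∞ F y) (u v : EuclideanSpace ℝ (Fin 5)) :
    secondDeriv F y u v = secondDeriv F y v u :=
  (hF.isSymmSndFDerivAt (by simp; norm_cast)) u v

theorem eventually_contDiffAt (hF : ContDiffAt ℝ ∞ F y) : ∀ᶠ x in nhds y, ContDiffAt ℝ 2 F x :=
  (hF.of_le (by norm_cast)).eventually (by norm_num)

theorem secondDeriv_add_left (u u' v : EuclideanSpace ℝ (Fin 5)) :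
    secondDeriv F y (u + u') v = secondDeriv F y u v + secondDeriv F y u' v := by
  simp [secondDeriv]

theorem secondDeriv_add_right (u v v' : EuclideanSpace ℝ (Fin 5)) :
    secondDeriv F y u (v + v') = secondDeriv F y u v + secondDeriv F y u v' := by
  simp [secondDeriv]

theorem secondDeriv_smul_left (c : ℝ) (u v : EuclideanSpace ℝ (Fin 5)) :
    secondDeriv F y (c • u) v = c • secondDeriv F y u v := by
  simp [secondDeriv]

theorem secondDeriv_smul_right (c : ℝ) (u v : EuclideanSpace ℝ (Fin 5)) :
    secondDeriv F y u (c • v) = c • secondDeriv F y u v := by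
  simp [secondDeriv]

end secondDeriv

namespace CP3

open ContinuousLinearMap InnerProductSpace

local notation "⟪" x ", " y "⟫" => Inner.inner ℂ x y

theorem adjoint_proj (p : CP3) : adjoint (proj p) = proj p := by
  obtain ⟨z, -, h⟩ := exists_unit p
  simp [h]

theorem proj_mul_self (p : CP3) : proj p * proj p = proj p := by
  obtain ⟨z, hz, h⟩ := exists_unit p
  ext v i
  simp [h, op_mul_apply, hz]

/-- The adjoint as a real-linear continuous map. -/
def adjointR : Op4 →L[ℝ] Op4 :=
  LinearMap.toContinuousLinearMap
    { toFun := fun A => adjoint A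
      map_add' := fun A B => map_add _ A B
      map_smul' := fun c A => by
        rw [real_smul_eq, LinearIsometryEquiv.map_smulₛₗ, Complex.conj_ofReal, real_smul_eq]
        rfl }

variable {p : EuclideanSpace ℝ (Fin 5) → CP3} {y : EuclideanSpace ℝ (Fin 5)}

theorem adjoint_fderiv {G : EuclideanSpace ℝ (Fin 5) → Op4} (hG : DifferentiableAt ℝ G y)
    (h : ∀ᶠ x in nhds y, adjoint (G x) = G x) (v : EuclideanSpace ℝ (Fin 5)) :
    adjoint (fderiv ℝ G y v) = fderiv ℝ G y v := by
  have h1 := adjointR.hasFDerivAt.comp y hG.hasFDerivAt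
  have h2 : (fun x => adjointR (G x)) =ᶠ[nhds y] G := h
  have h3 := (h1.congr_of_eventuallyEq h2.symm).unique hG.hasFDerivAt
  exact congrArg (fun T => T v) h3

theorem fderiv_mul_op {G H : EuclideanSpace ℝ (Fin 5) → Op4} (hG : DifferentiableAt ℝ G y)
    (hH : DifferentiableAt ℝ H y) (v : EuclideanSpace ℝ (Fin 5)) :
    fderiv ℝ (fun x => G x * H x) y v = fderiv ℝ G y v * H y + G y * fderiv ℝ H y v := by
  rw [fderiv_fun_mul' hG hH, add_comm]
  rfl

theorem fderiv_proj_mem (h : DifferentiableAt ℝ (fun x => proj (p x)) y)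
    (v : EuclideanSpace ℝ (Fin 5)) :
    fderiv ℝ (fun x => proj (p x)) y v ∈ tangentSpace (p y) := by
  refine ⟨adjoint_fderiv h (.of_forall fun x => adjoint_proj _) v, ?_⟩
  rw [← fderiv_mul_op h h]
  simp only [proj_mul_self]

theorem adjoint_secondDeriv (h : ContDiffAt ℝ ∞ (fun x => proj (p x)) y)
    (u v : EuclideanSpace ℝ (Fin 5)) :
    adjoint (secondDeriv (fun x => proj (p x)) y u v) = secondDeriv (fun x => proj (p x)) y u v := by
  rw [← fderiv_fderiv_apply h]
  refine adjoint_fderiv (hasFDerivAt_fderiv_apply h v) ?_ u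
  filter_upwards [eventually_contDiffAt h] with x hx
  exact (fderiv_proj_mem (hx.differentiableAt (by norm_num)) v).1

/-- Tangency dP = dP·P + P·dP holds on a whole neighbourhood, so it can be differentiated once more.
-/
theorem secondDeriv_proj_eq (h : ContDiffAt ℝ ∞ (fun x => proj (p x)) y)
    (u v : EuclideanSpace ℝ (Fin 5)) :
    secondDeriv (fun x => proj (p x)) y u v =
      secondDeriv (fun x => proj (p x)) y u v * proj (p y) +
      fderiv ℝ (fun x => proj (p x)) y v * fderiv ℝ (fun x => proj (p x)) y u +
      (fderiv ℝ (fun x => proj (p x)) y u * fderiv ℝ (fun x => proj (p x)) y v +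
      proj (p y) * secondDeriv (fun x => proj (p x)) y u v) := by
  have hd := h.differentiableAt (by simp)
  have hd2 := hasFDerivAt_fderiv_apply h v
  have e : (fun x => fderiv ℝ (fun x => proj (p x)) x v) =ᶠ[nhds y] fun x =>
      fderiv ℝ (fun x => proj (p x)) x v * proj (p x) +
      proj (p x) * fderiv ℝ (fun x => proj (p x)) x v := by
    filter_upwards [eventually_contDiffAt h] with x hx
    exact (fderiv_proj_mem (hx.differentiableAt (by norm_num)) v).2.symm
  conv_lhs => rw [← fderiv_fderiv_apply h, e.fderiv_eq]
  rw [fderiv_fun_add (hd2.fun_mul hd) (hd.fun_mul hd2), add_apply, fderiv_mul_op hd2 hd,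
    fderiv_mul_op hd hd2, fderiv_fderiv_apply h]

/-- The second fundamental form of `CP³` in the space of operators. -/
def sffCP (z w w' : C4) : Op4 :=
  rankOne ℂ w w' + rankOne ℂ w' w - (2 * (⟪w, w'⟫).re) • rankOne ℂ z z

/-- The relation obtained by differentiating P² = P twice leaves only the off-diagonal blocks of the
second derivative free. These are the tangential part; the diagonal blocks are quadratic in the
first derivatives and form the normal part. -/
theorem secondDeriv_decomp (h : ContDiffAt ℝ ∞ (fun x => proj (p x)) y) {z : C4} (hz : ‖z‖ = 1)
    (hp : proj (p y) = rankOne ℂ z z) (u v : EuclideanSpace ℝ (Fin 5)) :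
    secondDeriv (fun x => proj (p x)) y u v =
      tangentProj (p y) (secondDeriv (fun x => proj (p x)) y u v) +
      sffCP z (fderiv ℝ (fun x => proj (p x)) y u z) (fderiv ℝ (fun x => proj (p x)) y v z) := by
  have h1 := adjoint_secondDeriv h u v
  have h2 := secondDeriv_proj_eq h u v
  rw [tangentProj_eq hp h1]
  have hd := h.differentiableAt (by simp)
  obtain ⟨hu, hu'⟩ := eq_tvec_of_mem hz hp (fderiv_proj_mem hd u)
  obtain ⟨hv, hv'⟩ := eq_tvec_of_mem hz hp (fderiv_proj_mem hd v)
  generalize secondDeriv (fun x => proj (p x)) y u v = Q at *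
  generalize fderiv ℝ (fun x => proj (p x)) y u = A at *
  generalize fderiv ℝ (fun x => proj (p x)) y v = B at *
  generalize hw : A z = w at *
  generalize hw' : B z = w' at *
  subst hu' hv'
  have h4 : ∀ v, ⟪z, Q v⟫ = ⟪Q z, v⟫ := fun v => by rw [← adjoint_inner_right, h1]
  have e : ∀ v, Q v = ⟪z, v⟫ • Q z + (⟪w, v⟫ • w' + ⟪z, v⟫ • ⟪w', w⟫ • z) +
      (⟪w', v⟫ • w + ⟪z, v⟫ • ⟪w, w'⟫ • z) + ⟪Q z, v⟫ • z := by
    intro x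
    have := congrArg (fun T : Op4 => T x) h2
    simp only [hp, add_apply, op_mul_apply, rankOne_apply, map_smul, tvec_apply,
      _root_.inner_add_right, _root_.inner_smul_right, inner_self_one hz, hu, hv, h4, map_add,
      inner_zero_comm hu, inner_zero_comm hv] at this
    rw [this]
    module
  have h5 : ⟪z, Q z⟫ = -(⟪w', w⟫ + ⟪w, w'⟫) := by
    have := congrArg (fun x => ⟪z, x⟫) (e z)
    simp only [_root_.inner_add_right, _root_.inner_smul_right, inner_self_one hz, hu, hv,
      inner_zero_comm hu, inner_zero_comm hv, ← h4] at this
    linear_combination -this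
  have h6 : ((2 * (⟪w, w'⟫).re : ℝ) : ℂ) = ⟪w', w⟫ + ⟪w, w'⟫ := by
    rw [← inner_conj_symm w' w, add_comm, Complex.add_conj]
  have h7 : (starRingEnd ℂ) ⟪z, Q z⟫ = ⟪z, Q z⟫ := by rw [inner_conj_symm, ← h4]
  ext1 x
  rw [e x]
  simp only [sffCP, add_apply, sub_apply, rankOne_apply, tvec_apply, inner_sub_left,
    _root_.inner_smul_left, h7, real_smul_eq, h6, smul_apply]
  rw [h5]
  module

theorem inner_tvec_sffCP {z q w w' : C4} (hq : ⟪z, q⟫ = 0) (h : ⟪z, w⟫ = 0) (h' : ⟪z, w'⟫ = 0) :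
    inner (tvec z q) (sffCP z w w') = 0 := by
  rw [sffCP, sub_eq_add_neg, ← neg_smul]
  simp only [tvec, inner_add_left, inner_add_right, inner_smul_right, inner_rankOne, h, h', hq,
    inner_zero_comm h, inner_zero_comm h', inner_zero_comm hq]
  simp

theorem inner_sffCP {z a b c d : C4} (hz : ‖z‖ = 1) (ha : ⟪z, a⟫ = 0) (hb : ⟪z, b⟫ = 0)
    (hc : ⟪z, c⟫ = 0) (hd : ⟪z, d⟫ = 0) :
    inner (sffCP z a b) (sffCP z c d) = 2 * (⟪a, b⟫).re * (⟪c, d⟫).re +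
      (⟪a, c⟫ * ⟪d, b⟫).re + (⟪a, d⟫ * ⟪c, b⟫).re := by
  simp only [sffCP, sub_eq_add_neg, ← neg_smul]
  simp only [inner_add_left, inner_add_right, inner_smul_right, inner_smul_left, inner_rankOne,
    ha, hb, hc, hd, inner_zero_comm ha, inner_zero_comm hb, inner_zero_comm hc,
    inner_zero_comm hd, inner_self_one hz]
  have e (x y : C4) : (⟪x, y⟫).re = (⟪y, x⟫).re ∧ (⟪x, y⟫).im = -(⟪y, x⟫).im := by
    rw [← inner_conj_symm x y]; exact ⟨Complex.conj_re _, Complex.conj_im _⟩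
  simp only [Complex.mul_re, (e b c).1, (e b c).2, (e b d).1, (e b d).2, (e d a).1, (e d a).2,
    (e c a).1, (e c a).2]
  simp
  ring

end CP3
end

/-! ### The Gauss equation in coordinates for an immersion into the operators -/

noncomputable section

namespace CP3

/-- The Euclidean inner product of operators as a continuous bilinear map. -/
def innerC : Op4 →L[ℝ] Op4 →L[ℝ] ℝ :=
  LinearMap.toContinuousBilinearMap innerB

theorem innerC_apply (A B : Op4) : innerC A B = inner A B := rfl

theorem inner_sum_left {ι : Type*} (s : Finset ι) (A : ι → Op4) (B : Op4) :
    inner (∑ i ∈ s, A i) B = ∑ i ∈ s, inner (A i) B := by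
  simp only [← innerC_apply, map_sum, sum_apply]

theorem inner_sum_right {ι : Type*} (s : Finset ι) (A : ι → Op4) (B : Op4) :
    inner B (∑ i ∈ s, A i) = ∑ i ∈ s, inner B (A i) := by
  simp only [← innerC_apply, map_sum]

theorem inner_sub_left (A B C : Op4) : inner (A - B) C = inner A C - inner B C := by
  simp only [← innerC_apply, map_sub, sub_apply]

variable {y : EuclideanSpace ℝ (Fin 5)}

theorem fderiv_inner {A B : EuclideanSpace ℝ (Fin 5) → Op4} (hA : DifferentiableAt ℝ A y)
    (hB : DifferentiableAt ℝ B y) (u : EuclideanSpace ℝ (Fin 5)) :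
    fderiv ℝ (fun x => inner (A x) (B x)) y u =
      inner (A y) (fderiv ℝ B y u) + inner (fderiv ℝ A y u) (B y) := by
  have := (innerC.hasFDerivAt_of_bilinear hA.hasFDerivAt hB.hasFDerivAt).fderiv
  simp only [innerC_apply] at this
  rw [this]
  rfl

theorem differentiableAt_inner {A B : EuclideanSpace ℝ (Fin 5) → Op4} (hA : DifferentiableAt ℝ A y)
    (hB : DifferentiableAt ℝ B y) : DifferentiableAt ℝ (fun x => inner (A x) (B x)) y :=
  (innerC.hasFDerivAt_of_bilinear hA.hasFDerivAt hB.hasFDerivAt).differentiableAt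

theorem contDiffAt_inner {n : WithTop ℕ∞} {A B : EuclideanSpace ℝ (Fin 5) → Op4}
    (hA : ContDiffAt ℝ n A y) (hB : ContDiffAt ℝ n B y) :
    ContDiffAt ℝ n (fun x => inner (A x) (B x)) y := by
  simp only [← innerC_apply]
  exact (contDiffAt_const.clm_apply hA).clm_apply hB

end CP3

namespace CoordinateMetric

open CP3

/-- The coordinate derivative `∂ᵢ G` of an operator-valued map. -/
def cd (G : EuclideanSpace ℝ (Fin 5) → Op4) (i : Fin 5) (y : EuclideanSpace ℝ (Fin 5)) : Op4 :=
  fderiv ℝ G y (EuclideanSpace.single i 1)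

/-- The second coordinate derivative `∂ᵢ ∂ⱼ G` of an operator-valued map. -/
def cd2 (G : EuclideanSpace ℝ (Fin 5) → Op4) (i j : Fin 5) (y : EuclideanSpace ℝ (Fin 5)) : Op4 :=
  secondDeriv G y (EuclideanSpace.single i 1) (EuclideanSpace.single j 1)

/-- The Gram matrix of the coordinate derivatives of `G`. -/
def gramOf (G : EuclideanSpace ℝ (Fin 5) → Op4) (y : EuclideanSpace ℝ (Fin 5)) :
    Matrix (Fin 5) (Fin 5) ℝ :=
  Matrix.of fun i j => inner (cd G i y) (cd G j y)

variable {G : EuclideanSpace ℝ (Fin 5) → Op4} {y : EuclideanSpace ℝ (Fin 5)}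

theorem eventually_smooth (hG : ContDiffAt ℝ ∞ G y) : ∀ᶠ x in nhds y, ContDiffAt ℝ 3 G x :=
  (hG.of_le (by norm_cast)).eventually (by norm_num)

theorem differentiableAt_cd (hG : ContDiffAt ℝ 2 G y) (i : Fin 5) :
    DifferentiableAt ℝ (cd G i) y :=
  ((hG.fderiv_right (m := 1) (by norm_num)).differentiableAt one_ne_zero).clm_apply
    (differentiableAt_const _)

theorem fderiv_cd (hG : ContDiffAt ℝ 2 G y) (i : Fin 5) (u : EuclideanSpace ℝ (Fin 5)) :
    fderiv ℝ (cd G i) y u = secondDeriv G y u (EuclideanSpace.single i 1) := by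
  unfold cd
  rw [fderiv_clm_apply ((hG.fderiv_right (m := 1) (by norm_num)).differentiableAt one_ne_zero)
    (differentiableAt_const _)]
  simp [secondDeriv]

theorem contDiffAt_cd {n m : WithTop ℕ∞} (hG : ContDiffAt ℝ n G y) (h : m + 1 ≤ n) (i : Fin 5) :
    ContDiffAt ℝ m (cd G i) y :=
  (hG.fderiv_right h).clm_apply contDiffAt_const

theorem contDiffAt_cd2 {n m : WithTop ℕ∞} (hG : ContDiffAt ℝ n G y) (h : m + 1 + 1 ≤ n)
    (i j : Fin 5) : ContDiffAt ℝ m (cd2 G i j) y :=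
  ((((hG.fderiv_right h).fderiv_right le_rfl)).clm_apply contDiffAt_const).clm_apply
    contDiffAt_const

theorem secondDeriv_comm' (hG : ContDiffAt ℝ 2 G y) (u v : EuclideanSpace ℝ (Fin 5)) :
    secondDeriv G y u v = secondDeriv G y v u :=
  (hG.isSymmSndFDerivAt (by simp)) u v

theorem partialDeriv_gramOf (hG : ContDiffAt ℝ 2 G y) (i j l : Fin 5) :
    partialDeriv i (fun z => gramOf G z j l) y =
      inner (cd2 G i j y) (cd G l y) + inner (cd G j y) (cd2 G i l y) := by
  have := fderiv_inner (differentiableAt_cd hG j) (differentiableAt_cd hG l)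
    (EuclideanSpace.single i 1)
  rw [fderiv_cd hG, fderiv_cd hG] at this
  rw [add_comm]
  exact this

theorem gramOf_apply (i j : Fin 5) : gramOf G y i j = inner (cd G i y) (cd G j y) := rfl

theorem gramOf_isSymm : (gramOf G y).IsSymm := by
  refine Matrix.IsSymm.ext fun i j => ?_
  rw [gramOf_apply, gramOf_apply, inner_comm]

theorem gramOf_inv_symm (i j : Fin 5) : (gramOf G y)⁻¹ i j = (gramOf G y)⁻¹ j i :=
  Matrix.IsSymm.apply (Matrix.IsSymm.inv gramOf_isSymm) j i

/-- Of the six terms in the derivatives of the Gram matrix, four cancel by symmetry of second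
derivatives and the other two coincide. -/
theorem christoffel_gramOf (hG : ContDiffAt ℝ 2 G y) (k i j : Fin 5) :
    christoffel (gramOf G) k i j y =
      ∑ l, (gramOf G y)⁻¹ k l * inner (cd2 G i j y) (cd G l y) := by
  rw [christoffel, Finset.mul_sum]
  refine Finset.sum_congr rfl fun l _ => ?_
  rw [partialDeriv_gramOf hG, partialDeriv_gramOf hG, partialDeriv_gramOf hG]
  have e (a b : Fin 5) : cd2 G a b y = cd2 G b a y := secondDeriv_comm' hG _ _
  rw [inner_comm (cd G j y), inner_comm (cd G i y) (cd2 G j l y), e j i, e l i, e l j,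
    inner_comm (cd G i y) (cd2 G j l y)]
  ring

theorem christoffel_mul_gramOf (hG : ContDiffAt ℝ 2 G y) (h : IsUnit (gramOf G y).det)
    (i j l : Fin 5) :
    ∑ m, christoffel (gramOf G) m i j y * gramOf G y m l = inner (cd2 G i j y) (cd G l y) := by
  have e : Matrix.vecMul (fun m => christoffel (gramOf G) m i j y) (gramOf G y) =
      fun l => inner (cd2 G i j y) (cd G l y) := by
    have : (fun m => christoffel (gramOf G) m i j y) =
        Matrix.vecMul (fun l => inner (cd2 G i j y) (cd G l y)) (gramOf G y)⁻¹ := by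
      funext m
      rw [christoffel_gramOf hG, Matrix.vecMul, dotProduct]
      refine Finset.sum_congr rfl fun l _ => ?_
      rw [gramOf_inv_symm, mul_comm]
    rw [this, Matrix.vecMul_vecMul, Matrix.nonsing_inv_mul _ h, Matrix.vecMul_one]
  exact congrFun e l

theorem contDiffAt_gramOf (hG : ContDiffAt ℝ 3 G y) (i j : Fin 5) :
    ContDiffAt ℝ 1 (fun x => gramOf G x i j) y := by
  simp only [gramOf_apply]
  exact contDiffAt_inner (contDiffAt_cd hG (by norm_num) i) (contDiffAt_cd hG (by norm_num) j)

theorem contDiffAt_det {n : ℕ} {A : EuclideanSpace ℝ (Fin 5) → Matrix (Fin n) (Fin n) ℝ}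
    (hA : ∀ i j, ContDiffAt ℝ 1 (fun x => A x i j) y) : ContDiffAt ℝ 1 (fun x => (A x).det) y := by
  simp only [Matrix.det_apply']
  refine ContDiffAt.sum fun σ _ => contDiffAt_const.mul ?_
  exact contDiffAt_prod fun i _ => hA _ _

/-- Cramer's rule: each entry is a cofactor divided by the nonvanishing determinant. -/
theorem contDiffAt_nonsing_inv (hG : ContDiffAt ℝ 3 G y) (h : IsUnit (gramOf G y).det)
    (i j : Fin 5) : ContDiffAt ℝ 1 (fun x => (gramOf G x)⁻¹ i j) y := by
  simp only [Matrix.inv_def, Ring.inverse_eq_inv', Matrix.smul_apply, smul_eq_mul,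
    Matrix.adjugate_apply]
  refine ((contDiffAt_det (contDiffAt_gramOf hG)).inv h.ne_zero).mul
    (contDiffAt_det fun a b => ?_)
  by_cases hab : a = j
  · subst hab; simp only [Matrix.updateRow_self]; exact contDiffAt_const
  · simp only [Matrix.updateRow_ne hab]; exact contDiffAt_gramOf hG _ _

theorem eventually_isUnit_det (hG : ContDiffAt ℝ ∞ G y) (h : IsUnit (gramOf G y).det) :
    ∀ᶠ x in nhds y, IsUnit (gramOf G x).det := by
  have := (contDiffAt_det (contDiffAt_gramOf (hG.of_le (by norm_cast)))).continuousAt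
  simp only [isUnit_iff_ne_zero] at *
  exact this.eventually_ne h

theorem differentiableAt_christoffel (hG : ContDiffAt ℝ ∞ G y) (h : IsUnit (gramOf G y).det)
    (k i j : Fin 5) : DifferentiableAt ℝ (christoffel (gramOf G) k i j) y := by
  have h3 : ContDiffAt ℝ 3 G y := hG.of_le (by norm_cast)
  have e : christoffel (gramOf G) k i j =ᶠ[nhds y] fun x =>
      ∑ l, (gramOf G x)⁻¹ k l * inner (cd2 G i j x) (cd G l x) := by
    filter_upwards [eventually_smooth hG] with x hx
    exact christoffel_gramOf (hx.of_le (by norm_num)) k i j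
  refine DifferentiableAt.congr_of_eventuallyEq ?_ e
  refine DifferentiableAt.fun_sum fun l _ => DifferentiableAt.mul ?_ (differentiableAt_inner ?_ ?_)
  · exact (contDiffAt_nonsing_inv h3 h k l).differentiableAt one_ne_zero
  · exact (contDiffAt_cd2 (m := 1) h3 (by norm_num) i j).differentiableAt one_ne_zero
  · exact differentiableAt_cd (h3.of_le (by norm_num)) l

/-- The normal component of `∂ᵢ ∂ⱼ G`. -/
def normalPart (G : EuclideanSpace ℝ (Fin 5) → Op4) (i j : Fin 5)
    (y : EuclideanSpace ℝ (Fin 5)) : Op4 :=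
  cd2 G i j y - ∑ m, christoffel (gramOf G) m i j y • cd G m y

theorem normalPart_inner (hG : ContDiffAt ℝ ∞ G y) (h : IsUnit (gramOf G y).det) (i j l : Fin 5) :
    inner (normalPart G i j y) (cd G l y) = 0 := by
  rw [normalPart, inner_sub_left, inner_sum_left,
    ← christoffel_mul_gramOf (hG.of_le (by norm_cast)) h, sub_eq_zero]
  exact Finset.sum_congr rfl fun m _ => by rw [inner_smul_left]; rfl

/-- Differentiating the lowered identity `christoffel_mul_gramOf` avoids any formula for the
derivative of the inverse metric. -/
theorem fderiv_christoffel (hG : ContDiffAt ℝ ∞ G y) (h : IsUnit (gramOf G y).det)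
    (i j k l : Fin 5) :
    ∑ m, partialDeriv i (christoffel (gramOf G) m j k) y * gramOf G y m l +
      ∑ m, christoffel (gramOf G) m j k y *
        (inner (cd2 G i m y) (cd G l y) + inner (cd G m y) (cd2 G i l y)) =
      inner (fderiv ℝ (cd2 G j k) y (EuclideanSpace.single i 1)) (cd G l y) +
        inner (cd2 G j k y) (cd2 G i l y) := by
  have h3 : ContDiffAt ℝ 3 G y := hG.of_le (by norm_cast)
  have h2 : ContDiffAt ℝ 2 G y := hG.of_le (by norm_cast)
  have e : (fun x => ∑ m, christoffel (gramOf G) m j k x * gramOf G x m l) =ᶠ[nhds y]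
      fun x => inner (cd2 G j k x) (cd G l x) := by
    filter_upwards [eventually_smooth hG, eventually_isUnit_det hG h] with x hx hx'
    exact christoffel_mul_gramOf (hx.of_le (by norm_num)) hx' j k l
  have hc2 := (contDiffAt_cd2 (m := 1) h3 (by norm_num) j k).differentiableAt one_ne_zero
  have e2 := congrArg (fun T : EuclideanSpace ℝ (Fin 5) →L[ℝ] ℝ => T (EuclideanSpace.single i 1))
    (e.fderiv_eq (𝕜 := ℝ))
  simp only [fderiv_inner hc2 (differentiableAt_cd h2 l), fderiv_cd h2] at e2
  have hd (m : Fin 5) : DifferentiableAt ℝ (fun x => gramOf G x m l) y :=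
    differentiableAt_inner (differentiableAt_cd h2 m) (differentiableAt_cd h2 l)
  have hm (m : Fin 5) : DifferentiableAt ℝ
      (fun x => christoffel (gramOf G) m j k x * gramOf G x m l) y :=
    (differentiableAt_christoffel hG h m j k).fun_mul (hd m)
  rw [fderiv_fun_sum fun m _ => hm m] at e2
  rw [add_comm (inner (fderiv ℝ _ _ _) _)]
  refine Eq.trans ?_ e2
  rw [sum_apply, ← Finset.sum_add_distrib]
  refine Finset.sum_congr rfl fun m _ => ?_
  rw [fderiv_fun_mul (differentiableAt_christoffel hG h m j k) (hd m), ← partialDeriv_gramOf h2]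
  simp only [partialDeriv, add_apply, smul_apply, smul_eq_mul]
  ring

theorem fderiv_cd2_comm (hG : ContDiffAt ℝ ∞ G y) (i j k : Fin 5) :
    fderiv ℝ (cd2 G j k) y (EuclideanSpace.single i 1) =
      fderiv ℝ (cd2 G i k) y (EuclideanSpace.single j 1) := by
  have h2 : ContDiffAt ℝ 2 (cd G k) y := contDiffAt_cd hG (by norm_cast) k
  have e (j) : cd2 G j k =ᶠ[nhds y] fun x => fderiv ℝ (cd G k) x (EuclideanSpace.single j 1) := by
    filter_upwards [eventually_smooth hG] with x hx
    rw [fderiv_cd (hx.of_le (by norm_num))]; rfl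
  have h4 (j i) : fderiv ℝ (cd2 G j k) y (EuclideanSpace.single i 1) =
      secondDeriv (cd G k) y (EuclideanSpace.single i 1) (EuclideanSpace.single j 1) := by
    rw [(e j).fderiv_eq]
    exact fderiv_cd (G := cd G k) h2 j _
  rw [h4, h4, secondDeriv_comm' h2]

/-- The Gauss equation of an immersion into the Euclidean space of operators. -/
theorem gauss_equation (hG : ContDiffAt ℝ ∞ G y) (h : IsUnit (gramOf G y).det)
    (k i j r : Fin 5) :
    ∑ l, curvature (gramOf G) l k i j y * gramOf G y l r =
      inner (normalPart G j k y) (cd2 G i r y) - inner (normalPart G i k y) (cd2 G j r y) := by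
  have h2 : ContDiffAt ℝ 2 G y := hG.of_le (by norm_cast)
  have e1 := fderiv_christoffel hG h i j k r
  have e2 := fderiv_christoffel hG h j i k r
  -- The third derivatives are symmetric, so they cancel when the two instances are subtracted and
  -- only products of second derivatives remain.
  rw [fderiv_cd2_comm hG i j k] at e1
  have e3 (i j : Fin 5) : ∑ l, (∑ m, christoffel (gramOf G) l i m y *
      christoffel (gramOf G) m j k y) * gramOf G y l r =
      ∑ m, christoffel (gramOf G) m j k y * inner (cd2 G i m y) (cd G r y) := by
    simp only [← christoffel_mul_gramOf h2 h, Finset.sum_mul, Finset.mul_sum]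
    rw [Finset.sum_comm]
    exact Finset.sum_congr rfl fun _ _ => Finset.sum_congr rfl fun _ _ => by ring
  have e4 (i j : Fin 5) : inner (normalPart G j k y) (cd2 G i r y) =
      inner (cd2 G j k y) (cd2 G i r y) -
        ∑ m, christoffel (gramOf G) m j k y * inner (cd G m y) (cd2 G i r y) := by
    rw [normalPart, inner_sub_left, inner_sum_left]
    simp only [inner_smul_left]
  rw [e4, e4]
  simp only [curvature, add_mul, sub_mul, Finset.sum_add_distrib, Finset.sum_sub_distrib, e3]
  simp only [mul_add, Finset.sum_add_distrib] at e1 e2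
  linarith

theorem ricci_gramOf (hG : ContDiffAt ℝ ∞ G y) (h : IsUnit (gramOf G y).det) (j k : Fin 5) :
    ricci (gramOf G) j k y = ∑ i, ∑ r, (gramOf G y)⁻¹ i r *
      (inner (normalPart G j k y) (cd2 G i r y) - inner (normalPart G i k y) (cd2 G j r y)) := by
  simp only [← gauss_equation hG h, ricci]
  refine Finset.sum_congr rfl fun i _ => ?_
  have e : Matrix.vecMul (Matrix.vecMul (fun l => curvature (gramOf G) l k i j y) (gramOf G y))
      (gramOf G y)⁻¹ i = curvature (gramOf G) i k i j y := by
    rw [Matrix.vecMul_vecMul, Matrix.mul_nonsing_inv _ h, Matrix.vecMul_one]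
  rw [← e]
  simp only [Matrix.vecMul, dotProduct]
  refine Finset.sum_congr rfl fun r _ => ?_
  rw [gramOf_inv_symm, mul_comm]

end CoordinateMetric
end

/-! ### Orthonormal frames and coordinates of ℂ⁴ adapted to a hyperplane of the tangent space -/

noncomputable section

namespace CP3

open ContinuousLinearMap InnerProductSpace CoordinateMetric

local notation "⟪" x ", " y "⟫" => Inner.inner ℂ x y
local notation "ℝ⁵" => EuclideanSpace ℝ (Fin 5)

theorem inner_self_pos {p : CP3} {A : Op4} (hA : A ∈ tangentSpace p) (h : A ≠ 0) :
    0 < inner A A := by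
  obtain ⟨z, hz, hp⟩ := exists_unit p
  obtain ⟨h1, h2⟩ := eq_tvec_of_mem hz hp hA
  rw [h2, inner_tvec hz h1 h1]
  have : A z ≠ 0 := by
    intro h0
    rw [h0] at h2
    exact h (h2.trans (by simp [tvec]))
  have h3 : 0 < ‖A z‖ := norm_pos_iff.2 this
  have h4 := norm_sq_eq_re_inner (𝕜 := ℂ) (A z)
  change 0 < RCLike.re ⟪A z, A z⟫
  rw [← h4]
  positivity

theorem tvec_inner_apply {p : CP3} {z : C4} {A B : Op4} (hz : ‖z‖ = 1)
    (hp : proj p = rankOne ℂ z z) (hA : A ∈ tangentSpace p) (hB : B ∈ tangentSpace p) :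
    inner A B = (⟪A z, B z⟫).re := by
  obtain ⟨h1, h2⟩ := eq_tvec_of_mem hz hp hA
  obtain ⟨h3, h4⟩ := eq_tvec_of_mem hz hp hB
  conv_lhs => rw [h2, h4]
  rw [inner_tvec hz h1 h3]

theorem apply_eq_zero {p : CP3} {z : C4} {A : Op4} (hz : ‖z‖ = 1)
    (hp : proj p = rankOne ℂ z z) (hA : A ∈ tangentSpace p) (h : A z = 0) : A = 0 := by
  obtain ⟨h1, h2⟩ := eq_tvec_of_mem hz hp hA
  rw [h2, h]; simp [tvec]

theorem clm_apply_eq_sum {V : Type*} [NormedAddCommGroup V] [NormedSpace ℝ V] (D : ℝ⁵ →L[ℝ] V)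
    (v : ℝ⁵) : D v = ∑ i, v i • D (EuclideanSpace.single i 1) := by
  conv_lhs => rw [← (EuclideanSpace.basisFun (Fin 5) ℝ).sum_repr v]
  simp

/-- The differential at a point of a real hypersurface in coordinates, together with a unit
normal vector. -/
structure HyperplaneAt (p : CP3) (D : ℝ⁵ →L[ℝ] Op4) (ξ : Op4) : Prop where
  mem : ∀ v, D v ∈ tangentSpace p
  inj : ∀ v, D v = 0 → v = 0
  tangent : ξ ∈ tangentSpace p
  normal : ∀ v, inner ξ (D v) = 0
  unit : inner ξ ξ = 1

/-- A basis that is orthonormal for the metric induced by `D`. -/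
def IsOrthoFrame (D : ℝ⁵ →L[ℝ] Op4) (E : Fin 5 → ℝ⁵) : Prop :=
  ∀ a b, inner (D (E a)) (D (E b)) = if a = b then 1 else 0

/-- An orthogonal basis exists for every symmetric form; injectivity of D and positivity on the
tangent space of CP³ allow it to be normalised. -/
theorem exists_orthoFrame {p : CP3} {D : ℝ⁵ →L[ℝ] Op4} (mem : ∀ v, D v ∈ tangentSpace p)
    (inj : ∀ v, D v = 0 → v = 0) : ∃ E, IsOrthoFrame D E := by
  let B : LinearMap.BilinForm ℝ ℝ⁵ := innerB.compl₁₂ D.toLinearMap D.toLinearMap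
  have hB (u v) : B u v = inner (D u) (D v) := rfl
  have hs : LinearMap.IsSymm B := ⟨fun u v => by simp [hB, inner_comm (D u)]⟩
  obtain ⟨v, hv⟩ := LinearMap.BilinForm.exists_orthogonal_basis hs
  have hf : Module.finrank ℝ ℝ⁵ = 5 := by simp
  let w := v.reindex (finCongr hf)
  have hw (a b : Fin 5) (h : a ≠ b) : inner (D (w a)) (D (w b)) = 0 := by
    have : B (w a) (w b) = 0 := by
      simp only [w, Module.Basis.reindex_apply]
      exact hv (by simpa using h)
    exact this
  have hpos (a : Fin 5) : 0 < inner (D (w a)) (D (w a)) :=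
    inner_self_pos (mem _) fun h => w.ne_zero a (inj _ h)
  refine ⟨fun a => (√(inner (D (w a)) (D (w a))))⁻¹ • w a, fun a b => ?_⟩
  simp only [map_smul, inner_smul_left, inner_smul_right]
  split_ifs with h
  · subst h
    have := Real.mul_self_sqrt (hpos a).le
    have h0 := (Real.sqrt_pos.2 (hpos a)).ne'
    generalize √(inner (D (w a)) (D (w a))) = r at *
    rw [← this]; field_simp
  · rw [hw a b h]; simp

section frame

variable {D : ℝ⁵ →L[ℝ] Op4} {E : Fin 5 → ℝ⁵}

/-- The Gram matrix of the metric induced by `D`. -/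
def gramD (D : ℝ⁵ →L[ℝ] Op4) : Matrix (Fin 5) (Fin 5) ℝ :=
  Matrix.of fun i j =>
    inner (D (EuclideanSpace.single i 1)) (D (EuclideanSpace.single j 1))

theorem frame_gram (hE : IsOrthoFrame D E) :
    (Matrix.of fun a i => E a i) * gramD D * (Matrix.of fun i a => E a i) = 1 := by
  ext a b
  rw [Matrix.one_apply, ← hE a b]
  conv_rhs => rw [clm_apply_eq_sum D (E a), clm_apply_eq_sum D (E b)]
  simp only [inner_sum_left, inner_sum_right, inner_smul_left, inner_smul_right, Matrix.mul_apply,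
    Finset.sum_mul, Finset.mul_sum, Matrix.of_apply, gramD]
  exact Finset.sum_congr rfl fun _ _ => Finset.sum_congr rfl fun _ _ => by ring

theorem gramD_inv (hE : IsOrthoFrame D E) :
    (gramD D)⁻¹ = (Matrix.of fun i a => E a i) * (Matrix.of fun a i => E a i) := by
  have h1 := frame_gram hE
  have h2 := mul_eq_one_comm.1 h1
  rw [← mul_assoc] at h2
  exact Matrix.inv_eq_left_inv h2

theorem isUnit_gramD (hE : IsOrthoFrame D E) : IsUnit (gramD D).det := by
  have h1 := congrArg Matrix.det (frame_gram hE)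
  rw [Matrix.det_mul, Matrix.det_mul, Matrix.det_one] at h1
  exact isUnit_iff_ne_zero.2 fun h => by simp [h] at h1

/-- With the frame vectors as the rows of E, orthonormality E G Eᵀ = 1 gives G⁻¹ = Eᵀ E. This
converts the coordinate contractions in the definitions of Ricci, mean curvature and tangential part
into sums over a frame. -/
theorem frame_sum {V : Type*} [NormedAddCommGroup V] [NormedSpace ℝ V] (hE : IsOrthoFrame D E)
    (β : ℝ⁵ →ₗ[ℝ] ℝ⁵ →ₗ[ℝ] V) :
    ∑ i, ∑ j, (gramD D)⁻¹ i j • β (EuclideanSpace.single i 1) (EuclideanSpace.single j 1) =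
      ∑ a, β (E a) (E a) := by
  have e (a) : E a = ∑ i, E a i • EuclideanSpace.single i (1 : ℝ) := by
    conv_lhs => rw [← (EuclideanSpace.basisFun (Fin 5) ℝ).sum_repr (E a)]
    simp
  have e2 (a) : β (E a) (E a) = ∑ i, ∑ j, (E a i * E a j) •
      β (EuclideanSpace.single i 1) (EuclideanSpace.single j 1) := by
    conv_lhs => rw [e a]
    simp only [map_sum, map_smul, LinearMap.sum_apply, LinearMap.smul_apply, Finset.smul_sum,
      smul_smul]
    rw [Finset.sum_comm]
    exact Finset.sum_congr rfl fun _ _ => Finset.sum_congr rfl fun _ _ => by rw [mul_comm]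
  simp only [e2, gramD_inv hE, Matrix.mul_apply, Matrix.of_apply, Finset.sum_smul]
  conv_rhs => rw [Finset.sum_comm]
  refine Finset.sum_congr rfl fun i _ => ?_
  exact Finset.sum_comm

end frame

/-- The coordinates of `ℂ⁴` adapted to a hypersurface of `CP³`. -/
def coordMap (D : ℝ⁵ →L[ℝ] Op4) (z n : C4) : (ℝ⁵ × ℝ × ℂ) →L[ℝ] C4 :=
  ((ContinuousLinearMap.apply ℝ C4 z).comp
    ((ContinuousLinearMap.restrictScalarsL ℂ C4 C4 ℝ ℝ).comp D)).comp
      (ContinuousLinearMap.fst ℝ _ _) +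
  ((ContinuousLinearMap.fst ℝ ℝ ℂ).comp (ContinuousLinearMap.snd ℝ ℝ⁵ (ℝ × ℂ))).smulRight n +
  (((ContinuousLinearMap.toSpanSingleton ℂ z).restrictScalars ℝ).comp
    ((ContinuousLinearMap.snd ℝ ℝ ℂ).comp (ContinuousLinearMap.snd ℝ ℝ⁵ (ℝ × ℂ))))

theorem coordMap_apply (D : ℝ⁵ →L[ℝ] Op4) (z n : C4) (v : ℝ⁵) (t : ℝ) (c : ℂ) :
    coordMap D z n (v, t, c) = D v z + t • n + c • z := by
  simp [coordMap]

end CP3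
end

/-! ### Decomposition into tangent part, normal part and the complex line itself -/

noncomputable section

namespace CP3

open ContinuousLinearMap InnerProductSpace CoordinateMetric

local notation "⟪" x ", " y "⟫" => Inner.inner ℂ x y
local notation "ℝ⁵" => EuclideanSpace ℝ (Fin 5)

/-- Pairing with z isolates c, the real part of the pairing with n isolates t, and injectivity of D
then kills v. -/
theorem coordMap_injective {p : CP3} {D : ℝ⁵ →L[ℝ] Op4} {z n : C4} (hz : ‖z‖ = 1)
    (hp : proj p = rankOne ℂ z z) (mem : ∀ v, D v ∈ tangentSpace p)
    (inj : ∀ v, D v = 0 → v = 0) (hzn : ⟪z, n⟫ = 0) (hn : ‖n‖ = 1)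
    (normal : ∀ v, (⟪n, D v z⟫).re = 0) : Function.Injective (coordMap D z n) := by
  rw [injective_iff_map_eq_zero]
  rintro ⟨v, t, c⟩ h
  rw [coordMap_apply] at h
  have hv : ⟪z, D v z⟫ = 0 := (eq_tvec_of_mem hz hp (mem v)).1
  have hc : c = 0 := by
    have := congrArg (fun x => ⟪z, x⟫) h
    simpa [_root_.inner_add_right, hv, ← Complex.coe_smul, _root_.inner_smul_right, hzn, hz]
      using this
  subst hc
  have ht : t = 0 := by
    have := congrArg (fun x => (⟪n, x⟫).re) h
    simpa [_root_.inner_add_right, normal v, ← Complex.coe_smul, _root_.inner_smul_right, hn,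
      ← Complex.ofReal_pow] using this
  subst ht
  have : v = 0 := inj v (apply_eq_zero hz hp (mem v) (by simpa using h))
  simp [this]

theorem finrank_coord : Module.finrank ℝ (ℝ⁵ × ℝ × ℂ) = Module.finrank ℝ C4 := by
  have : Module.finrank ℝ C4 = 8 := by
    rw [← Module.finrank_mul_finrank ℝ ℂ C4]; simp
  rw [this]; simp

variable {p : CP3} {D : ℝ⁵ →L[ℝ] Op4} {ξ : Op4} {E : Fin 5 → ℝ⁵}

theorem HyperplaneAt.norm_apply (h : HyperplaneAt p D ξ) {z : C4} (hz : ‖z‖ = 1)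
    (hp : proj p = rankOne ℂ z z) : ‖ξ z‖ = 1 := by
  have := h.unit
  rw [tvec_inner_apply hz hp h.tangent h.tangent] at this
  have h4 := norm_sq_eq_re_inner (𝕜 := ℂ) (ξ z)
  have h5 : ‖ξ z‖ ^ 2 = 1 := h4.trans this
  exact (pow_eq_one_iff_of_nonneg (norm_nonneg _) two_ne_zero).1 h5

theorem HyperplaneAt.coordMap_surjective (h : HyperplaneAt p D ξ) {z : C4} (hz : ‖z‖ = 1)
    (hp : proj p = rankOne ℂ z z) : Function.Surjective (coordMap D z (ξ z)) := by
  refine (LinearMap.injective_iff_surjective_of_finrank_eq_finrank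
    (f := (coordMap D z (ξ z)).toLinearMap) finrank_coord).1
    (coordMap_injective hz hp h.mem h.inj (eq_tvec_of_mem hz hp h.tangent).1
      (h.norm_apply hz hp) fun v => ?_)
  rw [← tvec_inner_apply hz hp h.tangent (h.mem v), h.normal]

theorem HyperplaneAt.exists_decomp (h : HyperplaneAt p D ξ) {A : Op4} (hA : A ∈ tangentSpace p) :
    ∃ v, A = D v + inner A ξ • ξ := by
  obtain ⟨z, hz, hp⟩ := exists_unit p
  obtain ⟨⟨v, t, c⟩, hv⟩ := h.coordMap_surjective hz hp (A z)
  rw [coordMap_apply] at hv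
  have hv0 : ⟪z, D v z⟫ = 0 := (eq_tvec_of_mem hz hp (h.mem v)).1
  have hA0 := eq_tvec_of_mem hz hp hA
  have hξ := eq_tvec_of_mem hz hp h.tangent
  have hc : c = 0 := by
    have := congrArg (fun x => ⟪z, x⟫) hv
    simpa [_root_.inner_add_right, hv0, ← Complex.coe_smul, _root_.inner_smul_right, hξ.1, hz, hA0.1]
      using this
  subst hc
  have e : A = D v + t • ξ := by
    rw [hA0.2, ← hv, (eq_tvec_of_mem hz hp (h.mem v)).2]
    conv_rhs => rw [hξ.2]
    rw [← tvec_smul, ← tvec_add, tvec_self hz hv0]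
    simp
  have ht : inner A ξ = t := by
    rw [e, inner_add_left, inner_smul_left, h.unit, inner_comm, h.normal]; ring
  exact ⟨v, by rw [ht]; exact e⟩

/-- Five orthonormal vectors of a five-dimensional space are automatically a basis: here this is the
fact that one-sided inverses of square matrices are two-sided. -/
theorem IsOrthoFrame.eq_sum (hE : IsOrthoFrame D E) (v : ℝ⁵) : v = ∑ a, inner (D v) (D (E a)) • E a := by
  have h1 := mul_eq_one_comm.1 (frame_gram hE)
  rw [← mul_assoc] at h1
  have h2 := mul_eq_one_comm.1 h1
  have key := congrArg (fun M => Matrix.mulVec M v) (mul_eq_one_comm.1 h2)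
  simp only [Matrix.one_mulVec] at key
  ext i
  rw [← congrFun key i, ← Matrix.mulVec_mulVec, ← Matrix.mulVec_mulVec]
  have e (a) : inner (D v) (D (E a)) =
      Matrix.mulVec (Matrix.of fun a i => E a i) (Matrix.mulVec (gramD D) v) a := by
    rw [clm_apply_eq_sum D v, clm_apply_eq_sum D (E a)]
    simp only [inner_sum_left, inner_sum_right, inner_smul_left, inner_smul_right, Matrix.mulVec,
      dotProduct, Finset.mul_sum, Matrix.of_apply, gramD]
    refine Finset.sum_congr rfl fun _ _ => Finset.sum_congr rfl fun _ _ => ?_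
    rw [inner_comm]; ring
  simp only [e]
  simp [Matrix.mulVec, dotProduct, mul_comm]

/-- The orthogonal projection to the tangent space of the hypersurface, in an orthonormal frame. -/
theorem HyperplaneAt.eq_sum (h : HyperplaneAt p D ξ) (hE : IsOrthoFrame D E) {A : Op4}
    (hA : A ∈ tangentSpace p) :
    A = ∑ a, inner A (D (E a)) • D (E a) + inner A ξ • ξ := by
  obtain ⟨v, hv⟩ := h.exists_decomp hA
  have e (a) : inner A (D (E a)) = inner (D v) (D (E a)) := by
    rw [hv, inner_add_left, inner_smul_left, h.normal]; ring
  simp only [e]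
  have e2 := congrArg D (hE.eq_sum v)
  simp only [map_sum, map_smul] at e2
  rw [← e2]
  exact hv

end CP3
end

/-! ### Ricci curvature of a hypersurface in the direction Jξ -/

noncomputable section

namespace CP3

open ContinuousLinearMap InnerProductSpace CoordinateMetric

local notation "⟪" x ", " y "⟫" => Inner.inner ℂ x y
local notation "ℝ⁵" => EuclideanSpace ℝ (Fin 5)

theorem op_add_smul (c d : ℝ) (A : Op4) : (c + d) • A = c • A + d • A := add_smul c d A

theorem op_zero_smul (A : Op4) : (0 : ℝ) • A = 0 := zero_smul ℝ A

theorem op_sum_smul {ι : Type*} (s : Finset ι) (c : ι → ℝ) (A : Op4) :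
    (∑ i ∈ s, c i) • A = ∑ i ∈ s, c i • A := by
  exact Finset.sum_smul (f := c) (s := s) (x := A)

/-- The component of an operator orthogonal to the range of `D`, in the orthonormal frame `E`. -/
def orthoPart (D : ℝ⁵ →L[ℝ] Op4) (E : Fin 5 → ℝ⁵) (A : Op4) : Op4 :=
  A - ∑ a, inner A (D (E a)) • D (E a)

section

variable {D : ℝ⁵ →L[ℝ] Op4} {E : Fin 5 → ℝ⁵}

theorem orthoPart_add (A B : Op4) : orthoPart D E (A + B) = orthoPart D E A + orthoPart D E B := by
  simp only [orthoPart, inner_add_left, op_add_smul, Finset.sum_add_distrib]; abel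

theorem orthoPart_smul (c : ℝ) (A : Op4) : orthoPart D E (c • A) = c • orthoPart D E A := by
  simp only [orthoPart, inner_smul_left, smul_sub, Finset.smul_sum, smul_smul]

theorem orthoPart_sum (A : Fin 5 → Op4) :
    orthoPart D E (∑ i, A i) = ∑ i, orthoPart D E (A i) := by
  simp only [orthoPart, inner_sum_left, op_sum_smul, Finset.sum_sub_distrib]
  rw [Finset.sum_comm]

theorem orthoPart_eq_sub (hE : IsOrthoFrame D E) {A : Op4} {v : ℝ⁵}
    (h : ∀ w, inner (A - D v) (D w) = 0) : orthoPart D E A = A - D v := by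
  have e (a) : inner A (D (E a)) = inner (D v) (D (E a)) := by
    have := h (E a)
    rw [inner_sub_left] at this
    linarith
  have e2 := congrArg D (hE.eq_sum v)
  simp only [map_sum, map_smul] at e2
  simp only [orthoPart, e, ← e2]

end

theorem secondDeriv_eq_sum_left (G : ℝ⁵ → Op4) (y u v : ℝ⁵) :
    secondDeriv G y u v = ∑ i, u i • secondDeriv G y (EuclideanSpace.single i 1) v := by
  rw [secondDeriv, clm_apply_eq_sum _ u, sum_apply]
  rfl

theorem secondDeriv_eq_sum_right (G : ℝ⁵ → Op4) (y u v : ℝ⁵) :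
    secondDeriv G y u v = ∑ i, v i • secondDeriv G y u (EuclideanSpace.single i 1) :=
  clm_apply_eq_sum _ v

variable {p : ℝ⁵ → CP3} {y : ℝ⁵} {ξ : Op4} {E : Fin 5 → ℝ⁵}

/-- The second fundamental form of a hypersurface in coordinates, relative to the unit
normal `ξ`. -/
def hs (p : ℝ⁵ → CP3) (y : ℝ⁵) (ξ : Op4) (u v : ℝ⁵) : ℝ :=
  inner (secondDeriv (fun x => proj (p x)) y u v) ξ

theorem hs_comm (hG : ContDiffAt ℝ ∞ (fun x => proj (p x)) y) (u v : ℝ⁵) :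
    hs p y ξ u v = hs p y ξ v u := by
  rw [hs, secondDeriv_comm hG]; rfl

theorem hs_add_left (u u' v : ℝ⁵) : hs p y ξ (u + u') v = hs p y ξ u v + hs p y ξ u' v := by
  simp [hs, secondDeriv_add_left, inner_add_left]

theorem hs_add_right (u v v' : ℝ⁵) : hs p y ξ u (v + v') = hs p y ξ u v + hs p y ξ u v' := by
  simp [hs, secondDeriv_add_right, inner_add_left]

theorem hs_smul_left (c : ℝ) (u v : ℝ⁵) : hs p y ξ (c • u) v = c * hs p y ξ u v := by
  simp [hs, secondDeriv_smul_left, inner_smul_left]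

theorem hs_smul_right (c : ℝ) (u v : ℝ⁵) : hs p y ξ u (c • v) = c * hs p y ξ u v := by
  simp [hs, secondDeriv_smul_right, inner_smul_left]

theorem tangentProj_mem (q : CP3) {A : Op4} (hA : adjoint A = A) :
    tangentProj q A ∈ tangentSpace q := by
  obtain ⟨z, hz, hp⟩ := exists_unit q
  rw [tangentProj_eq hp hA]
  refine tvec_mem hz hp ?_
  simp [_root_.inner_sub_right, _root_.inner_smul_right, hz]

theorem J_mem {q : CP3} {A : Op4} (hA : A ∈ tangentSpace q) : J q A ∈ tangentSpace q := by
  obtain ⟨z, hz, hp⟩ := exists_unit q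
  obtain ⟨h1, h2⟩ := eq_tvec_of_mem hz hp hA
  rw [h2, J_tvec hz hp h1]
  exact tvec_mem hz hp (by rw [_root_.inner_smul_right, h1, mul_zero])

theorem J_apply {q : CP3} {z : C4} (hz : ‖z‖ = 1) (hp : proj q = rankOne ℂ z z) {A : Op4}
    (hA : A ∈ tangentSpace q) : J q A z = Complex.I • A z := by
  obtain ⟨h1, h2⟩ := eq_tvec_of_mem hz hp hA
  conv_lhs => rw [h2, J_tvec hz hp h1]
  exact tvec_self hz (by rw [_root_.inner_smul_right, h1, mul_zero])

theorem inner_J {q : CP3} {A B : Op4} (hA : A ∈ tangentSpace q) (hB : B ∈ tangentSpace q) :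
    inner (J q A) (J q B) = inner A B := by
  obtain ⟨z, hz, hp⟩ := exists_unit q
  rw [tvec_inner_apply hz hp (J_mem hA) (J_mem hB), tvec_inner_apply hz hp hA hB,
    J_apply hz hp hA, J_apply hz hp hB, _root_.inner_smul_left, _root_.inner_smul_right]
  simp [← mul_assoc]

theorem inner_J_left {q : CP3} {A B : Op4} (hA : A ∈ tangentSpace q) (hB : B ∈ tangentSpace q) :
    inner (J q A) B = -inner A (J q B) := by
  obtain ⟨z, hz, hp⟩ := exists_unit q
  rw [tvec_inner_apply hz hp (J_mem hA) hB, tvec_inner_apply hz hp hA (J_mem hB),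
    J_apply hz hp hA, J_apply hz hp hB, _root_.inner_smul_left, _root_.inner_smul_right]
  simp

theorem inner_sffCP_tangent {q : CP3} {z a b : C4} (hz : ‖z‖ = 1) (hp : proj q = rankOne ℂ z z)
    (ha : ⟪z, a⟫ = 0) (hb : ⟪z, b⟫ = 0) {A : Op4} (hA : A ∈ tangentSpace q) :
    inner (sffCP z a b) A = 0 := by
  obtain ⟨h1, h2⟩ := eq_tvec_of_mem hz hp hA
  rw [inner_comm, h2, inner_tvec_sffCP h1 ha hb]

section

variable (hG : ContDiffAt ℝ ∞ (fun x => proj (p x)) y)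
  (h : HyperplaneAt (p y) (fderiv ℝ (fun x => proj (p x)) y) ξ)

include hG h in
theorem inner_tangentProj_secondDeriv (u v : ℝ⁵) :
    inner (tangentProj (p y) (secondDeriv (fun x => proj (p x)) y u v)) ξ = hs p y ξ u v := by
  obtain ⟨z, hz, hp⟩ := exists_unit (p y)
  have hw (v) := (eq_tvec_of_mem hz hp (h.mem v)).1
  rw [hs]
  conv_rhs => rw [secondDeriv_decomp hG hz hp, inner_add_left,
    inner_sffCP_tangent hz hp (hw _) (hw _) h.tangent, add_zero]

include hG h in
-- The flat second derivative has three mutually orthogonal pieces: tangent to the hypersurface,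
-- along ξ, and normal to CP³. Only the first is removed.
theorem orthoPart_secondDeriv (hE : IsOrthoFrame (fderiv ℝ (fun x => proj (p x)) y) E) {z : C4}
    (hz : ‖z‖ = 1) (hp : proj (p y) = rankOne ℂ z z) (u v : ℝ⁵) :
    orthoPart (fderiv ℝ (fun x => proj (p x)) y) E (secondDeriv (fun x => proj (p x)) y u v) =
      hs p y ξ u v • ξ + sffCP z (fderiv ℝ (fun x => proj (p x)) y u z)
        (fderiv ℝ (fun x => proj (p x)) y v z) := by
  have hw (v) := (eq_tvec_of_mem hz hp (h.mem v)).1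
  conv_lhs => rw [secondDeriv_decomp hG hz hp, orthoPart_add]
  have h1 := h.eq_sum hE (tangentProj_mem (p y) (adjoint_secondDeriv hG u v))
  congr 1
  · rw [orthoPart, ← inner_tangentProj_secondDeriv hG h]
    conv_lhs => enter [1]; rw [h1]
    abel
  · simp [orthoPart, inner_sffCP_tangent hz hp (hw u) (hw v) (h.mem _), op_zero_smul]

/-- The Christoffel correction is itself in the range of D, and what remains is orthogonal to that
range, so it is the orthogonal projection computed in any frame. -/
theorem normalPart_eq (hG : ContDiffAt ℝ ∞ (fun x => proj (p x)) y)
    (hE : IsOrthoFrame (fderiv ℝ (fun x => proj (p x)) y) E) (i j : Fin 5) :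
    normalPart (fun x => proj (p x)) i j y =
      orthoPart (fderiv ℝ (fun x => proj (p x)) y) E (cd2 (fun x => proj (p x)) i j y) := by
  have hu : IsUnit (gramOf (fun x => proj (p x)) y).det := isUnit_gramD hE
  have e : normalPart (fun x => proj (p x)) i j y = cd2 (fun x => proj (p x)) i j y -
      fderiv ℝ (fun x => proj (p x)) y
        (∑ m, christoffel (gramOf (fun x => proj (p x))) m i j y • EuclideanSpace.single m 1) := by
    simp [normalPart, cd]
  rw [e]
  refine (orthoPart_eq_sub hE fun w => ?_).symm
  rw [← e, clm_apply_eq_sum _ w, inner_sum_right]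
  refine Finset.sum_eq_zero fun l _ => ?_
  rw [inner_smul_right]
  exact mul_eq_zero_of_right _ (normalPart_inner hG hu i j l)

theorem ricci_eq_sum (hG : ContDiffAt ℝ ∞ (fun x => proj (p x)) y)
    (hE : IsOrthoFrame (fderiv ℝ (fun x => proj (p x)) y) E) (u : ℝ⁵) :
    ∑ j, ∑ k, CoordinateMetric.ricci (gramOf fun x => proj (p x)) j k y * u j * u k =
      ∑ c, (inner (orthoPart (fderiv ℝ (fun x => proj (p x)) y) E
          (secondDeriv (fun x => proj (p x)) y u u)) (secondDeriv (fun x => proj (p x)) y (E c) (E c))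
        - inner (orthoPart (fderiv ℝ (fun x => proj (p x)) y) E
          (secondDeriv (fun x => proj (p x)) y (E c) u))
            (secondDeriv (fun x => proj (p x)) y u (E c))) := by
  have hu : IsUnit (gramOf (fun x => proj (p x)) y).det := isUnit_gramD hE
  simp only [ricci_gramOf hG hu, normalPart_eq hG hE, cd2]
  have hg : gramOf (fun x => proj (p x)) y = gramD (fderiv ℝ (fun x => proj (p x)) y) := rfl
  rw [hg]
  clear hu hg
  generalize fderiv ℝ (fun x => proj (p x)) y = D at *
  -- For fixed j and k, the contracted Gauss equation is the metric trace of this bilinear form.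
  have e1 (j k : Fin 5) := frame_sum hE (LinearMap.mk₂ ℝ
    (fun a b => inner (orthoPart D E (secondDeriv (fun x => proj (p x)) y
        (EuclideanSpace.single j 1) (EuclideanSpace.single k 1)))
          (secondDeriv (fun x => proj (p x)) y a b) -
      inner (orthoPart D E (secondDeriv (fun x => proj (p x)) y a (EuclideanSpace.single k 1)))
          (secondDeriv (fun x => proj (p x)) y (EuclideanSpace.single j 1) b))
    (by intros; simp only [secondDeriv_add_left, orthoPart_add, inner_add_left, inner_add_right]
        ring)
    (by intros; simp only [secondDeriv_smul_left, orthoPart_smul, inner_smul_left,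
          inner_smul_right, smul_eq_mul]
        ring)
    (by intros; simp only [secondDeriv_add_right, orthoPart_add, inner_add_left, inner_add_right]
        ring)
    (by intros; simp only [secondDeriv_smul_right, orthoPart_smul, inner_smul_left,
          inner_smul_right, smul_eq_mul]
        ring))
  simp only [LinearMap.mk₂_apply, smul_eq_mul] at e1
  have e2 (c : Fin 5) : inner (orthoPart D E (secondDeriv (fun x => proj (p x)) y u u))
        (secondDeriv (fun x => proj (p x)) y (E c) (E c)) =
      ∑ j, ∑ k, inner (orthoPart D E (secondDeriv (fun x => proj (p x)) y
        (EuclideanSpace.single j 1) (EuclideanSpace.single k 1)))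
          (secondDeriv (fun x => proj (p x)) y (E c) (E c)) * u j * u k := by
    rw [secondDeriv_eq_sum_left]
    simp only [orthoPart_sum, orthoPart_smul, inner_sum_left, inner_smul_left,
      secondDeriv_eq_sum_right _ _ _ u, Finset.mul_sum]
    exact Finset.sum_congr rfl fun _ _ => Finset.sum_congr rfl fun _ _ => by ring
  have e3 (c : Fin 5) : inner (orthoPart D E (secondDeriv (fun x => proj (p x)) y (E c) u))
        (secondDeriv (fun x => proj (p x)) y u (E c)) =
      ∑ j, ∑ k, inner (orthoPart D E (secondDeriv (fun x => proj (p x)) y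
        (E c) (EuclideanSpace.single k 1)))
          (secondDeriv (fun x => proj (p x)) y (EuclideanSpace.single j 1) (E c)) * u j * u k := by
    rw [secondDeriv_eq_sum_left _ _ u]
    simp only [orthoPart_sum, orthoPart_smul, inner_sum_left, inner_smul_left, inner_sum_right,
      inner_smul_right, secondDeriv_eq_sum_right _ _ _ u, Finset.mul_sum, Finset.sum_mul]
    exact Finset.sum_congr rfl fun _ _ => Finset.sum_congr rfl fun _ _ => by ring
  simp only [e1, e2, e3, ← Finset.sum_sub_distrib, Finset.sum_mul]
  conv_rhs => rw [Finset.sum_comm]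
  refine Finset.sum_congr rfl fun j _ => ?_
  conv_rhs => rw [Finset.sum_comm]
  exact Finset.sum_congr rfl fun k _ => Finset.sum_congr rfl fun c _ => by ring

include hG h in
/-- The Ricci curvature of a hypersurface of `CP³` in the direction of its structure vector. -/
theorem ricci_structure_vector (hE : IsOrthoFrame (fderiv ℝ (fun x => proj (p x)) y) E) (u : ℝ⁵)
    (hu : fderiv ℝ (fun x => proj (p x)) y u = J (p y) ξ) :
    ∑ j, ∑ k, CoordinateMetric.ricci (gramOf fun x => proj (p x)) j k y * u j * u k =
      4 + (∑ c, hs p y ξ (E c) (E c)) * hs p y ξ u u - ∑ c, hs p y ξ u (E c) ^ 2 := by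
  obtain ⟨z, hz, hp⟩ := exists_unit (p y)
  have hw (v) := (eq_tvec_of_mem hz hp (h.mem v)).1
  obtain ⟨hn, hn'⟩ := eq_tvec_of_mem hz hp h.tangent
  have hIn : ⟪z, Complex.I • ξ z⟫ = 0 := by rw [_root_.inner_smul_right, hn, mul_zero]
  have huz : fderiv ℝ (fun x => proj (p x)) y u z = Complex.I • ξ z := by
    rw [hu, hn', J_tvec hz hp hn, tvec_self hz hIn, tvec_self hz hn]
  have hξ := inner_self_one (h.norm_apply hz hp)
  -- Each frame vector contributes a term in h plus the sectional curvature part of CP³. The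
  -- holomorphic contribution to the latter involves the pairing of ξ with the frame vector and
  -- vanishes, leaving 1 - ⟨u, E c⟩²; these sum to 5 - 1 = 4.
  have hc (c : Fin 5) : inner (orthoPart (fderiv ℝ (fun x => proj (p x)) y) E
          (secondDeriv (fun x => proj (p x)) y u u)) (secondDeriv (fun x => proj (p x)) y (E c) (E c))
        - inner (orthoPart (fderiv ℝ (fun x => proj (p x)) y) E
          (secondDeriv (fun x => proj (p x)) y (E c) u))
            (secondDeriv (fun x => proj (p x)) y u (E c)) =
      hs p y ξ u u * hs p y ξ (E c) (E c) - hs p y ξ u (E c) ^ 2 +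
        (1 - inner (fderiv ℝ (fun x => proj (p x)) y u)
          (fderiv ℝ (fun x => proj (p x)) y (E c)) ^ 2) := by
    have key (a b c d : ℝ⁵) : inner (orthoPart (fderiv ℝ (fun x => proj (p x)) y) E
        (secondDeriv (fun x => proj (p x)) y a b)) (secondDeriv (fun x => proj (p x)) y c d) =
        hs p y ξ a b * hs p y ξ c d +
        inner (sffCP z (fderiv ℝ (fun x => proj (p x)) y a z)
          (fderiv ℝ (fun x => proj (p x)) y b z))
        (sffCP z (fderiv ℝ (fun x => proj (p x)) y c z)
          (fderiv ℝ (fun x => proj (p x)) y d z)) := by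
      rw [orthoPart_secondDeriv hG h hE hz hp, inner_add_left, inner_smul_left]
      congr 1
      · rw [inner_comm]; rfl
      · rw [secondDeriv_decomp hG hz hp c d, inner_add_right,
          inner_sffCP_tangent hz hp (hw _) (hw _)
            (tangentProj_mem _ (adjoint_secondDeriv hG c d)), zero_add]
    rw [key, key, inner_sffCP hz (hw _) (hw _) (hw _) (hw _),
      inner_sffCP hz (hw _) (hw _) (hw _) (hw _), tvec_inner_apply hz hp (h.mem _) (h.mem _), huz,
      hs_comm hG (E c) u]
    have h1 : (⟪fderiv ℝ (fun x => proj (p x)) y (E c) z,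
        fderiv ℝ (fun x => proj (p x)) y (E c) z⟫).re = 1 := by
      rw [← tvec_inner_apply hz hp (h.mem _) (h.mem _), hE c c, if_pos rfl]
    have h1' : (⟪fderiv ℝ (fun x => proj (p x)) y (E c) z,
        fderiv ℝ (fun x => proj (p x)) y (E c) z⟫).im = 0 :=
      inner_self_im (𝕜 := ℂ) (fderiv ℝ (fun x => proj (p x)) y (E c) z)
    have h2 : (⟪ξ z, fderiv ℝ (fun x => proj (p x)) y (E c) z⟫).re = 0 := by
      rw [← tvec_inner_apply hz hp h.tangent (h.mem _), h.normal]
    have h3 := inner_conj_symm (𝕜 := ℂ) (fderiv ℝ (fun x => proj (p x)) y (E c) z) (ξ z)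
    simp only [_root_.inner_smul_left, _root_.inner_smul_right, hξ, ← h3]
    simp only [Complex.mul_re, Complex.mul_im, Complex.conj_re, Complex.conj_im, Complex.I_re,
      Complex.I_im, Complex.one_re, Complex.one_im, h1, h1', h2]
    ring
  rw [ricci_eq_sum hG hE]
  simp only [hc, Finset.sum_add_distrib, Finset.sum_sub_distrib]
  have hsum : ∑ c, inner (fderiv ℝ (fun x => proj (p x)) y u)
      (fderiv ℝ (fun x => proj (p x)) y (E c)) ^ 2 = 1 := by
    have h5 : inner (fderiv ℝ (fun x => proj (p x)) y u) (fderiv ℝ (fun x => proj (p x)) y u) = 1 := by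
      rw [tvec_inner_apply hz hp (h.mem _) (h.mem _), huz]
      rw [_root_.inner_smul_left, _root_.inner_smul_right, hξ]
      simp
    rw [← h5]
    conv_rhs => rw [hE.eq_sum u]
    simp only [map_sum, map_smul, inner_sum_left, inner_sum_right, inner_smul_left,
      inner_smul_right, hE _ _]
    simp [sq]
  rw [hsum, ← Finset.mul_sum]
  simp
  ring

end

end CP3
end

/-! ### The curvature bound for real hypersurfaces -/

noncomputable section

namespace RealHypersurface

open ContinuousLinearMap InnerProductSpace CoordinateMetric CP3

local notation "ℝ⁵" => EuclideanSpace ℝ (Fin 5)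

variable {N : Type*} [TopologicalSpace N] [ChartedSpace ℝ⁵ N]

/-- A hypersurface in the preferred chart at `x`, as a map into `CP³`. -/
def localMap (f : N → CP3) (x : N) (y : ℝ⁵) : CP3 := f ((extChartAt (𝓡 5) x).symm y)

theorem localMap_self (f : N → CP3) (x : N) : localMap f x (extChartAt (𝓡 5) x x) = f x := by
  rw [localMap, extChartAt_to_inv]

theorem local_rep_eq (f : N → CP3) (x : N) : local_rep f x = fun y => proj (localMap f x y) := rfl

theorem isOpen_target (x : N) : IsOpen (extChartAt (𝓡 5) x).target :=
  isOpen_extChartAt_target x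

variable [IsManifold (𝓡 5) ∞ N] {f : N → CP3}

theorem contDiffAt_localMap (hf : IsHypersurface f) (x : N) {y : ℝ⁵}
    (hy : y ∈ (extChartAt (𝓡 5) x).target) :
    ContDiffAt ℝ ∞ (fun y => proj (localMap f x y)) y := by
  rw [← contMDiffAt_iff_contDiffAt]
  have h1 : ContMDiffAt 𝓘(ℝ, ℝ⁵) (𝓡 5) ∞ (extChartAt (𝓡 5) x).symm y :=
    (contMDiffOn_extChartAt_symm x).contMDiffAt ((isOpen_target x).mem_nhds hy)
  exact (hf.smooth _).comp y h1

theorem differential_eq (hf : IsHypersurface f) (x : N) (u : ℝ⁵) :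
    differential f x u =
      fderiv ℝ (fun y => proj (localMap f x y)) (extChartAt (𝓡 5) x x) u := by
  have h := ((hf.smooth x).mdifferentiableAt (by simp)).mfderiv
  change mfderiv (𝓡 5) 𝓘(ℝ, Op4) (fun x => proj (f x)) x u = _
  rw [h]
  simp only [modelWithCornersSelf_coe, Set.range_id, fderivWithin_univ]
  rfl

theorem differential_mem (hf : IsHypersurface f) (x : N) (v : ℝ⁵) :
    fderiv ℝ (fun y => proj (localMap f x y)) (extChartAt (𝓡 5) x x) v ∈
      tangentSpace (localMap f x (extChartAt (𝓡 5) x x)) :=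
  fderiv_proj_mem ((contDiffAt_localMap hf x (mem_extChartAt_target x)).differentiableAt
    (by simp)) v

theorem differential_inj (hf : IsHypersurface f) (x : N) (v : ℝ⁵)
    (h : fderiv ℝ (fun y => proj (localMap f x y)) (extChartAt (𝓡 5) x x) v = 0) : v = 0 := by
  refine hf.immersion x (a₂ := (0 : TangentSpace (𝓡 5) x)) ?_
  rw [map_zero]
  exact (differential_eq hf x v).trans h

theorem IsUnitNormal.hyperplaneAt (hf : IsHypersurface f) {x : N} {ξ : Op4}
    (hξ : IsUnitNormal f x ξ) :
    HyperplaneAt (localMap f x (extChartAt (𝓡 5) x x))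
      (fderiv ℝ (fun y => proj (localMap f x y)) (extChartAt (𝓡 5) x x)) ξ where
  mem := differential_mem hf x
  inj := differential_inj hf x
  tangent := by rw [localMap_self]; exact hξ.tangent
  normal v := by rw [← differential_eq hf x v]; exact hξ.normal v
  unit := hξ.unit

theorem gram_eq (f : N → CP3) (x : N) :
    gram f x (extChartAt (𝓡 5) x x) =
      gramD (fderiv ℝ (fun y => proj (localMap f x y)) (extChartAt (𝓡 5) x x)) := rfl

theorem tangentialPart_eq {x : N} {E : Fin 5 → ℝ⁵}
    (hE : IsOrthoFrame (fderiv ℝ (fun y => proj (localMap f x y)) (extChartAt (𝓡 5) x x)) E)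
    (A : Op4) :
    A - tangentialPart f x A =
      orthoPart (fderiv ℝ (fun y => proj (localMap f x y)) (extChartAt (𝓡 5) x x)) E A := by
  rw [orthoPart, tangentialPart, gram_eq]
  simp only [coordField, local_rep_eq]
  generalize fderiv ℝ (fun y => proj (localMap f x y)) (extChartAt (𝓡 5) x x) = D at *
  have := frame_sum hE (LinearMap.mk₂ ℝ (fun a b => inner A (D b) • D a)
    (by intros; simp only [map_add, smul_add])
    (by intros; simp only [map_smul]; rw [smul_comm])
    (by intros; simp only [map_add, inner_add_right, op_add_smul])
    (by intros; simp only [map_smul, inner_smul_right, smul_smul]))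
  simp only [LinearMap.mk₂_apply, smul_smul] at this
  rw [this]

/-- The normal line in the tangent space of CP³ is spanned by ξ. The coefficient may be read from
the flat second derivative, since its component normal to CP³ is orthogonal to ξ. -/
theorem sff_eq (hf : IsHypersurface f) {x : N} {ξ : Op4} (hξ : IsUnitNormal f x ξ)
    (u v : ℝ⁵) :
    sff f x u v = hs (localMap f x) (extChartAt (𝓡 5) x x) ξ u v • ξ := by
  have hG := contDiffAt_localMap hf x (mem_extChartAt_target x)
  have h := hξ.hyperplaneAt hf
  obtain ⟨E, hE⟩ := exists_orthoFrame h.mem h.inj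
  have e : ambientCovDeriv f x u v = tangentProj (localMap f x (extChartAt (𝓡 5) x x))
      (secondDeriv (fun y => proj (localMap f x y)) (extChartAt (𝓡 5) x x) u v) := by
    rw [← fderiv_fderiv_apply hG, localMap_self]; rfl
  have hm := tangentProj_mem (localMap f x (extChartAt (𝓡 5) x x)) (adjoint_secondDeriv hG u v)
  have h1 := h.eq_sum hE hm
  have h2 : sff f x u v = ambientCovDeriv f x u v -
    tangentialPart f x (ambientCovDeriv f x u v) := rfl
  rw [h2, tangentialPart_eq hE, e, orthoPart, ← inner_tangentProj_secondDeriv hG h]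
  conv_lhs => enter [1]; rw [h1]
  abel

theorem meanCurvatureVector_eq (hf : IsHypersurface f) {x : N} {ξ : Op4}
    (hξ : IsUnitNormal f x ξ) {E : Fin 5 → ℝ⁵}
    (hE : IsOrthoFrame (fderiv ℝ (fun y => proj (localMap f x y)) (extChartAt (𝓡 5) x x)) E) :
    meanCurvatureVector f x =
      (1 / 5 * ∑ a, hs (localMap f x) (extChartAt (𝓡 5) x x) ξ (E a) (E a)) • ξ := by
  have := frame_sum hE (LinearMap.mk₂ ℝ
    (fun a b => hs (localMap f x) (extChartAt (𝓡 5) x x) ξ a b • ξ)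
    (by intros; rw [hs_add_left, op_add_smul])
    (by intros; rw [hs_smul_left, smul_smul])
    (by intros; rw [hs_add_right, op_add_smul])
    (by intros; rw [hs_smul_right, smul_smul]))
  simp only [LinearMap.mk₂_apply] at this
  rw [meanCurvatureVector, gram_eq]
  rw [mul_smul, op_sum_smul, ← this]
  congr 1
  refine Finset.sum_congr rfl fun i _ => Finset.sum_congr rfl fun j _ => ?_
  congr 1
  exact sff_eq hf hξ _ _

theorem sqMeanCurvature_eq (hf : IsHypersurface f) {x : N} {ξ : Op4}
    (hξ : IsUnitNormal f x ξ) {E : Fin 5 → ℝ⁵}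
    (hE : IsOrthoFrame (fderiv ℝ (fun y => proj (localMap f x y)) (extChartAt (𝓡 5) x x)) E) :
    sqMeanCurvature f x =
      (1 / 5 * ∑ a, hs (localMap f x) (extChartAt (𝓡 5) x x) ξ (E a) (E a)) ^ 2 := by
  rw [sqMeanCurvature, meanCurvatureVector_eq hf hξ hE, inner_smul_left, inner_smul_right, hξ.unit]
  ring

theorem ricci_eq (hf : IsHypersurface f) {x : N} {ξ : Op4}
    (hξ : IsUnitNormal f x ξ) {E : Fin 5 → ℝ⁵}
    (hE : IsOrthoFrame (fderiv ℝ (fun y => proj (localMap f x y)) (extChartAt (𝓡 5) x x)) E)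
    {u : ℝ⁵} (hu : differential f x u = J (f x) ξ) :
    ricci f x u u = 4 + (∑ c, hs (localMap f x) (extChartAt (𝓡 5) x x) ξ (E c) (E c)) *
      hs (localMap f x) (extChartAt (𝓡 5) x x) ξ u u -
        ∑ c, hs (localMap f x) (extChartAt (𝓡 5) x x) ξ u (E c) ^ 2 := by
  have hG := contDiffAt_localMap hf x (mem_extChartAt_target x)
  rw [← ricci_structure_vector hG (hξ.hyperplaneAt hf) hE u
    (by rw [localMap_self, ← hu]; exact (differential_eq hf x u).symm)]
  rfl

theorem orthoFrame_expand {x : N} {ξ : Op4} {E : Fin 5 → ℝ⁵}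
    (hE : IsOrthoFrame (fderiv ℝ (fun y => proj (localMap f x y)) (extChartAt (𝓡 5) x x)) E)
    (u v : ℝ⁵) :
    hs (localMap f x) (extChartAt (𝓡 5) x x) ξ u v = ∑ a,
      inner (fderiv ℝ (fun y => proj (localMap f x y)) (extChartAt (𝓡 5) x x) v)
        (fderiv ℝ (fun y => proj (localMap f x y)) (extChartAt (𝓡 5) x x) (E a)) *
      hs (localMap f x) (extChartAt (𝓡 5) x x) ξ u (E a) := by
  conv_lhs => rw [hE.eq_sum v, hs, secondDeriv, map_sum]
  simp only [map_smul, inner_sum_left, inner_smul_left]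
  rfl

/-- The Ricci curvature of the structure vector is bounded by the squared mean curvature. -/
theorem ricci_le (hf : IsHypersurface f) {x : N} {ξ : Op4}
    (hξ : IsUnitNormal f x ξ) {u : ℝ⁵} (hu : differential f x u = J (f x) ξ) :
    ricci f x u u ≤ 25 / 2 * sqMeanCurvature f x + 4 ∧
    (ricci f x u u = 25 / 2 * sqMeanCurvature f x + 4 →
      (∀ v, hs (localMap f x) (extChartAt (𝓡 5) x x) ξ u v = 0) ∧
      ∀ E : Fin 5 → ℝ⁵,
        IsOrthoFrame (fderiv ℝ (fun y => proj (localMap f x y)) (extChartAt (𝓡 5) x x)) E →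
          ∑ a, hs (localMap f x) (extChartAt (𝓡 5) x x) ξ (E a) (E a) = 0) := by
  have h := hξ.hyperplaneAt hf
  -- Cauchy–Schwarz, as u has length one because J is an isometry.
  have key (E : Fin 5 → ℝ⁵) (hE : IsOrthoFrame
      (fderiv ℝ (fun y => proj (localMap f x y)) (extChartAt (𝓡 5) x x)) E) :
      hs (localMap f x) (extChartAt (𝓡 5) x x) ξ u u ^ 2 ≤
        ∑ c, hs (localMap f x) (extChartAt (𝓡 5) x x) ξ u (E c) ^ 2 := by
    have h1 : ∑ a, inner (fderiv ℝ (fun y => proj (localMap f x y)) (extChartAt (𝓡 5) x x) u)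
        (fderiv ℝ (fun y => proj (localMap f x y)) (extChartAt (𝓡 5) x x) (E a)) ^ 2 = 1 := by
      have h5 : inner (fderiv ℝ (fun y => proj (localMap f x y)) (extChartAt (𝓡 5) x x) u)
        (fderiv ℝ (fun y => proj (localMap f x y)) (extChartAt (𝓡 5) x x) u) = 1 := by
        rw [← differential_eq hf x u, hu, inner_J hξ.tangent hξ.tangent, hξ.unit]
      rw [← h5]
      conv_rhs => rw [hE.eq_sum u]
      simp only [map_sum, map_smul, inner_sum_left, inner_sum_right, inner_smul_left,
        inner_smul_right, hE _ _]
      simp [sq]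
    rw [orthoFrame_expand hE u u]
    refine (Finset.sum_mul_sq_le_sq_mul_sq _ _ _).trans ?_
    rw [h1, one_mul]
  obtain ⟨E, hE⟩ := exists_orthoFrame h.mem h.inj
  rw [ricci_eq hf hξ hE hu, sqMeanCurvature_eq hf hξ hE]
  have hk := key E hE
  generalize ht : ∑ c, hs (localMap f x) (extChartAt (𝓡 5) x x) ξ (E c) (E c) = t at *
  generalize hs' : ∑ c, hs (localMap f x) (extChartAt (𝓡 5) x x) ξ u (E c) ^ 2 = s at *
  generalize hs (localMap f x) (extChartAt (𝓡 5) x x) ξ u u = c at *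
  -- With c = h(u, u), the slack t²/2 - tc + s equals ((t - c)² + c²)/2 + (s - c²). All terms are
  -- nonnegative, so equality forces c = t = s = 0.
  refine ⟨by nlinarith [sq_nonneg (t - c), sq_nonneg c], fun heq => ?_⟩
  have hs0 : s = 0 := by
    have h2 : 0 ≤ s := hs' ▸ Finset.sum_nonneg fun _ _ => sq_nonneg _
    nlinarith [sq_nonneg (t - c), sq_nonneg c]
  have ht0 : t = 0 := by
    have hc : c = 0 := by nlinarith
    subst hc
    nlinarith
  constructor
  · intro v
    have hz (a : Fin 5) : hs (localMap f x) (extChartAt (𝓡 5) x x) ξ u (E a) = 0 := by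
      have := (Finset.sum_eq_zero_iff_of_nonneg (fun _ _ => sq_nonneg _)).1 (hs'.trans hs0) a
        (Finset.mem_univ a)
      exact pow_eq_zero_iff two_ne_zero |>.1 this
    rw [orthoFrame_expand hE u v]
    simp only [hz, mul_zero, Finset.sum_const_zero]
  · intro E' hE'
    -- The trace vanishes in one frame, hence in all, because the mean curvature vector does not see
    -- the frame.
    have h1 := meanCurvatureVector_eq hf hξ hE
    rw [meanCurvatureVector_eq hf hξ hE', ht, ht0] at h1
    have h2 := congrArg (fun A => inner A ξ) h1
    simp only [CP3.inner_smul_left, hξ.unit] at h2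
    linarith

end RealHypersurface
end

/-! ### From the diagonal frame to equality -/

noncomputable section

namespace RealHypersurface

open ContinuousLinearMap InnerProductSpace CoordinateMetric CP3

local notation "ℝ⁵" => EuclideanSpace ℝ (Fin 5)

variable {N : Type*} [TopologicalSpace N] [ChartedSpace ℝ⁵ N] [IsManifold (𝓡 5) ∞ N] {f : N → CP3}

/-- The normal `ξ₀` of the frame need not be the given ξ; only the factor `inner ξ₀ ξ` enters. The
diagonal is trace-free for every value of `l`, and its last entry is zero. -/
theorem ricci_eq_of_frame (hf : IsHypersurface f) {x : N} {ξ ξ₀ : Op4} (hξ : IsUnitNormal f x ξ)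
    {u : ℝ⁵} (hu : differential f x u = J (f x) ξ)
    (e : Fin 5 → ℝ⁵) (l : ℝ) (he : ∀ a b, metric f x (e a) (e b) = if a = b then 1 else 0)
    (h2 : differential f x (e 2) = J (f x) (differential f x (e 0)))
    (h3 : differential f x (e 3) = J (f x) (differential f x (e 1)))
    (hσ : ∀ a b, sff f x (e a) (e b) =
      Matrix.diagonal ![l, -l, 1 / l, -(1 / l), 0] a b • ξ₀) :
    ricci f x u u = 25 / 2 * sqMeanCurvature f x + 4 := by
  have hE : IsOrthoFrame (fderiv ℝ (fun y => proj (localMap f x y)) (extChartAt (𝓡 5) x x)) e := by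
    intro a b
    rw [← differential_eq hf, ← differential_eq hf, ← he a b]
    rfl
  have hm (v : ℝ⁵) : differential f x v ∈ tangentSpace (f x) := by
    rw [differential_eq hf]
    exact localMap_self f x ▸ differential_mem hf x v
  have key (a b) : hs (localMap f x) (extChartAt (𝓡 5) x x) ξ (e a) (e b) =
      Matrix.diagonal ![l, -l, 1 / l, -(1 / l), 0] a b * inner ξ₀ ξ := by
    have h1 := congrArg (fun A => inner A ξ) ((sff_eq hf hξ (e a) (e b)).symm.trans (hσ a b))
    simpa only [CP3.inner_smul_left, hξ.unit, mul_one] using h1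
  have ht : ∑ c, hs (localMap f x) (extChartAt (𝓡 5) x x) ξ (e c) (e c) = 0 := by
    simp only [key, Fin.sum_univ_five, Matrix.diagonal_apply_eq]
    simp
  -- Jξ is orthogonal to v and Jv whenever both are tangent. Hence u is orthogonal to the first four
  -- frame vectors and lies along the fifth, the kernel direction.
  have hJ (v w : ℝ⁵) (h : differential f x w = J (f x) (differential f x v)) :
      inner (differential f x u) (differential f x v) = 0 ∧
      inner (differential f x u) (differential f x w) = 0 := by
    have hn (v : ℝ⁵) : inner ξ (differential f x v) = 0 := hξ.normal v
    rw [hu, inner_J_left hξ.tangent (hm v), ← h, hn, h, inner_J hξ.tangent (hm v), hn]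
    simp
  have hz (b) : hs (localMap f x) (extChartAt (𝓡 5) x x) ξ u (e b) = 0 := by
    rw [hs_comm (contDiffAt_localMap hf x (mem_extChartAt_target x)), orthoFrame_expand hE]
    simp only [← differential_eq hf, Fin.sum_univ_five, (hJ _ _ h2).1, (hJ _ _ h2).2,
      (hJ _ _ h3).1, (hJ _ _ h3).2, zero_mul, zero_add, key]
    fin_cases b <;> simp [Matrix.diagonal_apply]
  rw [ricci_eq hf hξ hE hu, sqMeanCurvature_eq hf hξ hE, ht]
  simp only [hz]
  simp

end RealHypersurface
end

/-! ### Connection forms with vanishing structure curvature: structure equations and the focal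
surface -/

noncomputable section

namespace HopfForms

open ComplexConjugate

local notation "ℝ⁵" => EuclideanSpace ℝ (Fin 5)

/-- The connection forms of a unitary frame of `ℂ⁴` adapted to a real hypersurface of `CP³` whose
structure vector is a principal direction with vanishing principal curvature. -/
structure IsHopf (W : Set ℝ⁵) (Ω : Fin 4 → Fin 4 → ℝ⁵ → ℝ⁵ → ℂ) : Prop where
  skew : ∀ y ∈ W, ∀ i j v, conj (Ω i j y v) = -Ω j i y v
  diff : ∀ y ∈ W, ∀ i j v, DifferentiableAt ℝ (fun x => Ω i j x v) y
  flat : ∀ y ∈ W, ∀ i j u v,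
    fderiv ℝ (fun x => Ω i j x v) y u - fderiv ℝ (fun x => Ω i j x u) y v =
      ∑ k, (Ω i k y v * Ω k j y u - Ω i k y u * Ω k j y v)
  normal : ∀ y ∈ W, ∀ v, Ω 0 1 y v = Ω 1 0 y v
  hopf : ∀ y ∈ W, ∀ v, Ω 1 1 y v = Ω 0 0 y v
  surj : ∀ y ∈ W, ∀ w₁ w₂, ∃ u, Ω 2 0 y u = w₁ ∧ Ω 3 0 y u = w₂

variable {W : Set ℝ⁵} {Ω : Fin 4 → Fin 4 → ℝ⁵ → ℝ⁵ → ℂ} {y : ℝ⁵}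

theorem fderiv_eq_of_eqOn (hW : IsOpen W) (hy : y ∈ W) {g h : ℝ⁵ → ℂ} (e : ∀ x ∈ W, g x = h x) :
    fderiv ℝ g y = fderiv ℝ h y :=
  Filter.EventuallyEq.fderiv_eq (Filter.eventually_of_mem (hW.mem_nhds hy) e)

/-- Equality of Ω₁₁ and Ω₀₀ on an open set gives equality of their exterior derivatives. The
products involving indices 0 and 1 cancel, and the rest says that the shape operator preserves the
Kähler form, AJA = J. -/
theorem IsHopf.kaehler (h : IsHopf W Ω) (hW : IsOpen W) (hy : y ∈ W) (u v : ℝ⁵) :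
    conj (Ω 2 1 y u) * Ω 2 1 y v + conj (Ω 3 1 y u) * Ω 3 1 y v -
      (conj (Ω 2 1 y v) * Ω 2 1 y u + conj (Ω 3 1 y v) * Ω 3 1 y u) =
    conj (Ω 2 0 y u) * Ω 2 0 y v + conj (Ω 3 0 y u) * Ω 3 0 y v -
      (conj (Ω 2 0 y v) * Ω 2 0 y u + conj (Ω 3 0 y v) * Ω 3 0 y u) := by
  have h0 := h.flat y hy 0 0 u v
  have h1 := h.flat y hy 1 1 u v
  rw [fderiv_eq_of_eqOn hW hy (fun x hx => h.hopf x hx v),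
    fderiv_eq_of_eqOn hW hy (fun x hx => h.hopf x hx u), h0] at h1
  simp only [Fin.sum_univ_four, h.normal y hy] at h1
  simp only [h.skew y hy]
  linear_combination -h1

/-- Comparing the exterior derivatives of Ω₀₁ and Ω₁₀ expresses that the shape operator is
self-adjoint. -/
theorem IsHopf.symm (h : IsHopf W Ω) (hW : IsOpen W) (hy : y ∈ W) (u v : ℝ⁵) :
    conj (Ω 2 1 y u) * Ω 2 0 y v + conj (Ω 3 1 y u) * Ω 3 0 y v +
      (conj (Ω 2 0 y v) * Ω 2 1 y u + conj (Ω 3 0 y v) * Ω 3 1 y u) =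
    conj (Ω 2 1 y v) * Ω 2 0 y u + conj (Ω 3 1 y v) * Ω 3 0 y u +
      (conj (Ω 2 0 y u) * Ω 2 1 y v + conj (Ω 3 0 y u) * Ω 3 1 y v) := by
  have h0 := h.flat y hy 0 1 u v
  have h1 := h.flat y hy 1 0 u v
  rw [fderiv_eq_of_eqOn hW hy (fun x hx => h.normal x hx v),
    fderiv_eq_of_eqOn hW hy (fun x hx => h.normal x hx u), h1] at h0
  simp only [Fin.sum_univ_four, h.normal y hy, h.hopf y hy] at h0
  simp only [h.skew y hy]
  linear_combination h0

/-- The shape operator on the holomorphic distribution, split in its complex linear part `s` and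
its antilinear part `t`. -/
structure IsShape (W : Set ℝ⁵) (Ω : Fin 4 → Fin 4 → ℝ⁵ → ℝ⁵ → ℂ) (s t : Fin 4 → Fin 4 → ℝ⁵ → ℂ) :
    Prop where
  eq : ∀ y ∈ W, ∀ i, 2 ≤ i → ∀ v, Ω i 1 y v = s i 2 y * Ω 2 0 y v + s i 3 y * Ω 3 0 y v +
    (t i 2 y * conj (Ω 2 0 y v) + t i 3 y * conj (Ω 3 0 y v))
  trace : ∀ y ∈ W, (s 2 2 y + s 3 3 y).re = 0
  smooth_s : ∀ i j, ContDiffOn ℝ ∞ (s i j) W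
  smooth_t : ∀ i j, ContDiffOn ℝ ∞ (t i j) W

variable {s t : Fin 4 → Fin 4 → ℝ⁵ → ℂ}

/-- Testing self-adjointness on the real basis (1,0), (i,0), (0,1), (0,i) makes the complex linear
part Hermitian and the antilinear part symmetric; the trace condition makes the former trace-free.
-/
theorem IsShape.linear_relations (hs : IsShape W Ω s t) (h : IsHopf W Ω) (hW : IsOpen W)
    (hy : y ∈ W) :
    conj (s 2 2 y) = s 2 2 y ∧ s 3 3 y = -s 2 2 y ∧ s 3 2 y = conj (s 2 3 y) ∧
      t 3 2 y = t 2 3 y := by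
  obtain ⟨u₁, h1, h1'⟩ := h.surj y hy 1 0
  obtain ⟨u₂, h2, h2'⟩ := h.surj y hy Complex.I 0
  obtain ⟨u₃, h3, h3'⟩ := h.surj y hy 0 1
  obtain ⟨u₄, h4, h4'⟩ := h.surj y hy 0 Complex.I
  have e12 := congrArg Complex.re (h.symm hW hy u₁ u₂)
  have e34 := congrArg Complex.re (h.symm hW hy u₃ u₄)
  have e13 := congrArg Complex.re (h.symm hW hy u₁ u₃)
  have e24 := congrArg Complex.re (h.symm hW hy u₂ u₄)
  have e14 := congrArg Complex.re (h.symm hW hy u₁ u₄)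
  have e23 := congrArg Complex.re (h.symm hW hy u₂ u₃)
  have tr := hs.trace y hy
  simp only [hs.eq y hy 2 le_rfl, hs.eq y hy 3 (by decide), h1, h1', h2, h2', h3, h3', h4, h4']
    at e12 e34 e13 e24 e14 e23
  simp at e12 e34 e13 e24 e14 e23 tr
  refine ⟨?_, ?_, ?_, ?_⟩ <;> apply Complex.ext <;> (try simp) <;> linarith

/-- With A = S + T split by J-linearity, AJA = J becomes (S - T)(S + T) = 1, that is S² - T² = 1 and
ST = TS. A trace-free Hermitian 2×2 matrix S has scalar square, so T² is scalar too. -/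
theorem IsShape.quadratic_relations (hs : IsShape W Ω s t) (h : IsHopf W Ω) (hW : IsOpen W)
    (hy : y ∈ W) :
    t 2 2 y * conj (t 2 2 y) + t 2 3 y * conj (t 2 3 y) =
      s 2 2 y ^ 2 + s 2 3 y * conj (s 2 3 y) - 1 ∧
    t 2 3 y * conj (t 2 3 y) + t 3 3 y * conj (t 3 3 y) =
      s 2 2 y ^ 2 + s 2 3 y * conj (s 2 3 y) - 1 ∧
    t 2 2 y * conj (t 2 3 y) + t 2 3 y * conj (t 3 3 y) = 0 ∧
    2 * s 2 2 y * t 2 3 y + s 2 3 y * t 3 3 y - conj (s 2 3 y) * t 2 2 y = 0 := by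
  obtain ⟨u₁, h1, h1'⟩ := h.surj y hy 1 0
  obtain ⟨u₂, h2, h2'⟩ := h.surj y hy Complex.I 0
  obtain ⟨u₃, h3, h3'⟩ := h.surj y hy 0 1
  obtain ⟨u₄, h4, h4'⟩ := h.surj y hy 0 Complex.I
  obtain ⟨r1, r2, r3, r4⟩ := hs.linear_relations h hW hy
  have e12 := congrArg Complex.im (h.kaehler hW hy u₁ u₂)
  have e34 := congrArg Complex.im (h.kaehler hW hy u₃ u₄)
  have e13 := congrArg Complex.im (h.kaehler hW hy u₁ u₃)
  have e24 := congrArg Complex.im (h.kaehler hW hy u₂ u₄)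
  have e14 := congrArg Complex.im (h.kaehler hW hy u₁ u₄)
  have e23 := congrArg Complex.im (h.kaehler hW hy u₂ u₃)
  have r1' : (s 2 2 y).im = 0 := by
    have := congrArg Complex.im r1
    simp at this; linarith
  simp only [hs.eq y hy 2 le_rfl, hs.eq y hy 3 (by decide), h1, h1', h2, h2', h3, h3', h4, h4',
    r2, r3, r4] at e12 e34 e13 e24 e14 e23
  simp [r1'] at e12 e34 e13 e24 e14 e23
  refine ⟨?_, ?_, ?_, ?_⟩ <;> apply Complex.ext <;> simp [r1', sq] <;> linarith

/-- The structure equations of the focal submanifold: the derivative of the relation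
`Q̄ = B P` between the forms `P = θ + φ` and `Q = θ - φ`. -/
theorem IsHopf.covariant_deriv (h : IsHopf W Ω) (hW : IsOpen W) {B : Fin 4 → Fin 4 → ℝ⁵ → ℂ}
    (hB : ∀ y ∈ W, ∀ i j, DifferentiableAt ℝ (B i j) y)
    (hQ : ∀ y ∈ W, ∀ i, 2 ≤ i → ∀ v, conj (Ω i 0 y v - Ω i 1 y v) =
      B i 2 y * (Ω 2 0 y v + Ω 2 1 y v) + B i 3 y * (Ω 3 0 y v + Ω 3 1 y v))
    (hy : y ∈ W) (i : Fin 4) (hi : 2 ≤ i) (C : Fin 4 → ℝ⁵ → ℂ)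
    (hC : ∀ j u, C j u = fderiv ℝ (B i j) y u + 2 * Ω 0 0 y u * B i j y -
      (B i 2 y * Ω 2 j y u + B i 3 y * Ω 3 j y u) -
      (Ω 2 i y u * B 2 j y + Ω 3 i y u * B 3 j y)) (u v : ℝ⁵) :
    C 2 u * (Ω 2 0 y v + Ω 2 1 y v) + C 3 u * (Ω 3 0 y v + Ω 3 1 y v) =
      C 2 v * (Ω 2 0 y u + Ω 2 1 y u) + C 3 v * (Ω 3 0 y u + Ω 3 1 y u) := by
  have hd (j v) : DifferentiableAt ℝ (fun x => Ω j 0 x v + Ω j 1 x v) y :=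
    (h.diff y hy _ _ v).add (h.diff y hy _ _ v)
  have key (u v) : conj (fderiv ℝ (fun x => Ω i 0 x v) y u - fderiv ℝ (fun x => Ω i 1 x v) y u) =
      fderiv ℝ (B i 2) y u * (Ω 2 0 y v + Ω 2 1 y v) +
      B i 2 y * (fderiv ℝ (fun x => Ω 2 0 x v) y u + fderiv ℝ (fun x => Ω 2 1 x v) y u) +
      (fderiv ℝ (B i 3) y u * (Ω 3 0 y v + Ω 3 1 y v) +
      B i 3 y * (fderiv ℝ (fun x => Ω 3 0 x v) y u + fderiv ℝ (fun x => Ω 3 1 x v) y u)) := by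
    have e := congrArg (fun T : ℝ⁵ →L[ℝ] ℂ => T u)
      (fderiv_eq_of_eqOn hW hy (fun x hx => hQ x hx i hi v))
    have e1 : HasFDerivAt (fun x => conj (Ω i 0 x v - Ω i 1 x v))
        (Complex.conjCLE.toContinuousLinearMap.comp
          (fderiv ℝ (fun x => Ω i 0 x v) y - fderiv ℝ (fun x => Ω i 1 x v) y)) y :=
      Complex.conjCLE.toContinuousLinearMap.hasFDerivAt.comp y
        ((h.diff y hy i 0 v).hasFDerivAt.sub (h.diff y hy i 1 v).hasFDerivAt)
    have e2 := (((hB y hy i 2).hasFDerivAt.mul (hd 2 v).hasFDerivAt).add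
      ((hB y hy i 3).hasFDerivAt.mul (hd 3 v).hasFDerivAt)).fderiv
    have e3 (j) : fderiv ℝ (fun x => Ω j 0 x v + Ω j 1 x v) y =
        fderiv ℝ (fun x => Ω j 0 x v) y + fderiv ℝ (fun x => Ω j 1 x v) y :=
      fderiv_fun_add (h.diff y hy j 0 v) (h.diff y hy j 1 v)
    rw [e1.fderiv] at e
    refine e.trans ((congrArg (fun T : ℝ⁵ →L[ℝ] ℂ => T u) e2).trans ?_)
    simp [e3]
    ring
  -- The derivatives in `key` are antisymmetrised and replaced by the structure equations; the
  -- relation conj Q = B P then removes all conjugates, leaving the Codazzi equation.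
  have f (j k) := h.flat y hy j k u v
  have k1 := key u v
  have k2 := key v u
  have q1 := hQ y hy
  have fi0 := congrArg conj (f i 0)
  have fi1 := congrArg conj (f i 1)
  have f20 := f 2 0
  have f21 := f 2 1
  have f30 := f 3 0
  have f31 := f 3 1
  simp only [map_sub, h.skew y hy] at k1 k2 fi0 fi1
  simp only [Fin.sum_univ_four, map_add, map_sub, map_mul, h.skew y hy, h.normal y hy,
    h.hopf y hy] at fi0 fi1 f20 f21 f30 f31
  have q2u := q1 2 le_rfl u
  have q2v := q1 2 le_rfl v
  have q3u := q1 3 (by decide) u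
  have q3v := q1 3 (by decide) v
  have qiu := q1 i hi u
  have qiv := q1 i hi v
  simp only [map_sub, h.skew y hy] at q2u q2v q3u q3v qiu qiv
  simp only [hC]
  linear_combination k2 - k1 + (fi0 - fi1) - B i 2 y * (f20 + f21) - B i 3 y * (f30 + f31) +
    (Ω 1 0 y u - Ω 0 0 y u) * qiv + (Ω 0 0 y v - Ω 1 0 y v) * qiu + Ω 2 i y u * q2v +
    Ω 3 i y u * q3v - Ω 2 i y v * q2u - Ω 3 i y v * q3u

theorem eq_zero_of_re_eq_zero {k₂ k₃ : ℂ} (h : ∀ w₂ w₃ : ℂ, (k₂ * w₂ + k₃ * w₃).re = 0) :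
    k₂ = 0 ∧ k₃ = 0 := by
  have h1 := h (conj k₂) 0
  have h2 := h 0 (conj k₃)
  simp only [mul_zero, add_zero, zero_add, Complex.mul_conj, Complex.ofReal_re,
    Complex.normSq_eq_zero] at h1 h2
  exact ⟨h1, h2⟩

/-- The logarithmic derivative of the determinant of `B`, when it has modulus one. -/
theorem IsHopf.fderiv_det (h : IsHopf W Ω) (hW : IsOpen W) {B : Fin 4 → Fin 4 → ℝ⁵ → ℂ}
    (hB : ∀ y ∈ W, ∀ i j, DifferentiableAt ℝ (B i j) y)
    (hQ : ∀ y ∈ W, ∀ i, 2 ≤ i → ∀ v, conj (Ω i 0 y v - Ω i 1 y v) =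
      B i 2 y * (Ω 2 0 y v + Ω 2 1 y v) + B i 3 y * (Ω 3 0 y v + Ω 3 1 y v))
    (hP : ∀ y ∈ W, ∀ w₂ w₃, ∃ u, Ω 2 0 y u + Ω 2 1 y u = w₂ ∧ Ω 3 0 y u + Ω 3 1 y u = w₃)
    (hdet : ∀ y ∈ W, conj (B 2 2 y * B 3 3 y - B 2 3 y * B 3 2 y) *
      (B 2 2 y * B 3 3 y - B 2 3 y * B 3 2 y) = 1)
    (hy : y ∈ W) (u : ℝ⁵) :
    fderiv ℝ (fun y => B 2 2 y * B 3 3 y - B 2 3 y * B 3 2 y) y u =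
      (B 2 2 y * B 3 3 y - B 2 3 y * B 3 2 y) *
        (2 * (Ω 2 2 y u + Ω 3 3 y u) - 4 * Ω 0 0 y u) := by
  obtain ⟨X₂, a2, b2⟩ := hP y hy 1 0
  obtain ⟨X₃, a3, b3⟩ := hP y hy 0 1
  set C : Fin 4 → Fin 4 → ℝ⁵ → ℂ := fun i j u => fderiv ℝ (B i j) y u + 2 * Ω 0 0 y u * B i j y -
      (B i 2 y * Ω 2 j y u + B i 3 y * Ω 3 j y u) -
      (Ω 2 i y u * B 2 j y + Ω 3 i y u * B 3 j y) with hC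
  have hc (i : Fin 4) (hi : 2 ≤ i) := h.covariant_deriv hW hB hQ hy i hi (C i) (fun j u => rfl)
  -- Since X₂, X₃ are dual to P, Codazzi shows that each covariant derivative is a complex linear
  -- combination of the components of P, hence of type (1,0).
  have c2 (i : Fin 4) (hi : 2 ≤ i) (u : ℝ⁵) := hc i hi u X₂
  have c3 (i : Fin 4) (hi : 2 ≤ i) (u : ℝ⁵) := hc i hi u X₃
  simp only [a2, b2, a3, b3, mul_one, mul_zero, add_zero, zero_add] at c2 c3
  set δ := B 2 2 y * B 3 3 y - B 2 3 y * B 3 2 y with hδ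
  have hd : HasFDerivAt (fun y => B 2 2 y * B 3 3 y - B 2 3 y * B 3 2 y) _ y :=
    ((hB y hy 2 2).hasFDerivAt.mul (hB y hy 3 3).hasFDerivAt).sub
      ((hB y hy 2 3).hasFDerivAt.mul (hB y hy 3 2).hasFDerivAt)
  have hd1 (u) : fderiv ℝ (fun y => B 2 2 y * B 3 3 y - B 2 3 y * B 3 2 y) y u =
      B 3 3 y * C 2 2 u + B 2 2 y * C 3 3 u - B 2 3 y * C 3 2 u - B 3 2 y * C 2 3 u +
      δ * (2 * (Ω 2 2 y u + Ω 3 3 y u) - 4 * Ω 0 0 y u) := by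
    rw [hd.fderiv]
    simp [hC, hδ]
    ring
  set k₂ := B 3 3 y * C 2 2 X₂ + B 2 2 y * C 3 2 X₃ - B 2 3 y * C 3 2 X₂ - B 3 2 y * C 2 2 X₃
    with hk2
  set k₃ := B 3 3 y * C 2 3 X₂ + B 2 2 y * C 3 3 X₃ - B 2 3 y * C 3 3 X₂ - B 3 2 y * C 2 3 X₃
    with hk3
  have hd2 (u) : fderiv ℝ (fun y => B 2 2 y * B 3 3 y - B 2 3 y * B 3 2 y) y u =
      k₂ * (Ω 2 0 y u + Ω 2 1 y u) + k₃ * (Ω 3 0 y u + Ω 3 1 y u) +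
      δ * (2 * (Ω 2 2 y u + Ω 3 3 y u) - 4 * Ω 0 0 y u) := by
    rw [hd1, c2 2 le_rfl u, c3 3 (by decide) u, c2 3 (by decide) u, c3 2 le_rfl u, hk2, hk3]
    ring
  have hdd : DifferentiableAt ℝ (fun y => B 2 2 y * B 3 3 y - B 2 3 y * B 3 2 y) y :=
    hd.differentiableAt
  -- Constant modulus makes the logarithmic derivative imaginary. The connection term is imaginary
  -- as well, so the (1,0) term has zero real part for every value of P, which a complex linear form
  -- can only do by vanishing.
  have hn (u) : (conj δ *
      fderiv ℝ (fun y => B 2 2 y * B 3 3 y - B 2 3 y * B 3 2 y) y u).re = 0 := by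
    have e1 := (Complex.conjCLE.toContinuousLinearMap.hasFDerivAt.comp y hdd.hasFDerivAt).mul
      hdd.hasFDerivAt
    have e2 := congrArg (fun T : ℝ⁵ →L[ℝ] ℂ => T u) (e1.fderiv.symm.trans
      (fderiv_eq_of_eqOn hW hy (fun x hx => hdet x hx)))
    have e3 := congrArg Complex.re e2
    simp [← hδ] at e3
    simp only [Complex.mul_re, Complex.conj_re, Complex.conj_im]
    linarith
  have hδ1 := hdet y hy
  rw [← hδ] at hδ1
  have him (u) : (2 * (Ω 2 2 y u + Ω 3 3 y u) - 4 * Ω 0 0 y u).re = 0 := by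
    have e (i) : (Ω i i y u).re = 0 := by
      have := congrArg Complex.re (h.skew y hy i i u)
      simp at this
      linarith
    simp [e]
  have hk (u) : (conj δ * k₂ * (Ω 2 0 y u + Ω 2 1 y u) +
      conj δ * k₃ * (Ω 3 0 y u + Ω 3 1 y u)).re = 0 := by
    have := hn u
    rw [hd2, mul_add, ← mul_assoc _ δ, hδ1, one_mul, Complex.add_re, him, add_zero] at this
    rw [← this]
    ring_nf
  have hz := eq_zero_of_re_eq_zero (k₂ := conj δ * k₂) (k₃ := conj δ * k₃) fun w₂ w₃ => by
    obtain ⟨u, h2, h3⟩ := hP y hy w₂ w₃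
    rw [← h2, ← h3]
    exact hk u
  have hδ0 : conj δ ≠ 0 := fun h0 => by simp [h0] at hδ1
  rw [hd2, (mul_eq_zero.1 hz.1).resolve_left hδ0, (mul_eq_zero.1 hz.2).resolve_left hδ0]
  ring

/-- A logarithmic derivative is closed. The trace of Ω is closed and Ω₁₁ = Ω₀₀, so modulo closed
forms the given form is -8Ω₀₀, and the exterior derivative of Ω₀₀ is a nonzero multiple of the
Kähler form. -/
theorem IsHopf.not_logDeriv (h : IsHopf W Ω) (hW : IsOpen W) {δ : ℝ⁵ → ℂ}
    (hδ : ContDiffOn ℝ ∞ δ W) (h0 : ∀ y ∈ W, δ y ≠ 0)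
    (hd : ∀ y ∈ W, ∀ u, fderiv ℝ δ y u =
      δ y * (2 * (Ω 2 2 y u + Ω 3 3 y u) - 4 * Ω 0 0 y u)) (hy : y ∈ W) : False := by
  have hc : ContDiffAt ℝ ∞ δ y := hδ.contDiffAt (hW.mem_nhds hy)
  have hdδ := hc.differentiableAt (by simp)
  have hl (v) : HasFDerivAt (fun x => 2 * (Ω 2 2 x v + Ω 3 3 x v) - 4 * Ω 0 0 x v) _ y :=
    (((h.diff y hy 2 2 v).hasFDerivAt.add (h.diff y hy 3 3 v).hasFDerivAt).const_mul 2).sub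
      ((h.diff y hy 0 0 v).hasFDerivAt.const_mul 4)
  have e (u v) : secondDeriv δ y u v = fderiv ℝ δ y u *
      (2 * (Ω 2 2 y v + Ω 3 3 y v) - 4 * Ω 0 0 y v) + δ y *
      (2 * (fderiv ℝ (fun x => Ω 2 2 x v) y u + fderiv ℝ (fun x => Ω 3 3 x v) y u) -
        4 * fderiv ℝ (fun x => Ω 0 0 x v) y u) := by
    rw [← fderiv_fderiv_apply hc, fderiv_eq_of_eqOn hW hy (fun x hx => hd x hx v),
      (hdδ.hasFDerivAt.fun_mul (hl v)).fderiv]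
    simp
    ring
  obtain ⟨u, hu, hu'⟩ := h.surj y hy 1 0
  obtain ⟨v, hv, hv'⟩ := h.surj y hy Complex.I 0
  have hsymm := secondDeriv_comm hc u v
  rw [e, e, hd y hy, hd y hy] at hsymm
  have hk := h.kaehler hW hy u v
  have hs := h.skew y hy
  rw [hu, hu', hv, hv'] at hk
  have f0 := h.flat y hy 0 0 u v
  have f2 := h.flat y hy 2 2 u v
  have f3 := h.flat y hy 3 3 u v
  simp only [Fin.sum_univ_four, h.normal y hy] at f0 f2 f3
  have g (i w) : Ω 0 i y w = -conj (Ω i 0 y w) := by rw [hs]; ring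
  have g1 (i w) : Ω 1 i y w = -conj (Ω i 1 y w) := by rw [hs]; ring
  -- The directions u and v correspond to (1,0) and (i,0), where dΩ₀₀ takes the value 2i.
  have key : δ y * (-16 * Complex.I) = 0 := by
    simp only [g 2, g 3, g1 2, g1 3, hu, hu', hv, hv', map_one, map_zero, Complex.conj_I]
      at f0 f2 f3 hk
    linear_combination hsymm - δ y * (2 * (f2 + f3) - 4 * f0) + 2 * δ y * hk
  simp [h0 y hy] at key

end HopfForms
end

/-! ### Vanishing of the antilinear part of the shape operator -/

noncomputable section

namespace HopfForms

open ComplexConjugate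

local notation "ℝ⁵" => EuclideanSpace ℝ (Fin 5)

variable {W : Set ℝ⁵} {Ω : Fin 4 → Fin 4 → ℝ⁵ → ℝ⁵ → ℂ} {y : ℝ⁵} {s t : Fin 4 → Fin 4 → ℝ⁵ → ℂ}

theorem IsHopf.mono {W' : Set ℝ⁵} (h : IsHopf W Ω) (hW : W' ⊆ W) : IsHopf W' Ω where
  skew y hy := h.skew y (hW hy)
  diff y hy := h.diff y (hW hy)
  flat y hy := h.flat y (hW hy)
  normal y hy := h.normal y (hW hy)
  hopf y hy := h.hopf y (hW hy)
  surj y hy := h.surj y (hW hy)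

theorem IsShape.mono {W' : Set ℝ⁵} (h : IsShape W Ω s t) (hW : W' ⊆ W) : IsShape W' Ω s t where
  eq y hy := h.eq y (hW hy)
  trace y hy := h.trace y (hW hy)
  smooth_s i j := (h.smooth_s i j).mono hW
  smooth_t i j := (h.smooth_t i j).mono hW

/-- The square of the complex linear part of the shape operator. -/
def sqLin (s : Fin 4 → Fin 4 → ℝ⁵ → ℂ) (y : ℝ⁵) : ℂ := s 2 2 y ^ 2 + s 2 3 y * conj (s 2 3 y)

/-- The matrix relating the derivatives of the two focal maps. -/
def focalMatrix (s t : Fin 4 → Fin 4 → ℝ⁵ → ℂ) (i j : Fin 4) (y : ℝ⁵) : ℂ :=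
  (sqLin s y - 1)⁻¹ * (conj (t i j y) -
    (conj (s i 2 y) * conj (t 2 j y) + conj (s i 3 y) * conj (t 3 j y)))

theorem contDiffOn_conj {g : ℝ⁵ → ℂ} (hg : ContDiffOn ℝ ∞ g W) :
    ContDiffOn ℝ ∞ (fun x => conj (g x)) W :=
  Complex.conjCLE.contDiff.comp_contDiffOn hg

theorem IsShape.contDiffOn_sqLin (hs : IsShape W Ω s t) : ContDiffOn ℝ ∞ (sqLin s) W :=
  ((hs.smooth_s 2 2).pow 2).add ((hs.smooth_s 2 3).mul (contDiffOn_conj (hs.smooth_s 2 3)))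

theorem IsShape.contDiffOn_focalMatrix (hs : IsShape W Ω s t) (h1 : ∀ y ∈ W, sqLin s y ≠ 1)
    (i j : Fin 4) : ContDiffOn ℝ ∞ (focalMatrix s t i j) W := by
  have hS i j := contDiffOn_conj (hs.smooth_s i j)
  have hT i j := contDiffOn_conj (hs.smooth_t i j)
  refine ContDiffOn.mul ?_
    ((hT i j).sub (((hS i 2).mul (hT 2 j)).add ((hS i 3).mul (hT 3 j))))
  exact (hs.contDiffOn_sqLin.sub contDiffOn_const).inv fun y hy => sub_ne_zero.2 (h1 y hy)

/-- Put m = S², a scalar. From ST = TS and T² = m - 1 one gets (m - 1)⁻¹(1 - S)T(1 + A) = 1 - A.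
Thus the passage from P = (1 + A)θ to Q = (1 - A)θ is antilinear, and its conjugate is given by
`focalMatrix`. -/
theorem IsShape.focalMatrix_eq (hs : IsShape W Ω s t) (h : IsHopf W Ω) (hW : IsOpen W)
    (hy : y ∈ W) (h1 : sqLin s y ≠ 1) (i : Fin 4) (hi : 2 ≤ i) (v : ℝ⁵) :
    conj (Ω i 0 y v - Ω i 1 y v) =
      focalMatrix s t i 2 y * (Ω 2 0 y v + Ω 2 1 y v) +
      focalMatrix s t i 3 y * (Ω 3 0 y v + Ω 3 1 y v) := by
  obtain ⟨l1, l2, l3, l4⟩ := hs.linear_relations h hW hy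
  obtain ⟨r1, r2, r3, r4⟩ := hs.quadratic_relations h hW hy
  have r1' := congrArg conj r1
  have r2' := congrArg conj r2
  have r3' := congrArg conj r3
  have r4' := congrArg conj r4
  have h0 : sqLin s y - 1 ≠ 0 := sub_ne_zero.2 h1
  rw [sqLin] at h0
  rw [hs.eq y hy 2 le_rfl, hs.eq y hy 3 (by decide), hs.eq y hy i hi]
  simp only [focalMatrix, sqLin]
  have hi' : i = 2 ∨ i = 3 := by
    rcases i with ⟨i, hi4⟩
    simp only [Fin.le_def, Fin.ext_iff] at *
    have : (2 : ℕ) ≤ i := hi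
    change i = 2 ∨ i = 3
    omega
  simp only [map_sub, map_add, map_mul, map_pow, map_one, map_zero, map_ofNat, Complex.conj_conj,
    l1] at r1' r2' r3' r4'
  rcases hi' with rfl | rfl
  · simp only [l1, l2, l3, l4, map_sub, map_add, map_mul, map_neg, Complex.conj_conj]
    generalize s 2 2 y = a at *
    generalize s 2 3 y = b at *
    generalize conj b = b' at *
    generalize t 2 2 y = c at *
    generalize conj c = c' at *
    generalize t 2 3 y = d at *
    generalize conj d = d' at *
    generalize t 3 3 y = e at *
    generalize conj e = e' at *
    generalize Ω 2 0 y v = x at *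
    generalize conj x = x' at *
    generalize Ω 3 0 y v = w at *
    generalize conj w = w' at *
    linear_combination -(x' - (a * x' + b' * w' + c' * x + d' * w)) * inv_mul_cancel₀ h0 +
      (a ^ 2 + b * b' - 1)⁻¹ * (-((1 - a) * (r1 * x' + r3' * w') - b' * (r3 * x' + r2 * w')) +
      r4' * (b' * x + (1 - a) * w))
  · simp only [l1, l2, l3, l4, map_sub, map_add, map_mul, map_neg, Complex.conj_conj]
    generalize s 2 2 y = a at *
    generalize s 2 3 y = b at *
    generalize conj b = b' at *
    generalize t 2 2 y = c at *
    generalize conj c = c' at *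
    generalize t 2 3 y = d at *
    generalize conj d = d' at *
    generalize t 3 3 y = e at *
    generalize conj e = e' at *
    generalize Ω 2 0 y v = x at *
    generalize conj x = x' at *
    generalize Ω 3 0 y v = w at *
    generalize conj w = w' at *
    linear_combination -(w' - (b * x' - a * w' + d' * x + e' * w)) * inv_mul_cancel₀ h0 +
      (a ^ 2 + b * b' - 1)⁻¹ * (-(-b * (r1 * x' + r3' * w') + (1 + a) * (r3 * x' + r2 * w')) -
      r4' * ((1 + a) * x + b * w))

theorem IsShape.focal_surjective (hs : IsShape W Ω s t) (h : IsHopf W Ω) (hW : IsOpen W)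
    (hy : y ∈ W) (h1 : sqLin s y ≠ 1) (w₂ w₃ : ℂ) :
    ∃ u, Ω 2 0 y u + Ω 2 1 y u = w₂ ∧ Ω 3 0 y u + Ω 3 1 y u = w₃ := by
  obtain ⟨l1, l2, l3, l4⟩ := hs.linear_relations h hW hy
  obtain ⟨r1, r2, r3, r4⟩ := hs.quadratic_relations h hW hy
  have r3' := congrArg conj r3
  have h0 : 1 - sqLin s y ≠ 0 := sub_ne_zero.2 h1.symm
  have hc : conj (2 * (1 - sqLin s y))⁻¹ = (2 * (1 - sqLin s y))⁻¹ := by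
    simp [sqLin, l1, mul_comm, map_ofNat conj 2]
  -- This is (1 - S)w. The preimage comes from (1 + A)(1 + S - T) = 2(1 + S) and (1 + S)(1 - S) = 1
  -- - m, with m the scalar S².
  set m₂ := (1 - s 2 2 y) * w₂ - s 2 3 y * w₃ with hm2
  set m₃ := -conj (s 2 3 y) * w₂ + (1 + s 2 2 y) * w₃ with hm3
  obtain ⟨u, h2, h3⟩ := h.surj y hy
    ((2 * (1 - sqLin s y))⁻¹ * ((1 + s 2 2 y) * m₂ + s 2 3 y * m₃ -
      (t 2 2 y * conj m₂ + t 2 3 y * conj m₃)))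
    ((2 * (1 - sqLin s y))⁻¹ * (conj (s 2 3 y) * m₂ + (1 - s 2 2 y) * m₃ -
      (t 2 3 y * conj m₂ + t 3 3 y * conj m₃)))
  refine ⟨u, ?_⟩
  rw [hs.eq y hy 2 le_rfl, hs.eq y hy 3 (by decide), h2, h3]
  simp only [map_mul, map_add, map_sub, hc, map_one, Complex.conj_conj, l1, l2, l3, l4] at r3' ⊢
  rw [map_zero] at r3'
  rw [sqLin] at h0 ⊢
  generalize hm2' : conj m₂ = m₂' at *
  generalize hm3' : conj m₃ = m₃' at *
  generalize s 2 2 y = a at *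
  generalize s 2 3 y = b at *
  generalize conj b = b' at *
  generalize t 2 2 y = c at *
  generalize conj c = c' at *
  generalize t 2 3 y = d at *
  generalize conj d = d' at *
  generalize t 3 3 y = e at *
  generalize conj e = e' at *
  constructor
  · field_simp
    linear_combination (2 * (1 + a) * hm2 + 2 * b * hm3) - (r4 * m₃' + r1 * m₂ + r3 * m₃)
  · field_simp
    linear_combination (2 * b' * hm2 + 2 * (1 - a) * hm3) - (-r4 * m₂' + r3' * m₂ + r2 * m₃)

/-- With m the scalar S², trace-freeness gives det(1 - S) = 1 - m, and the quadratic relations give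
|det t| = |m - 1|. The powers of m - 1 cancel in the modulus. -/
theorem IsShape.det_focalMatrix (hs : IsShape W Ω s t) (h : IsHopf W Ω) (hW : IsOpen W)
    (hy : y ∈ W) (h1 : sqLin s y ≠ 1) :
    conj (focalMatrix s t 2 2 y * focalMatrix s t 3 3 y -
        focalMatrix s t 2 3 y * focalMatrix s t 3 2 y) *
      (focalMatrix s t 2 2 y * focalMatrix s t 3 3 y -
        focalMatrix s t 2 3 y * focalMatrix s t 3 2 y) = 1 := by
  obtain ⟨l1, l2, l3, l4⟩ := hs.linear_relations h hW hy
  obtain ⟨r1, r2, r3, r4⟩ := hs.quadratic_relations h hW hy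
  have h0 : sqLin s y - 1 ≠ 0 := sub_ne_zero.2 h1
  have hc : conj (sqLin s y) = sqLin s y := by
    simp [sqLin, l1, mul_comm]
  have e : focalMatrix s t 2 2 y * focalMatrix s t 3 3 y -
        focalMatrix s t 2 3 y * focalMatrix s t 3 2 y =
      -(sqLin s y - 1)⁻¹ * conj (t 2 2 y * t 3 3 y - t 2 3 y ^ 2) := by
    simp only [focalMatrix, l1, l2, l3, l4, map_sub, map_mul, map_neg, map_pow, Complex.conj_conj]
    field_simp
    rw [sqLin]
    ring
  rw [e]
  simp only [map_mul, map_neg, map_inv₀, map_sub, map_pow, Complex.conj_conj, hc, map_one]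
  field_simp
  rw [sqLin]
  linear_combination (t 2 3 y * conj (t 2 3 y) + t 3 3 y * conj (t 3 3 y)) * r1 +
    (s 2 2 y ^ 2 + s 2 3 y * conj (s 2 3 y) - 1) * r2 -
    (t 2 3 y * conj (t 2 2 y) + t 3 3 y * conj (t 2 3 y)) * r3

/-- The antilinear part of the shape operator vanishes. -/
theorem IsShape.antilinear_eq_zero (hs : IsShape W Ω s t) (h : IsHopf W Ω) (hW : IsOpen W)
    (hy : y ∈ W) :
    sqLin s y = 1 ∧ t 2 2 y = 0 ∧ t 2 3 y = 0 ∧ t 3 2 y = 0 ∧ t 3 3 y = 0 := by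
  have h1 : sqLin s y = 1 := by
    -- If m ≠ 1 at y, the same holds on an open neighbourhood, where the focal argument applies and
    -- is contradictory.
    by_contra h1
    have hW' : IsOpen (W ∩ sqLin s ⁻¹' {1}ᶜ) :=
      hs.contDiffOn_sqLin.continuousOn.isOpen_inter_preimage hW isOpen_compl_singleton
    have h' := h.mono (W' := W ∩ sqLin s ⁻¹' {1}ᶜ) Set.inter_subset_left
    have hs' := hs.mono (W' := W ∩ sqLin s ⁻¹' {1}ᶜ) Set.inter_subset_left
    have hB := hs'.contDiffOn_focalMatrix fun y hy => hy.2
    refine h'.not_logDeriv hW' (((hB 2 2).mul (hB 3 3)).sub ((hB 2 3).mul (hB 3 2)))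
      (fun y hy h0 => ?_) (fun y hy u => h'.fderiv_det hW' (B := focalMatrix s t)
        (fun y hy i j => ((hB i j).contDiffAt (hW'.mem_nhds hy)).differentiableAt (by simp))
        (fun y hy i hi v => hs'.focalMatrix_eq h' hW' hy hy.2 i hi v)
        (fun y hy => hs'.focal_surjective h' hW' hy hy.2)
        (fun y hy => hs'.det_focalMatrix h' hW' hy hy.2) hy u) (y := y) ⟨hy, h1⟩
    have := hs'.det_focalMatrix h' hW' hy hy.2
    rw [h0] at this
    simp at this
  obtain ⟨l1, l2, l3, l4⟩ := hs.linear_relations h hW hy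
  obtain ⟨r1, r2, r3, r4⟩ := hs.quadratic_relations h hW hy
  rw [sqLin] at h1
  rw [h1] at r1 r2
  simp only [Complex.mul_conj, sub_self] at r1 r2
  norm_cast at r1 r2
  have n (z : ℂ) := Complex.normSq_nonneg z
  have z1 := n (t 2 2 y)
  have z2 := n (t 2 3 y)
  have z3 := n (t 3 3 y)
  have t23 := Complex.normSq_eq_zero.1 (show Complex.normSq (t 2 3 y) = 0 by linarith)
  exact ⟨h1, Complex.normSq_eq_zero.1 (by linarith), t23, l4.trans t23,
    Complex.normSq_eq_zero.1 (by linarith)⟩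

end HopfForms
end

/-! ### Unitary moving frames of ℂ⁴ -/

noncomputable section

namespace MovingFrame

open ComplexConjugate

local notation "⟪" x ", " y "⟫" => Inner.inner ℂ x y
local notation "ℝ⁵" => EuclideanSpace ℝ (Fin 5)

theorem contDiffAt_fderiv {V : Type*} [NormedAddCommGroup V] [NormedSpace ℝ V] {F : ℝ⁵ → V}
    {y : ℝ⁵} (hF : ContDiffAt ℝ ∞ F y) : ContDiffAt ℝ ∞ (fderiv ℝ F) y :=
  hF.fderiv_right (by simp)

theorem contDiffAt_inner {a b : ℝ⁵ → C4} {y : ℝ⁵} (ha : ContDiffAt ℝ ∞ a y)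
    (hb : ContDiffAt ℝ ∞ b y) : ContDiffAt ℝ ∞ (fun x => ⟪a x, b x⟫) y :=
  ha.inner ℂ hb

theorem fderiv_inner {a b : ℝ⁵ → C4} {y : ℝ⁵} (ha : DifferentiableAt ℝ a y)
    (hb : DifferentiableAt ℝ b y) (u : ℝ⁵) :
    fderiv ℝ (fun x => ⟪a x, b x⟫) y u = ⟪a y, fderiv ℝ b y u⟫ + ⟪fderiv ℝ a y u, b y⟫ :=
  fderiv_inner_apply ℂ ha hb u

theorem contDiffAt_smul {a : ℝ⁵ → ℂ} {b : ℝ⁵ → C4} {y : ℝ⁵} (ha : ContDiffAt ℝ ∞ a y)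
    (hb : ContDiffAt ℝ ∞ b y) : ContDiffAt ℝ ∞ (fun x => a x • b x) y :=
  ha.smul hb

/-- A nowhere zero vector field, normalised. -/
def unitVec (a : ℝ⁵ → C4) (y : ℝ⁵) : C4 := (‖a y‖⁻¹ : ℝ) • a y

theorem contDiffAt_unitVec {a : ℝ⁵ → C4} {y : ℝ⁵} (ha : ContDiffAt ℝ ∞ a y) (h : a y ≠ 0) :
    ContDiffAt ℝ ∞ (unitVec a) y :=
  ((ha.norm ℂ h).inv (norm_ne_zero_iff.2 h)).smul ha

theorem norm_unitVec {a : ℝ⁵ → C4} {y : ℝ⁵} (h : a y ≠ 0) : ‖unitVec a y‖ = 1 := by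
  rw [unitVec, norm_smul, norm_inv, norm_norm, inv_mul_cancel₀ (norm_ne_zero_iff.2 h)]

/-- The connection forms of a frame of `ℂ⁴`. -/
def connForm (Z : Fin 4 → ℝ⁵ → C4) (i j : Fin 4) (y v : ℝ⁵) : ℂ := ⟪Z i y, fderiv ℝ (Z j) y v⟫

/-- A smooth unitary frame of `ℂ⁴` on the open set `W`. -/
structure IsUnitary (W : Set ℝ⁵) (Z : Fin 4 → ℝ⁵ → C4) : Prop where
  isOpen : IsOpen W
  smooth : ∀ i, ∀ y ∈ W, ContDiffAt ℝ ∞ (Z i) y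
  orthonormal : ∀ y ∈ W, ∀ i j, ⟪Z i y, Z j y⟫ = if i = j then 1 else 0

namespace IsUnitary

variable {W : Set ℝ⁵} {Z : Fin 4 → ℝ⁵ → C4} {y : ℝ⁵} (h : IsUnitary W Z) (hy : y ∈ W)

include h hy

theorem differentiableAt (i : Fin 4) : DifferentiableAt ℝ (Z i) y :=
  (h.smooth i y hy).differentiableAt (by simp)

theorem sum_inner (w : C4) : w = ∑ k, ⟪Z k y, w⟫ • Z k y := by
  have ho : Orthonormal ℂ fun i => Z i y := orthonormal_iff_ite.2 (h.orthonormal y hy)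
  let b := basisOfOrthonormalOfCardEqFinrank ho (by simp)
  have hb : Orthonormal ℂ b := by simpa [b] using ho
  have := (b.toOrthonormalBasis hb).sum_repr' w
  simpa [b] using this.symm

theorem inner_eq_sum (w w' : C4) : ⟪w, w'⟫ = ∑ k, conj ⟪Z k y, w⟫ * ⟪Z k y, w'⟫ := by
  conv_lhs => rw [h.sum_inner hy w, _root_.sum_inner]
  simp only [inner_smul_left]

theorem skew (i j : Fin 4) (v : ℝ⁵) : conj (connForm Z i j y v) = -connForm Z j i y v := by
  have h1 := fderiv_inner (h.differentiableAt hy j) (h.differentiableAt hy i) v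
  rw [HopfForms.fderiv_eq_of_eqOn h.isOpen hy fun x hx => h.orthonormal x hx j i] at h1
  simp only [fderiv_const_apply, zero_apply] at h1
  rw [connForm, connForm, inner_conj_symm]
  exact eq_neg_of_add_eq_zero_right h1.symm

theorem contDiffAt_connForm (i j : Fin 4) {v : ℝ⁵ → ℝ⁵} (hv : ContDiffAt ℝ ∞ v y) :
    ContDiffAt ℝ ∞ (fun x => connForm Z i j x (v x)) y :=
  contDiffAt_inner (h.smooth i y hy) ((contDiffAt_fderiv (h.smooth j y hy)).clm_apply hv)

/-- The second derivatives of the frame vectors drop out by symmetry; the remaining products of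
first derivatives are expanded in the frame itself. -/
theorem flat (i j : Fin 4) (u v : ℝ⁵) :
    fderiv ℝ (fun x => connForm Z i j x v) y u - fderiv ℝ (fun x => connForm Z i j x u) y v =
      ∑ k, (connForm Z i k y v * connForm Z k j y u - connForm Z i k y u * connForm Z k j y v) := by
  have e (u v : ℝ⁵) : fderiv ℝ (fun x => connForm Z i j x v) y u =
      ⟪Z i y, secondDeriv (Z j) y u v⟫ + ⟪fderiv ℝ (Z i) y u, fderiv ℝ (Z j) y v⟫ := by
    rw [← fderiv_fderiv_apply (h.smooth j y hy)]
    exact fderiv_inner (h.differentiableAt hy i) (hasFDerivAt_fderiv_apply (h.smooth j y hy) v) u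
  rw [e, e, secondDeriv_comm (h.smooth j y hy) v u, add_sub_add_left_eq_sub, h.inner_eq_sum hy,
    h.inner_eq_sum hy (fderiv ℝ (Z i) y v), ← Finset.sum_sub_distrib]
  refine Finset.sum_congr rfl fun k _ => ?_
  have h1 (u : ℝ⁵) := h.skew hy k i u
  simp only [connForm] at h1 ⊢
  rw [h1, h1]
  ring

end IsUnitary

theorem exists_orthogonal {k : ℕ} (hk : k < 4) (a : Fin k → C4) :
    ∃ c : C4, c ≠ 0 ∧ ∀ i, ⟪a i, c⟫ = 0 := by
  have h1 : Submodule.span ℂ (Set.range a) ≠ ⊤ := by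
    intro h
    have h2 := finrank_range_le_card (R := ℂ) a
    rw [Set.finrank, h, finrank_top] at h2
    simp at h2
    omega
  have h2 : (Submodule.span ℂ (Set.range a))ᗮ ≠ ⊥ := by
    rwa [Ne, Submodule.orthogonal_eq_bot_iff]
  obtain ⟨c, hc, h0⟩ := Submodule.exists_mem_ne_zero_of_ne_bot h2
  exact ⟨c, h0, fun i => hc _ (Submodule.subset_span ⟨i, rfl⟩)⟩

/-- A smooth orthonormal family of less than four vector fields can be extended. -/
theorem exists_extend {k : ℕ} (hk : k < 4) {W : Set ℝ⁵} (hW : IsOpen W) {y : ℝ⁵} (hy : y ∈ W)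
    (a : Fin k → ℝ⁵ → C4) (ha : ∀ i, ∀ x ∈ W, ContDiffAt ℝ ∞ (a i) x)
    (ho : ∀ x ∈ W, ∀ i j, ⟪a i x, a j x⟫ = if i = j then 1 else 0) :
    ∃ W' ⊆ W, IsOpen W' ∧ y ∈ W' ∧ ∃ b : ℝ⁵ → C4, (∀ x ∈ W', ContDiffAt ℝ ∞ b x) ∧
      ∀ x ∈ W', ‖b x‖ = 1 ∧ ∀ i, ⟪a i x, b x⟫ = 0 := by
  obtain ⟨c, hc, h0⟩ := exists_orthogonal hk fun i => a i y
  -- Gram–Schmidt remainder of a constant vector: it equals c at the base point, hence stays nonzero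
  -- nearby.
  let r : ℝ⁵ → C4 := fun x => c - ∑ i, ⟪a i x, c⟫ • a i x
  have hr : ∀ x ∈ W, ContDiffAt ℝ ∞ r x := fun x hx =>
    contDiffAt_const.sub (ContDiffAt.sum fun i _ =>
      contDiffAt_smul (contDiffAt_inner (ha i x hx) contDiffAt_const) (ha i x hx))
  have hc' : ContinuousOn r W := fun x hx => (hr x hx).continuousAt.continuousWithinAt
  refine ⟨W ∩ r ⁻¹' {0}ᶜ, Set.inter_subset_left,
    hc'.isOpen_inter_preimage hW isOpen_compl_singleton, ⟨hy, ?_⟩, unitVec r,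
    fun x hx => contDiffAt_unitVec (hr x hx.1) hx.2, fun x hx => ⟨norm_unitVec hx.2, fun i => ?_⟩⟩
  · simp [r, h0, hc]
  · rw [unitVec, ← Complex.coe_smul, inner_smul_right]
    simp [r, inner_sub_right, inner_sum, inner_smul_right, ho x hx.1]

/-- The vector representing a real functional of `ℂ⁴`. -/
def rieszVec (l : C4 →L[ℝ] ℝ) : C4 :=
  ∑ j, ((l (EuclideanSpace.single j 1) : ℂ) +
    Complex.I * (l (Complex.I • EuclideanSpace.single j 1) : ℂ)) • EuclideanSpace.single j 1

theorem re_inner_rieszVec (l : C4 →L[ℝ] ℝ) (w : C4) : (⟪rieszVec l, w⟫).re = l w := by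
  have hw : w = ∑ j, ((w j).re • EuclideanSpace.single j (1 : ℂ) +
      (w j).im • (Complex.I • EuclideanSpace.single j (1 : ℂ)) : C4) := by
    ext k
    rw [WithLp.ofLp_sum, Finset.sum_apply]
    simp [Complex.re_add_im, mul_comm Complex.I, Finset.sum_ite_eq, PiLp.single_apply,
      Finset.sum_add_distrib]
  have hl (a b : ℝ) (v v' : C4) : l (a • v + b • v') = a * l v + b * l v' := by
    rw [map_add, map_smul, map_smul, smul_eq_mul, smul_eq_mul]
  conv_rhs => rw [hw, map_sum]
  rw [rieszVec, sum_inner, Complex.re_sum]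
  refine Finset.sum_congr rfl fun j _ => ?_
  rw [inner_smul_left, hl, EuclideanSpace.inner_single_left]
  simp
  ring

theorem contDiffAt_rieszVec {l : ℝ⁵ → C4 →L[ℝ] ℝ} {y : ℝ⁵} (hl : ContDiffAt ℝ ∞ l y) :
    ContDiffAt ℝ ∞ (fun x => rieszVec (l x)) y := by
  have h (w : C4) : ContDiffAt ℝ ∞ (fun x => (l x w : ℂ)) y :=
    Complex.ofRealCLM.contDiff.contDiffAt.comp y (hl.clm_apply contDiffAt_const)
  exact ContDiffAt.sum fun j _ =>
    contDiffAt_smul ((h _).add (contDiffAt_const.mul (h _))) contDiffAt_const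

end MovingFrame
end

/-! ### Local lifts to the sphere and local unit normals -/

noncomputable section

namespace MovingFrame

open ComplexConjugate CP3 InnerProductSpace

local notation "⟪" x ", " y "⟫" => Inner.inner ℂ x y
local notation "ℝ⁵" => EuclideanSpace ℝ (Fin 5)

/-- A unitary frame of `ℂ⁴` adapted to an immersed hypersurface of `CP³`: the first vector lifts
the immersion to the sphere, and the second one is horizontal and normal to the hypersurface. -/
structure IsAdapted (p : ℝ⁵ → CP3) (W : Set ℝ⁵) (Z : Fin 4 → ℝ⁵ → C4) : Prop
    extends IsUnitary W Z where
  smooth_proj : ∀ y ∈ W, ContDiffAt ℝ ∞ (fun x => proj (p x)) y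
  inj : ∀ y ∈ W, ∀ v, fderiv ℝ (fun x => proj (p x)) y v = 0 → v = 0
  lift : ∀ y ∈ W, proj (p y) = rankOne ℂ (Z 0 y) (Z 0 y)
  normal : ∀ y ∈ W, ∀ v, (connForm Z 1 0 y v).re = 0

/-- Projecting a fixed vector of the line at y onto the nearby lines gives a smooth nonvanishing
section. Its normalisation is determined up to a phase, which the projection does not see. -/
theorem exists_lift {p : ℝ⁵ → CP3} {W : Set ℝ⁵} (hW : IsOpen W) {y : ℝ⁵} (hy : y ∈ W)
    (hG : ∀ y ∈ W, ContDiffAt ℝ ∞ (fun x => proj (p x)) y) :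
    ∃ W' ⊆ W, IsOpen W' ∧ y ∈ W' ∧ ∃ z : ℝ⁵ → C4, (∀ x ∈ W', ContDiffAt ℝ ∞ z x) ∧
      ∀ x ∈ W', ‖z x‖ = 1 ∧ proj (p x) = rankOne ℂ (z x) (z x) := by
  obtain ⟨z₀, h1, h2⟩ := exists_unit (p y)
  let r : ℝ⁵ → C4 := fun x => proj (p x) z₀
  have hr : ∀ x ∈ W, ContDiffAt ℝ ∞ r x := fun x hx => by
    have : ContDiffAt ℝ ∞ (fun x => (ContinuousLinearMap.restrictScalarsL ℂ C4 C4 ℝ ℝ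
        (proj (p x))) z₀) x :=
      ((ContinuousLinearMap.contDiff _).contDiffAt.comp x (hG x hx)).clm_apply contDiffAt_const
    exact this
  have hc' : ContinuousOn r W := fun x hx => (hr x hx).continuousAt.continuousWithinAt
  refine ⟨W ∩ r ⁻¹' {0}ᶜ, Set.inter_subset_left,
    hc'.isOpen_inter_preimage hW isOpen_compl_singleton, ⟨hy, ?_⟩, unitVec r,
    fun x hx => contDiffAt_unitVec (hr x hx.1) hx.2, fun x hx => ⟨norm_unitVec hx.2, ?_⟩⟩
  · have : z₀ ≠ 0 := fun h => by simp [h] at h1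
    simpa [r, proj_apply_unit h1 h2] using this
  · obtain ⟨z, h3, h4⟩ := exists_unit (p x)
    have h5 : r x = ⟪z, z₀⟫ • z := by simp [r, h4]
    have h6 : ⟪z, z₀⟫ ≠ 0 := fun h0 => hx.2 (by simp [h5, h0])
    rw [h4, unitVec, h5, norm_smul, h3, mul_one, ← Complex.coe_smul, smul_smul]
    have h7 : conj (((‖⟪z, z₀⟫‖⁻¹ : ℝ) : ℂ) * ⟪z, z₀⟫) * (((‖⟪z, z₀⟫‖⁻¹ : ℝ) : ℂ) * ⟪z, z₀⟫) = 1 := by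
      rw [Complex.conj_mul', norm_mul, Complex.norm_real, norm_inv, norm_norm,
        inv_mul_cancel₀ (norm_ne_zero_iff.2 h6)]
      simp
    generalize ((‖⟪z, z₀⟫‖⁻¹ : ℝ) : ℂ) * ⟪z, z₀⟫ = c at *
    ext1 v
    simp only [rankOne_apply, _root_.inner_smul_left, smul_smul]
    rw [mul_right_comm, h7, one_mul]

/-- The inverse of the coordinates of `ℂ⁴` adapted to a hypersurface. -/
def coordInv (p : ℝ⁵ → CP3) (z n : ℝ⁵ → C4) (y : ℝ⁵) : C4 →L[ℝ] (ℝ⁵ × ℝ × ℂ) :=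
  (coordMap (fderiv ℝ (fun x => proj (p x)) y) (z y) (n y)).inverse

theorem exists_equiv_coordMap {D : ℝ⁵ →L[ℝ] Op4} {z n : C4}
    (h : Function.Injective (coordMap D z n)) :
    ∃ e : (ℝ⁵ × ℝ × ℂ) ≃L[ℝ] C4, (e : (ℝ⁵ × ℝ × ℂ) →L[ℝ] C4) = coordMap D z n :=
  ⟨(LinearEquiv.ofInjectiveOfFinrankEq (coordMap D z n).toLinearMap h
    finrank_coord).toContinuousLinearEquiv, rfl⟩

theorem contDiffAt_coordMap {p : ℝ⁵ → CP3} {z n : ℝ⁵ → C4} {y : ℝ⁵}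
    (hG : ContDiffAt ℝ ∞ (fun x => proj (p x)) y) (hz : ContDiffAt ℝ ∞ z y)
    (hn : ContDiffAt ℝ ∞ n y) :
    ContDiffAt ℝ ∞ (fun x => coordMap (fderiv ℝ (fun x => proj (p x)) x) (z x) (n x)) y := by
  have hD := contDiffAt_fderiv hG
  simp only [coordMap]
  refine ContDiffAt.add (ContDiffAt.add ?_ ?_) ?_
  · refine ContDiffAt.clm_comp (ContDiffAt.clm_comp ?_ (ContDiffAt.clm_comp contDiffAt_const hD))
      contDiffAt_const
    have : ContDiff ℝ ∞ fun w : C4 => (ContinuousLinearMap.apply ℝ C4 w : (C4 →L[ℝ] C4) →L[ℝ] C4) :=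
      ContinuousLinearMap.contDiff (𝕜 := ℝ) (E := C4) (F := (C4 →L[ℝ] C4) →L[ℝ] C4)
        (ContinuousLinearMap.apply ℝ C4)
    exact this.contDiffAt.comp y hz
  · exact contDiffAt_const.smulRight hn
  · refine ContDiffAt.clm_comp ?_ contDiffAt_const
    have : ContDiff ℝ ∞ fun z : C4 => (ContinuousLinearMap.toSpanSingleton ℂ z).restrictScalars ℝ := by
      let L : C4 →L[ℝ] ℂ →L[ℝ] C4 := LinearMap.toContinuousLinearMap
        { toFun := fun z => (ContinuousLinearMap.toSpanSingleton ℂ z).restrictScalars ℝ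
          map_add' := fun a b => by ext; simp
          map_smul' := fun a b => by ext; simp; ring }
      exact L.contDiff
    exact this.contDiffAt.comp y hz

theorem contDiffAt_coordInv {p : ℝ⁵ → CP3} {z n : ℝ⁵ → C4} {y : ℝ⁵}
    (hG : ContDiffAt ℝ ∞ (fun x => proj (p x)) y) (hz : ContDiffAt ℝ ∞ z y)
    (hn : ContDiffAt ℝ ∞ n y)
    (h : Function.Injective (coordMap (fderiv ℝ (fun x => proj (p x)) y) (z y) (n y))) :
    ContDiffAt ℝ ∞ (coordInv p z n) y := by
  obtain ⟨e, he⟩ := exists_equiv_coordMap h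
  exact ContDiffAt.comp y (he ▸ contDiffAt_map_inverse e) (contDiffAt_coordMap hG hz hn)

theorem exists_normal {p : ℝ⁵ → CP3} {W : Set ℝ⁵} (hW : IsOpen W) {y : ℝ⁵} (hy : y ∈ W)
    (hG : ∀ y ∈ W, ContDiffAt ℝ ∞ (fun x => proj (p x)) y)
    (inj : ∀ y ∈ W, ∀ v, fderiv ℝ (fun x => proj (p x)) y v = 0 → v = 0) {z : ℝ⁵ → C4}
    (hz : ∀ x ∈ W, ContDiffAt ℝ ∞ z x)
    (hzp : ∀ x ∈ W, ‖z x‖ = 1 ∧ proj (p x) = rankOne ℂ (z x) (z x)) :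
    ∃ W' ⊆ W, IsOpen W' ∧ y ∈ W' ∧ ∃ n : ℝ⁵ → C4, (∀ x ∈ W', ContDiffAt ℝ ∞ n x) ∧
      ∀ x ∈ W', ‖n x‖ = 1 ∧ ⟪z x, n x⟫ = 0 ∧
        ∀ v, (⟪n x, fderiv ℝ (fun x => proj (p x)) x v (z x)⟫).re = 0 := by
  set D := fderiv ℝ (fun x => proj (p x)) with hD
  have riesz_mem (x : ℝ⁵) (l : C4 →L[ℝ] ℝ) (hl : ∀ (v : ℝ⁵) (c : ℂ), l (D x v (z x) + c • z x) = 0) :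
      ⟪z x, rieszVec l⟫ = 0 ∧ ∀ v, (⟪rieszVec l, D x v (z x)⟫).re = 0 := by
    constructor
    · refine inner_zero_comm (Complex.ext ?_ ?_)
      · rw [re_inner_rieszVec]
        simpa using hl 0 1
      · have := hl 0 (-Complex.I)
        rw [← re_inner_rieszVec, _root_.inner_add_right, _root_.inner_smul_right] at this
        simpa using this
    · intro v
      rw [re_inner_rieszVec]
      simpa using hl v 0
  obtain ⟨n₀, hn1, hn2, hn3⟩ : ∃ n : C4, ‖n‖ = 1 ∧ ⟪z y, n⟫ = 0 ∧
      ∀ v, (⟪n, D y v (z y)⟫).re = 0 := by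
    let R : (ℝ⁵ × ℂ) →ₗ[ℝ] C4 :=
      { toFun := fun q => D y q.1 (z y) + q.2 • z y
        map_add' := fun a b => by simp [add_smul]; abel
        map_smul' := fun a b => by simp [mul_smul] }
    -- The tangent vectors and the complex line span at most 5 + 2 = 7 of the 8 real dimensions.
    have hR : LinearMap.range R < ⊤ := by
      rw [lt_top_iff_ne_top]
      intro h
      have h1 := LinearMap.finrank_range_le R
      have h2 : Module.finrank ℝ C4 = 8 := by rw [← finrank_coord]; simp
      rw [h, finrank_top, h2] at h1
      simp at h1
    obtain ⟨l, hl0, hl⟩ := Submodule.exists_le_ker_of_lt_top _ hR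
    have hl' : ∀ q, l (R q) = 0 := fun q => hl ⟨q, rfl⟩
    have h1 := riesz_mem y l.toContinuousLinearMap fun v c => hl' (v, c)
    have h0 : rieszVec l.toContinuousLinearMap ≠ 0 := by
      intro h0
      refine hl0 (LinearMap.ext fun w => ?_)
      have := re_inner_rieszVec l.toContinuousLinearMap w
      rw [h0] at this
      simpa using this.symm
    refine ⟨(‖rieszVec l.toContinuousLinearMap‖⁻¹ : ℝ) • rieszVec l.toContinuousLinearMap, ?_, ?_,
      fun v => ?_⟩
    · rw [norm_smul, norm_inv, norm_norm, inv_mul_cancel₀ (norm_ne_zero_iff.2 h0)]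
    · rw [← Complex.coe_smul, _root_.inner_smul_right, h1.1, mul_zero]
    · rw [← Complex.coe_smul, _root_.inner_smul_left, Complex.conj_ofReal, Complex.re_ofReal_mul, h1.2,
        mul_zero]
  have hinj : Function.Injective (coordMap (D y) (z y) n₀) :=
    coordMap_injective (hzp y hy).1 (hzp y hy).2
      (fun v => fderiv_proj_mem ((hG y hy).differentiableAt (by simp)) v) (inj y hy) hn2 hn1 hn3
  obtain ⟨e, he⟩ := exists_equiv_coordMap hinj
  have hcont : ContinuousOn (fun x => coordMap (D x) (z x) n₀) W := fun x hx =>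
    (contDiffAt_coordMap (n := fun _ => n₀) (hG x hx) (hz x hx)
      contDiffAt_const).continuousAt.continuousWithinAt
  have hopen := hcont.isOpen_inter_preimage hW (ContinuousLinearEquiv.isOpen (𝕜 := ℝ)
    (E := ℝ⁵ × ℝ × ℂ) (F := C4))
  -- With the constant vector n₀ the adapted coordinates remain invertible near y. Their middle
  -- component annihilates tangent vectors and the line, so its representing vector is a smooth
  -- normal, even though n₀ itself is normal only at y.
  set l : ℝ⁵ → C4 →L[ℝ] ℝ := fun x =>
    ((ContinuousLinearMap.fst ℝ ℝ ℂ).comp (ContinuousLinearMap.snd ℝ ℝ⁵ (ℝ × ℂ))).comp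
      (coordInv p z (fun _ => n₀) x)
  have hl (x : ℝ⁵) (e : (ℝ⁵ × ℝ × ℂ) ≃L[ℝ] C4)
      (he : (e : (ℝ⁵ × ℝ × ℂ) →L[ℝ] C4) = coordMap (D x) (z x) n₀) (v : ℝ⁵) (t : ℝ) (c : ℂ) :
      l x (D x v (z x) + t • n₀ + c • z x) = t := by
    have h1 : coordInv p z (fun _ => n₀) x = e.symm := by
      rw [coordInv, ← hD, ← he, ContinuousLinearMap.inverse_equiv]
    have h2 : e (v, t, c) = D x v (z x) + t • n₀ + c • z x := by
      rw [← coordMap_apply, ← he]; rfl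
    simp [l, h1, ← h2]
  have hsm : ∀ x ∈ W ∩ (fun x => coordMap (D x) (z x) n₀) ⁻¹'
      Set.range ((↑) : ((ℝ⁵ × ℝ × ℂ) ≃L[ℝ] C4) → _), ContDiffAt ℝ ∞ (fun x => rieszVec (l x)) x := by
    rintro x ⟨hx, e, he⟩
    replace he : (e : (ℝ⁵ × ℝ × ℂ) →L[ℝ] C4) = coordMap (D x) (z x) n₀ := he
    have h1 := contDiffAt_coordInv (p := p) (z := z) (n := fun _ => n₀) (hG x hx) (hz x hx)
      contDiffAt_const (by rw [← hD, ← he]; exact e.injective)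
    exact contDiffAt_rieszVec (contDiffAt_const.clm_comp h1)
  have h0 : ∀ x ∈ W ∩ (fun x => coordMap (D x) (z x) n₀) ⁻¹'
      Set.range ((↑) : ((ℝ⁵ × ℝ × ℂ) ≃L[ℝ] C4) → _), rieszVec (l x) ≠ 0 := by
    rintro x ⟨hx, e, he⟩ h0
    have h1 := hl x e he 0 1 0
    rw [← re_inner_rieszVec, h0] at h1
    simp at h1
  refine ⟨_, Set.inter_subset_left, hopen, ⟨hy, e, he⟩, unitVec fun x => rieszVec (l x),
    fun x hx => contDiffAt_unitVec (hsm x hx) (h0 x hx), fun x hx =>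
      ⟨norm_unitVec (h0 x hx), ?_⟩⟩
  obtain ⟨hx, e, he⟩ := hx
  have h1 := riesz_mem x (l x) fun v c => by simpa using hl x e he v 0 c
  constructor
  · rw [unitVec, ← Complex.coe_smul, _root_.inner_smul_right, h1.1, mul_zero]
  · intro v
    rw [unitVec, ← Complex.coe_smul, _root_.inner_smul_left, Complex.conj_ofReal, Complex.re_ofReal_mul,
      h1.2, mul_zero]

end MovingFrame
end

/-! ### Unitary frames adapted to the hypersurface -/

noncomputable section

namespace MovingFrame

open ComplexConjugate CP3 InnerProductSpace

local notation "⟪" x ", " y "⟫" => Inner.inner ℂ x y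
local notation "ℝ⁵" => EuclideanSpace ℝ (Fin 5)

theorem fderiv_rankOne {a b : ℝ⁵ → C4} {y : ℝ⁵} (ha : DifferentiableAt ℝ a y)
    (hb : DifferentiableAt ℝ b y) (v : ℝ⁵) :
    DifferentiableAt ℝ (fun x => rankOne ℂ (a x) (b x)) y ∧
    fderiv ℝ (fun x => rankOne ℂ (a x) (b x)) y v =
      rankOne ℂ (a y) (fderiv ℝ b y v) + rankOne ℂ (fderiv ℝ a y v) (b y) := by
  have := (isBoundedBilinearMap_rankOne.hasFDerivAt (a y, b y)).comp y
    (ha.hasFDerivAt.prodMk hb.hasFDerivAt)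
  refine ⟨this.differentiableAt, ?_⟩
  change fderiv ℝ ((fun q : C4 × C4 => rankOne ℂ q.1 q.2) ∘ fun x => (a x, b x)) y v = _
  rw [this.fderiv]
  rfl

theorem exists_adapted {p : ℝ⁵ → CP3} {W : Set ℝ⁵} (hW : IsOpen W) {y : ℝ⁵} (hy : y ∈ W)
    (hG : ∀ y ∈ W, ContDiffAt ℝ ∞ (fun x => proj (p x)) y)
    (inj : ∀ y ∈ W, ∀ v, fderiv ℝ (fun x => proj (p x)) y v = 0 → v = 0) :
    ∃ W' ⊆ W, y ∈ W' ∧ ∃ Z, IsAdapted p W' Z := by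
  obtain ⟨W₁, h₁, hW₁, hy₁, z, hz, hzp⟩ := exists_lift hW hy hG
  obtain ⟨W₂, h₂, hW₂, hy₂, n, hn, hnp⟩ := exists_normal hW₁ hy₁ (fun x hx => hG x (h₁ hx))
    (fun x hx => inj x (h₁ hx)) hz hzp
  have o1 {x} (hx : x ∈ W₂) : ⟪z x, z x⟫ = 1 := inner_self_one (hzp x (h₂ hx)).1
  have o2 {x} (hx : x ∈ W₂) : ⟪n x, n x⟫ = 1 := inner_self_one (hnp x hx).1
  have o3 {x} (hx : x ∈ W₂) : ⟪z x, n x⟫ = 0 := (hnp x hx).2.1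
  have o4 {x} (hx : x ∈ W₂) : ⟪n x, z x⟫ = 0 := inner_zero_comm (o3 hx)
  obtain ⟨W₃, h₃, hW₃, hy₃, a, ha, hap⟩ := exists_extend (k := 2) (by norm_num) hW₂ hy₂ ![z, n]
    (fun i x hx => by
      fin_cases i
      exacts [hz x (h₂ hx), hn x hx])
    (fun x hx i j => by fin_cases i <;> fin_cases j <;> simp [-inner_self_eq_norm_sq_to_K, o1 hx, o2 hx, o3 hx, o4 hx])
  have o5 {x} (hx : x ∈ W₃) : ⟪a x, a x⟫ = 1 := inner_self_one (hap x hx).1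
  have o6 {x} (hx : x ∈ W₃) : ⟪z x, a x⟫ = 0 := (hap x hx).2 0
  have o7 {x} (hx : x ∈ W₃) : ⟪n x, a x⟫ = 0 := (hap x hx).2 1
  have o8 {x} (hx : x ∈ W₃) : ⟪a x, z x⟫ = 0 := inner_zero_comm (o6 hx)
  have o9 {x} (hx : x ∈ W₃) : ⟪a x, n x⟫ = 0 := inner_zero_comm (o7 hx)
  obtain ⟨W₄, h₄, hW₄, hy₄, b, hb, hbp⟩ := exists_extend (k := 3) (by norm_num) hW₃ hy₃ ![z, n, a]
    (fun i x hx => by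
      fin_cases i
      exacts [hz x (h₂ (h₃ hx)), hn x (h₃ hx), ha x hx])
    (fun x hx i j => by
      fin_cases i <;> fin_cases j <;> simp [-inner_self_eq_norm_sq_to_K, o1 (h₃ hx), o2 (h₃ hx), o3 (h₃ hx), o4 (h₃ hx), o5 hx,
        o6 hx, o7 hx, o8 hx, o9 hx])
  have p1 {x} (hx : x ∈ W₄) : ⟪b x, b x⟫ = 1 := inner_self_one (hbp x hx).1
  have p2 {x} (hx : x ∈ W₄) : ⟪z x, b x⟫ = 0 := (hbp x hx).2 0
  have p3 {x} (hx : x ∈ W₄) : ⟪n x, b x⟫ = 0 := (hbp x hx).2 1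
  have p4 {x} (hx : x ∈ W₄) : ⟪a x, b x⟫ = 0 := (hbp x hx).2 2
  have hsub {x} (hx : x ∈ W₄) : x ∈ W₁ := h₂ (h₃ (h₄ hx))
  refine ⟨W₄, fun x hx => h₁ (hsub hx), hy₄, ![z, n, a, b], ⟨⟨hW₄, fun i x hx => ?_,
    fun x hx i j => ?_⟩, fun x hx => hG x (h₁ (hsub hx)), fun x hx => inj x (h₁ (hsub hx)),
    fun x hx => (hzp x (hsub hx)).2, fun x hx v => ?_⟩⟩
  · fin_cases i
    exacts [hz x (hsub hx), hn x (h₃ (h₄ hx)), ha x (h₄ hx), hb x hx]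
  · fin_cases i <;> fin_cases j <;> simp [-inner_self_eq_norm_sq_to_K, o1 (h₃ (h₄ hx)), o2 (h₃ (h₄ hx)), o3 (h₃ (h₄ hx)),
      o4 (h₃ (h₄ hx)), o5 (h₄ hx), o6 (h₄ hx), o7 (h₄ hx), o8 (h₄ hx), o9 (h₄ hx), p1 hx, p2 hx,
      p3 hx, p4 hx, inner_zero_comm (p2 hx), inner_zero_comm (p3 hx), inner_zero_comm (p4 hx)]
  · have h0 : ∀ᶠ x' in nhds x, ⟪n x', z x'⟫ = 0 :=
      Filter.eventually_of_mem (hW₂.mem_nhds (h₃ (h₄ hx))) fun x' hx' => o4 hx'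
    have h1 := (hnp x (h₃ (h₄ hx))).2.2 v
    have h2 : fderiv ℝ (fun x => proj (p x)) x v =
        rankOne ℂ (z x) (fderiv ℝ z x v) + rankOne ℂ (fderiv ℝ z x v) (z x) := by
      have hz' := (hz x (hsub hx)).differentiableAt (by simp)
      rw [Filter.EventuallyEq.fderiv_eq (Filter.eventually_of_mem (hW₁.mem_nhds (hsub hx))
        fun x' hx' => (hzp x' hx').2)]
      exact (fderiv_rankOne hz' hz' v).2
    rw [h2] at h1
    simpa [-inner_self_eq_norm_sq_to_K, connForm, o1 (h₃ (h₄ hx)), o4 (h₃ (h₄ hx)), _root_.inner_add_right] using h1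

namespace IsAdapted

variable {p : ℝ⁵ → CP3} {W : Set ℝ⁵} {Z : Fin 4 → ℝ⁵ → C4} {y : ℝ⁵} (h : IsAdapted p W Z)
  (hy : y ∈ W)

include h hy

theorem norm_zero : ‖Z 0 y‖ = 1 :=
  (orthonormal_iff_ite (v := fun i => Z i y).2 (h.orthonormal y hy)).1 0

theorem mem (v : ℝ⁵) : fderiv ℝ (fun x => proj (p x)) y v ∈ tangentSpace (p y) :=
  fderiv_proj_mem ((h.smooth_proj y hy).differentiableAt (by simp)) v

theorem inner_zero_apply (v : ℝ⁵) : ⟪Z 0 y, fderiv ℝ (fun x => proj (p x)) y v (Z 0 y)⟫ = 0 :=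
  (eq_tvec_of_mem (h.norm_zero hy) (h.lift y hy) (h.mem hy v)).1

theorem inner_apply {i : Fin 4} (hi : i ≠ 0) (v : ℝ⁵) :
    ⟪Z i y, fderiv ℝ (fun x => proj (p x)) y v (Z 0 y)⟫ = connForm Z i 0 y v := by
  have h1 : fderiv ℝ (fun x => proj (p x)) y v = rankOne ℂ (Z 0 y) (fderiv ℝ (Z 0) y v) +
      rankOne ℂ (fderiv ℝ (Z 0) y v) (Z 0 y) := by
    rw [Filter.EventuallyEq.fderiv_eq (Filter.eventually_of_mem (h.isOpen.mem_nhds hy) h.lift)]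
    exact (fderiv_rankOne (h.differentiableAt hy 0) (h.differentiableAt hy 0) v).2
  rw [h1]
  simp [-inner_self_eq_norm_sq_to_K, h.orthonormal y hy, hi, connForm, _root_.inner_add_right]

theorem apply_eq (v : ℝ⁵) : fderiv ℝ (fun x => proj (p x)) y v (Z 0 y) =
    connForm Z 1 0 y v • Z 1 y + connForm Z 2 0 y v • Z 2 y + connForm Z 3 0 y v • Z 3 y := by
  rw [h.sum_inner hy (fderiv ℝ (fun x => proj (p x)) y v (Z 0 y)), Fin.sum_univ_four,
    h.inner_zero_apply hy, h.inner_apply hy (by decide), h.inner_apply hy (by decide),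
    h.inner_apply hy (by decide), zero_smul, zero_add]

theorem hyperplaneAt :
    HyperplaneAt (p y) (fderiv ℝ (fun x => proj (p x)) y) (tvec (Z 0 y) (Z 1 y)) := by
  have h01 : ⟪Z 0 y, Z 1 y⟫ = 0 := by simp [-inner_self_eq_norm_sq_to_K, h.orthonormal y hy]
  refine ⟨h.mem hy, h.inj y hy, tvec_mem (h.norm_zero hy) (h.lift y hy) h01, fun v => ?_, ?_⟩
  · rw [tvec_inner_apply (h.norm_zero hy) (h.lift y hy)
      (tvec_mem (h.norm_zero hy) (h.lift y hy) h01) (h.mem hy v), tvec_self (h.norm_zero hy) h01,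
      h.inner_apply hy (by decide), h.normal y hy]
  · rw [inner_tvec (h.norm_zero hy) h01 h01]
    simp [-inner_self_eq_norm_sq_to_K, h.orthonormal y hy]

theorem coordMap_injective :
    Function.Injective (coordMap (fderiv ℝ (fun x => proj (p x)) y) (Z 0 y) (Z 1 y)) := by
  have h01 : ⟪Z 0 y, Z 1 y⟫ = 0 := by simp [-inner_self_eq_norm_sq_to_K, h.orthonormal y hy]
  have h2 := (h.hyperplaneAt hy).norm_apply (h.norm_zero hy) (h.lift y hy)
  rw [tvec_self (h.norm_zero hy) h01] at h2
  exact CP3.coordMap_injective (h.norm_zero hy) (h.lift y hy) (h.mem hy) (h.inj y hy) h01 h2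
    fun v => by rw [h.inner_apply hy (by decide), h.normal y hy]

end IsAdapted

/-- The vector tangent to a hypersurface of `CP³` whose image corresponds to `w`. -/
def tangentVec (p : ℝ⁵ → CP3) (Z : Fin 4 → ℝ⁵ → C4) (y : ℝ⁵) (w : C4) : ℝ⁵ :=
  (coordInv p (Z 0) (Z 1) y w).1

theorem tangentVec_add (p : ℝ⁵ → CP3) (Z : Fin 4 → ℝ⁵ → C4) (y : ℝ⁵) (w w' : C4) :
    tangentVec p Z y (w + w') = tangentVec p Z y w + tangentVec p Z y w' := by
  rw [tangentVec, map_add]; rfl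

theorem tangentVec_smul (p : ℝ⁵ → CP3) (Z : Fin 4 → ℝ⁵ → C4) (y : ℝ⁵) (c : ℝ) (w : C4) :
    tangentVec p Z y (c • w) = c • tangentVec p Z y w := by
  rw [tangentVec, map_smul]; rfl

namespace IsAdapted

variable {p : ℝ⁵ → CP3} {W : Set ℝ⁵} {Z : Fin 4 → ℝ⁵ → C4} {y : ℝ⁵} (h : IsAdapted p W Z)
  (hy : y ∈ W)

include h hy

theorem contDiffAt_tangentVec {w : ℝ⁵ → C4} (hw : ContDiffAt ℝ ∞ w y) :
    ContDiffAt ℝ ∞ (fun x => tangentVec p Z x (w x)) y :=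
  ((contDiffAt_coordInv (h.smooth_proj y hy) (h.smooth 0 y hy) (h.smooth 1 y hy)
    (h.coordMap_injective hy)).clm_apply hw).fst

theorem tangentVec_apply (v : ℝ⁵) :
    tangentVec p Z y (fderiv ℝ (fun x => proj (p x)) y v (Z 0 y)) = v := by
  obtain ⟨e, he⟩ := exists_equiv_coordMap (h.coordMap_injective hy)
  have h2 : e (v, 0, 0) = fderiv ℝ (fun x => proj (p x)) y v (Z 0 y) := by
    have := coordMap_apply (fderiv ℝ (fun x => proj (p x)) y) (Z 0 y) (Z 1 y) v 0 0
    rw [← he] at this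
    simpa using this
  rw [tangentVec, coordInv, ← he, ContinuousLinearMap.inverse_equiv, ← h2]
  simp

theorem apply_tangentVec {w : C4} (h0 : ⟪Z 0 y, w⟫ = 0) (h1 : (⟪Z 1 y, w⟫).re = 0) :
    fderiv ℝ (fun x => proj (p x)) y (tangentVec p Z y w) (Z 0 y) = w := by
  obtain ⟨e, he⟩ := exists_equiv_coordMap (h.coordMap_injective hy)
  obtain ⟨⟨v, t, c⟩, rfl⟩ := e.surjective w
  have h2 : e (v, t, c) = fderiv ℝ (fun x => proj (p x)) y v (Z 0 y) + t • Z 1 y + c • Z 0 y := by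
    rw [← coordMap_apply, ← he]; rfl
  rw [h2, ← Complex.coe_smul, _root_.inner_add_right, _root_.inner_add_right, h.inner_zero_apply hy,
    _root_.inner_smul_right, _root_.inner_smul_right, h.orthonormal y hy, h.orthonormal y hy] at h0
  rw [h2, ← Complex.coe_smul, _root_.inner_add_right, _root_.inner_add_right,
    h.inner_apply hy (by decide), _root_.inner_smul_right, _root_.inner_smul_right,
    h.orthonormal y hy, h.orthonormal y hy] at h1
  simp [h.normal y hy] at h0 h1
  rw [h2, h0, h1, zero_smul, zero_smul, add_zero, add_zero]
  rw [h.tangentVec_apply hy]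

end IsAdapted

end MovingFrame
end

/-! ### The second fundamental form in terms of connection forms -/

noncomputable section

namespace MovingFrame

open ComplexConjugate CP3 InnerProductSpace HopfForms

local notation "⟪" x ", " y "⟫" => Inner.inner ℂ x y
local notation "ℝ⁵" => EuclideanSpace ℝ (Fin 5)

/-- The pointwise conditions for equality in the bound of the Ricci curvature of the structure
vector of a hypersurface in coordinates: the structure vector is in the kernel of the second
fundamental form, whose trace vanishes. -/
def HasEqualityAt (p : ℝ⁵ → CP3) (y : ℝ⁵) : Prop :=
  ∀ ξ, HyperplaneAt (p y) (fderiv ℝ (fun x => proj (p x)) y) ξ →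
    (∀ u, fderiv ℝ (fun x => proj (p x)) y u = J (p y) ξ → ∀ v, hs p y ξ u v = 0) ∧
    ∀ E, IsOrthoFrame (fderiv ℝ (fun x => proj (p x)) y) E → ∑ a, hs p y ξ (E a) (E a) = 0

namespace IsAdapted

variable {p : ℝ⁵ → CP3} {W : Set ℝ⁵} {Z : Fin 4 → ℝ⁵ → C4} {y : ℝ⁵} (h : IsAdapted p W Z)
  (hy : y ∈ W)

include h hy

/-- Weingarten's formula: differentiating ⟨dP v, ξ⟩ = 0 along u trades the second derivative of P
for the derivative of ξ = Z₁ Z₀* + Z₀ Z₁*, which the connection forms describe. -/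
theorem hs_eq (u v : ℝ⁵) : hs p y (tvec (Z 0 y) (Z 1 y)) u v =
    -(conj (connForm Z 2 0 y v) * connForm Z 2 1 y u + conj (connForm Z 3 0 y v) * connForm Z 3 1 y u
      - connForm Z 1 0 y v * (connForm Z 1 1 y u - connForm Z 0 0 y u)).re := by
  have hD := fun i => h.differentiableAt hy i
  have r1 := fderiv_rankOne (hD 1) (hD 0) u
  have r2 := fderiv_rankOne (hD 0) (hD 1) u
  have h1 := CP3.fderiv_inner (hasFDerivAt_fderiv_apply (h.smooth_proj y hy) v) (r1.1.add r2.1) u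
  have h0 : (fun x => inner (fderiv ℝ (fun x => proj (p x)) x v)
      (((fun x => rankOne ℂ (Z 1 x) (Z 0 x)) + fun x => rankOne ℂ (Z 0 x) (Z 1 x)) x)) =ᶠ[nhds y]
      fun _ => (0 : ℝ) := Filter.eventually_of_mem (h.isOpen.mem_nhds hy) fun x hx =>
    (CP3.inner_comm _ _).trans ((h.hyperplaneAt hx).normal v)
  rw [h0.fderiv_eq, fderiv_fderiv_apply (h.smooth_proj y hy), fderiv_add r1.1 r2.1] at h1
  simp only [add_apply, r1.2, r2.2, fderiv_const_apply, zero_apply] at h1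
  have h2 : hs p y (tvec (Z 0 y) (Z 1 y)) u v = - inner (fderiv ℝ (fun x => proj (p x)) y v)
      (rankOne ℂ (Z 1 y) (fderiv ℝ (Z 0) y u) + rankOne ℂ (fderiv ℝ (Z 1) y u) (Z 0 y) +
      (rankOne ℂ (Z 0 y) (fderiv ℝ (Z 1) y u) + rankOne ℂ (fderiv ℝ (Z 0) y u) (Z 1 y))) :=
    eq_neg_of_add_eq_zero_right h1.symm
  obtain ⟨hw, hv⟩ := eq_tvec_of_mem (h.norm_zero hy) (h.lift y hy) (h.mem hy v)
  have hw1 := h.inner_apply hy (i := 1) (by decide) v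
  have hw2 := h.inner_apply hy (i := 2) (by decide) v
  have hw3 := h.inner_apply hy (i := 3) (by decide) v
  rw [h2, hv]
  generalize fderiv ℝ (fun x => proj (p x)) y v (Z 0 y) = w at *
  have o1 : ⟪Z 0 y, Z 1 y⟫ = 0 := by rw [h.orthonormal y hy]; rfl
  have o2 : ⟪Z 0 y, Z 0 y⟫ = 1 := by rw [h.orthonormal y hy]; rfl
  have e0 : conj (connForm Z 1 0 y v) = -connForm Z 1 0 y v := by
    refine Complex.ext ?_ ?_ <;> simp [h.normal y hy v]
  have e1 : ⟪w, Z 1 y⟫ = -connForm Z 1 0 y v := by rw [← inner_conj_symm, hw1, e0]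
  have e2 : ⟪fderiv ℝ (Z 0) y u, Z 0 y⟫ = -connForm Z 0 0 y u := by
    rw [← inner_conj_symm, ← h.skew hy]; rfl
  have e3 : ⟪w, fderiv ℝ (Z 1) y u⟫ = -connForm Z 1 0 y v * connForm Z 1 1 y u +
      conj (connForm Z 2 0 y v) * connForm Z 2 1 y u +
      conj (connForm Z 3 0 y v) * connForm Z 3 1 y u := by
    rw [h.inner_eq_sum hy w, Fin.sum_univ_four, hw, hw1, hw2, hw3, e0]
    simp [connForm]
  have e4 : ⟪fderiv ℝ (Z 1) y u, w⟫ = conj ⟪w, fderiv ℝ (Z 1) y u⟫ := (inner_conj_symm _ _).symm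
  have e5 : ⟪Z 0 y, fderiv ℝ (Z 0) y u⟫ = connForm Z 0 0 y u := rfl
  rw [tvec, CP3.inner_add_left]
  simp only [CP3.inner_add_right, inner_rankOne, hw, inner_zero_comm hw, o1, inner_zero_comm o1, o2,
    hw1, e1, e2, e4, e5, mul_zero, zero_mul, mul_one, one_mul, Complex.conj_re, Complex.zero_re,
    add_zero, zero_add]
  rw [e3]
  simp only [Complex.add_re, Complex.sub_re, Complex.mul_re, Complex.neg_re, Complex.neg_im,
    Complex.sub_im]
  ring

end IsAdapted

end MovingFrame
end

/-! ### The shape operator in an adapted frame under the equality conditions -/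

noncomputable section

namespace MovingFrame

open ComplexConjugate CP3 InnerProductSpace HopfForms

local notation "⟪" x ", " y "⟫" => Inner.inner ℂ x y
local notation "ℝ⁵" => EuclideanSpace ℝ (Fin 5)

/-- The vector tangent to a hypersurface of `CP³` with the given components in an adapted frame. -/
def frameVec (p : ℝ⁵ → CP3) (Z : Fin 4 → ℝ⁵ → C4) (y : ℝ⁵) (r : ℝ) (a b : ℂ) : ℝ⁵ :=
  tangentVec p Z y ((r * Complex.I) • Z 1 y + a • Z 2 y + b • Z 3 y)

theorem frameVec_eq_sum (p : ℝ⁵ → CP3) (Z : Fin 4 → ℝ⁵ → C4) (y : ℝ⁵) (r : ℝ) (a b : ℂ) :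
    frameVec p Z y r a b = r • frameVec p Z y 1 0 0 +
      (a.re • frameVec p Z y 0 1 0 + a.im • frameVec p Z y 0 Complex.I 0) +
      (b.re • frameVec p Z y 0 0 1 + b.im • frameVec p Z y 0 0 Complex.I) := by
  simp only [frameVec, ← tangentVec_smul, ← tangentVec_add]
  congr 1
  simp only [← Complex.coe_smul]
  conv_lhs => rw [← Complex.re_add_im a, ← Complex.re_add_im b]
  module

namespace IsAdapted

variable {p : ℝ⁵ → CP3} {W : Set ℝ⁵} {Z : Fin 4 → ℝ⁵ → C4} {y : ℝ⁵} (h : IsAdapted p W Z)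
  (hy : y ∈ W)

include h hy

theorem contDiffAt_frameVec {r : ℝ} {a b : ℝ⁵ → ℂ} (ha : ContDiffAt ℝ ∞ a y)
    (hb : ContDiffAt ℝ ∞ b y) : ContDiffAt ℝ ∞ (fun x => frameVec p Z x r (a x) (b x)) y :=
  h.contDiffAt_tangentVec hy (((contDiffAt_smul contDiffAt_const (h.smooth 1 y hy)).add
    (contDiffAt_smul ha (h.smooth 2 y hy))).add (contDiffAt_smul hb (h.smooth 3 y hy)))

theorem apply_frameVec (r : ℝ) (a b : ℂ) :
    fderiv ℝ (fun x => proj (p x)) y (frameVec p Z y r a b) (Z 0 y) =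
      (r * Complex.I) • Z 1 y + a • Z 2 y + b • Z 3 y := by
  apply h.apply_tangentVec hy <;>
  simp [-inner_self_eq_norm_sq_to_K, _root_.inner_add_right, _root_.inner_smul_right,
    h.orthonormal y hy]

theorem connForm_frameVec (r : ℝ) (a b : ℂ) :
    connForm Z 1 0 y (frameVec p Z y r a b) = r * Complex.I ∧
    connForm Z 2 0 y (frameVec p Z y r a b) = a ∧ connForm Z 3 0 y (frameVec p Z y r a b) = b := by
  refine ⟨?_, ?_, ?_⟩ <;> rw [← h.inner_apply hy (by decide), h.apply_frameVec hy] <;>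
  simp [-inner_self_eq_norm_sq_to_K, _root_.inner_add_right, _root_.inner_smul_right,
    h.orthonormal y hy]

theorem eq_frameVec (v : ℝ⁵) :
    v = frameVec p Z y (connForm Z 1 0 y v).im (connForm Z 2 0 y v) (connForm Z 3 0 y v) := by
  have h1 : ((connForm Z 1 0 y v).im : ℂ) * Complex.I = connForm Z 1 0 y v := by
    refine Complex.ext ?_ ?_ <;> simp [h.normal y hy v]
  rw [frameVec, h1, ← h.apply_eq hy, h.tangentVec_apply hy]

theorem inner_frameVec (r r' : ℝ) (a b a' b' : ℂ) :
    inner (fderiv ℝ (fun x => proj (p x)) y (frameVec p Z y r a b))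
      (fderiv ℝ (fun x => proj (p x)) y (frameVec p Z y r' a' b')) =
      r * r' + (conj a * a' + conj b * b').re := by
  rw [tvec_inner_apply (h.norm_zero hy) (h.lift y hy) (h.mem hy _) (h.mem hy _),
    h.apply_frameVec hy, h.apply_frameVec hy]
  simp [-inner_self_eq_norm_sq_to_K, _root_.inner_add_right, _root_.inner_smul_right,
    _root_.inner_add_left, _root_.inner_smul_left, h.orthonormal y hy]
  ring

theorem fderiv_structureVec :
    fderiv ℝ (fun x => proj (p x)) y (frameVec p Z y 1 0 0) =
      J (p y) (tvec (Z 0 y) (Z 1 y)) := by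
  have h01 : ⟪Z 0 y, Z 1 y⟫ = 0 := by simp [h.orthonormal y hy]
  rw [J_tvec (h.norm_zero hy) (h.lift y hy) h01,
    (eq_tvec_of_mem (h.norm_zero hy) (h.lift y hy) (h.mem hy _)).2, h.apply_frameVec hy]
  simp

theorem fderiv_frameVec_I (a b : ℂ) :
    fderiv ℝ (fun x => proj (p x)) y (frameVec p Z y 0 (Complex.I * a) (Complex.I * b)) =
      J (p y) (fderiv ℝ (fun x => proj (p x)) y (frameVec p Z y 0 a b)) := by
  have h1 := eq_tvec_of_mem (h.norm_zero hy) (h.lift y hy) (h.mem hy (frameVec p Z y 0 a b))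
  rw [h1.2, J_tvec (h.norm_zero hy) (h.lift y hy) h1.1,
    (eq_tvec_of_mem (h.norm_zero hy) (h.lift y hy) (h.mem hy _)).2, h.apply_frameVec hy,
    h.apply_frameVec hy]
  simp [smul_add, mul_smul]

theorem isOrthoFrame {a b c d : ℂ} (h1 : conj a * a + conj b * b = 1)
    (h2 : conj c * c + conj d * d = 1) (h3 : conj a * c + conj b * d = 0) :
    IsOrthoFrame (fderiv ℝ (fun x => proj (p x)) y)
      ![frameVec p Z y 0 a b, frameVec p Z y 0 c d,
        frameVec p Z y 0 (Complex.I * a) (Complex.I * b),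
        frameVec p Z y 0 (Complex.I * c) (Complex.I * d), frameVec p Z y 1 0 0] := by
  have r1 := congrArg Complex.re h1
  have r2 := congrArg Complex.re h2
  have r3 := congrArg Complex.re h3
  have i1 := congrArg Complex.im h1
  have i2 := congrArg Complex.im h2
  have i3 := congrArg Complex.im h3
  simp at r1 r2 r3 i1 i2 i3
  intro i j
  fin_cases i <;> fin_cases j <;> simp [h.inner_frameVec hy] <;> linarith

theorem structureVec_kernel (hp : HasEqualityAt p y) (v : ℝ⁵) :
    hs p y (tvec (Z 0 y) (Z 1 y)) (frameVec p Z y 1 0 0) v = 0 :=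
  (hp _ (h.hyperplaneAt hy)).1 _ (h.fderiv_structureVec hy) v

/-- On the structure vector only Ω₁₀ = i survives, so h(Jξ, v) = 0 compares the imaginary parts of
Ω₁₁ and Ω₀₀; the real parts vanish by skewness. -/
theorem connForm_hopf (hp : HasEqualityAt p y) (v : ℝ⁵) :
    connForm Z 1 1 y v = connForm Z 0 0 y v := by
  have h1 := h.structureVec_kernel hy hp v
  obtain ⟨c1, c2, c3⟩ := h.connForm_frameVec hy 1 0 0
  rw [hs_comm (h.smooth_proj y hy), h.hs_eq hy, c1, c2, c3] at h1
  have s1 := congrArg Complex.re (h.skew hy 1 1 v)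
  have s0 := congrArg Complex.re (h.skew hy 0 0 v)
  simp at h1 s0 s1
  refine Complex.ext ?_ ?_ <;> linarith

theorem hs_eq_of_equality (hp : HasEqualityAt p y) (u v : ℝ⁵) :
    hs p y (tvec (Z 0 y) (Z 1 y)) u v = -(conj (connForm Z 2 0 y v) * connForm Z 2 1 y u +
      conj (connForm Z 3 0 y v) * connForm Z 3 1 y u).re := by
  rw [h.hs_eq hy, h.connForm_hopf hy hp, sub_self, mul_zero, sub_zero]

theorem connForm_structureVec (hp : HasEqualityAt p y) :
    connForm Z 2 1 y (frameVec p Z y 1 0 0) = 0 ∧ connForm Z 3 1 y (frameVec p Z y 1 0 0) = 0 := by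
  have h1 (a b : ℂ) := h.structureVec_kernel hy hp (frameVec p Z y 0 a b)
  simp only [h.hs_eq_of_equality hy hp, h.connForm_frameVec hy] at h1
  have k1 := h1 1 0
  have k2 := h1 Complex.I 0
  have k3 := h1 0 1
  have k4 := h1 0 Complex.I
  simp at k1 k2 k3 k4
  exact ⟨Complex.ext k1 k2, Complex.ext k3 k4⟩

end IsAdapted

/-- The complex linear part of the shape operator in an adapted frame. -/
def shapeLin (p : ℝ⁵ → CP3) (Z : Fin 4 → ℝ⁵ → C4) (i j : Fin 4) (y : ℝ⁵) : ℂ :=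
  (connForm Z i 1 y (frameVec p Z y 0 (if j = 2 then 1 else 0) (if j = 3 then 1 else 0)) -
    Complex.I * connForm Z i 1 y (frameVec p Z y 0 (if j = 2 then Complex.I else 0)
      (if j = 3 then Complex.I else 0))) / 2

/-- The antilinear part of the shape operator in an adapted frame. -/
def shapeAnti (p : ℝ⁵ → CP3) (Z : Fin 4 → ℝ⁵ → C4) (i j : Fin 4) (y : ℝ⁵) : ℂ :=
  (connForm Z i 1 y (frameVec p Z y 0 (if j = 2 then 1 else 0) (if j = 3 then 1 else 0)) +
    Complex.I * connForm Z i 1 y (frameVec p Z y 0 (if j = 2 then Complex.I else 0)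
      (if j = 3 then Complex.I else 0))) / 2

theorem connForm_add (Z : Fin 4 → ℝ⁵ → C4) (i j : Fin 4) (y u v : ℝ⁵) :
    connForm Z i j y (u + v) = connForm Z i j y u + connForm Z i j y v := by
  rw [connForm, map_add, _root_.inner_add_right]; rfl

theorem connForm_smul (Z : Fin 4 → ℝ⁵ → C4) (i j : Fin 4) (y v : ℝ⁵) (c : ℝ) :
    connForm Z i j y (c • v) = c * connForm Z i j y v := by
  rw [connForm, map_smul, ← Complex.coe_smul, _root_.inner_smul_right]; rfl

namespace IsAdapted

variable {p : ℝ⁵ → CP3} {W : Set ℝ⁵} {Z : Fin 4 → ℝ⁵ → C4} (h : IsAdapted p W Z)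
  (hp : ∀ y ∈ W, HasEqualityAt p y)

include h hp

theorem isHopf : IsHopf W (connForm Z) where
  skew y hy i j v := h.skew hy i j v
  diff y hy i j v := (h.contDiffAt_connForm hy i j contDiffAt_const).differentiableAt (by simp)
  flat y hy i j u v := h.flat hy i j u v
  normal y hy v := by
    have h1 := h.skew hy 1 0 v
    have h2 : conj (connForm Z 1 0 y v) = -connForm Z 1 0 y v := by
      refine Complex.ext ?_ ?_ <;> simp [h.normal y hy v]
    exact neg_injective (h1.symm.trans h2)
  hopf y hy v := h.connForm_hopf hy (hp y hy) v
  surj y hy a b := ⟨frameVec p Z y 0 a b, (h.connForm_frameVec hy 0 a b).2⟩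

theorem isShape : IsShape W (connForm Z) (shapeLin p Z) (shapeAnti p Z) where
  eq y hy i hi v := by
    -- The structure vector contributes nothing, so Ω_{i1} is a real linear function of the two
    -- holomorphic components and splits into linear and antilinear parts.
    have h0 : connForm Z i 1 y (frameVec p Z y 1 0 0) = 0 := by
      have := h.connForm_structureVec hy (hp y hy)
      have hi' : i = 2 ∨ i = 3 := by omega
      rcases hi' with rfl | rfl
      exacts [this.1, this.2]
    conv_lhs => rw [h.eq_frameVec hy v, frameVec_eq_sum]
    simp only [connForm_add, connForm_smul, h0, shapeLin, shapeAnti]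
    generalize connForm Z 2 0 y v = a
    generalize connForm Z 3 0 y v = b
    simp only [show (2 : Fin 4) ≠ 3 by decide, show (3 : Fin 4) ≠ 2 by decide, if_true, if_false]
    generalize connForm Z i 1 y (frameVec p Z y 0 1 0) = w1
    generalize connForm Z i 1 y (frameVec p Z y 0 Complex.I 0) = w2
    generalize connForm Z i 1 y (frameVec p Z y 0 0 1) = w3
    generalize connForm Z i 1 y (frameVec p Z y 0 0 Complex.I) = w4
    apply Complex.ext <;> simp <;> ring
  trace y hy := by
    have h1 := (hp y hy _ (h.hyperplaneAt hy)).2 _ (h.isOrthoFrame hy (a := 1) (b := 0) (c := 0)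
      (d := 1) (by simp) (by simp) (by simp))
    simp [Fin.sum_univ_five, h.hs_eq_of_equality hy (hp y hy), h.connForm_frameVec hy] at h1
    simp [shapeLin]
    linarith
  smooth_s i j y hy := by
    have h1 (a b : ℂ) : ContDiffAt ℝ ∞ (fun x => connForm Z i 1 x (frameVec p Z x 0 a b)) y :=
      h.contDiffAt_connForm hy i 1 (h.contDiffAt_frameVec hy contDiffAt_const contDiffAt_const)
    exact (((h1 _ _).sub (contDiffAt_const.mul (h1 _ _))).div_const 2).contDiffWithinAt
  smooth_t i j y hy := by
    have h1 (a b : ℂ) : ContDiffAt ℝ ∞ (fun x => connForm Z i 1 x (frameVec p Z x 0 a b)) y :=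
      h.contDiffAt_connForm hy i 1 (h.contDiffAt_frameVec hy contDiffAt_const contDiffAt_const)
    exact (((h1 _ _).add (contDiffAt_const.mul (h1 _ _))).div_const 2).contDiffWithinAt

/-- The shape operator is complex linear on the holomorphic distribution, and its square is the
identity there. -/
theorem shape_eq {y : ℝ⁵} (hy : y ∈ W) (a b a' b' : ℂ) :
    hs p y (tvec (Z 0 y) (Z 1 y)) (frameVec p Z y 0 a b) (frameVec p Z y 0 a' b') =
      -(conj a' * (shapeLin p Z 2 2 y * a + shapeLin p Z 2 3 y * b) +
        conj b' * (conj (shapeLin p Z 2 3 y) * a - shapeLin p Z 2 2 y * b)).re := by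
  have hh := h.isHopf hp
  have hs' := h.isShape hp
  obtain ⟨-, t1, t2, t3, t4⟩ := hs'.antilinear_eq_zero hh h.isOpen hy
  obtain ⟨l1, l2, l3, -⟩ := hs'.linear_relations hh h.isOpen hy
  rw [h.hs_eq_of_equality hy (hp y hy), hs'.eq y hy 2 le_rfl, hs'.eq y hy 3 (by decide), t1, t2, t3,
    t4, l2, l3]
  simp only [h.connForm_frameVec hy, zero_mul, add_zero]
  ring_nf

end IsAdapted

end MovingFrame
end

/-! ### Smooth eigenframes and diagonalisation -/

noncomputable section

namespace MovingFrame

open ComplexConjugate CP3 InnerProductSpace HopfForms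

local notation "⟪" x ", " y "⟫" => Inner.inner ℂ x y
local notation "ℝ⁵" => EuclideanSpace ℝ (Fin 5)

/-- A unitary frame of eigenvectors of the Hermitian matrix `!![a, b; conj b, -a]`. -/
structure IsEigenframe (W : Set ℝ⁵) (a b : ℝ⁵ → ℂ) (c c' d d' : ℝ⁵ → ℂ) : Prop where
  smooth : ∀ y ∈ W, ContDiffAt ℝ ∞ c y ∧ ContDiffAt ℝ ∞ c' y ∧ ContDiffAt ℝ ∞ d y ∧
    ContDiffAt ℝ ∞ d' y
  unit : ∀ y ∈ W, conj (c y) * c y + conj (c' y) * c' y = 1 ∧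
    conj (d y) * d y + conj (d' y) * d' y = 1
  orthogonal : ∀ y ∈ W, conj (c y) * d y + conj (c' y) * d' y = 0
  neg : ∀ y ∈ W, a y * c y + b y * c' y = -c y ∧ conj (b y) * c y - a y * c' y = -c' y
  pos : ∀ y ∈ W, a y * d y + b y * d' y = d y ∧ conj (b y) * d y - a y * d' y = d' y

theorem contDiffAt_conj {a : ℝ⁵ → ℂ} {y : ℝ⁵} (ha : ContDiffAt ℝ ∞ a y) :
    ContDiffAt ℝ ∞ (fun x => conj (a x)) y :=
  Complex.conjCLE.contDiff.contDiffAt.comp y ha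

/-- The eigenvectors are (1 - a, -conj b) for -1 and (b, 1 - a) for 1. Both have squared length 2(1
- a), which is positive exactly when a ≠ 1 because a² ≤ 1. -/
theorem exists_eigenframe_of_ne {W : Set ℝ⁵} (hW : IsOpen W) {y : ℝ⁵} (hy : y ∈ W) {a b : ℝ⁵ → ℂ}
    (ha : ∀ x ∈ W, ContDiffAt ℝ ∞ a x) (hb : ∀ x ∈ W, ContDiffAt ℝ ∞ b x)
    (har : ∀ x ∈ W, conj (a x) = a x) (hab : ∀ x ∈ W, a x ^ 2 + b x * conj (b x) = 1)
    (h1 : a y ≠ 1) :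
    ∃ W' ⊆ W, IsOpen W' ∧ y ∈ W' ∧ ∃ c c' d d', IsEigenframe W' a b c c' d d' := by
  have hc : ContinuousOn a W := fun x hx => (ha x hx).continuousAt.continuousWithinAt
  let k : ℝ⁵ → ℂ := fun x => ((√(2 * (1 - (a x).re)))⁻¹ : ℝ)
  have hre : ∀ x ∈ W, ((a x).re : ℂ) = a x := fun x hx => Complex.conj_eq_iff_re.1 (har x hx)
  have hpos : ∀ x ∈ W ∩ a ⁻¹' {1}ᶜ, 0 < 2 * (1 - (a x).re) := by
    rintro x ⟨hx, hx1⟩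
    have h2 := hab x hx
    rw [← hre x hx, Complex.mul_conj] at h2
    norm_cast at h2
    have h3 : (a x).re ≠ 1 := fun h => hx1 (show a x = 1 by rw [← hre x hx, h, Complex.ofReal_one])
    have h4 : (a x).re ≤ 1 := by nlinarith [Complex.normSq_nonneg (b x)]
    have := lt_of_le_of_ne h4 h3
    linarith
  have hk : ∀ x ∈ W ∩ a ⁻¹' {1}ᶜ, conj (k x) = k x ∧ k x ^ 2 * (2 * (1 - a x)) = 1 := by
    intro x hx
    refine ⟨Complex.conj_ofReal _, ?_⟩
    simp only [k]
    rw [← hre x hx.1]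
    norm_cast
    rw [inv_pow, Real.sq_sqrt (hpos x hx).le, inv_mul_cancel₀ (hpos x hx).ne']
  have hks : ∀ x ∈ W ∩ a ⁻¹' {1}ᶜ, ContDiffAt ℝ ∞ k x := by
    intro x hx
    have h2 : ContDiffAt ℝ ∞ (fun x => 2 * (1 - (a x).re)) x :=
      contDiffAt_const.mul (contDiffAt_const.sub
        (Complex.reCLM.contDiff.contDiffAt.comp x (ha x hx.1)))
    exact Complex.ofRealCLM.contDiff.contDiffAt.comp x
      ((h2.sqrt (hpos x hx).ne').inv (Real.sqrt_ne_zero'.2 (hpos x hx)))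
  refine ⟨W ∩ a ⁻¹' {1}ᶜ, Set.inter_subset_left,
    hc.isOpen_inter_preimage hW isOpen_compl_singleton, ⟨hy, h1⟩, fun x => k x * (1 - a x),
    fun x => -(k x * conj (b x)), fun x => k x * b x, fun x => k x * (1 - a x),
    fun x hx => ?_, fun x hx => ?_, fun x hx => ?_, fun x hx => ?_, fun x hx => ?_⟩
  · have hk' := hks x hx
    have e1 := hk'.mul (contDiffAt_const.sub (ha x hx.1) : ContDiffAt ℝ ∞ (fun x => 1 - a x) x)
    exact ⟨e1, (hk'.mul (contDiffAt_conj (hb x hx.1))).neg, hk'.mul (hb x hx.1), e1⟩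
  all_goals
    obtain ⟨k1, k2⟩ := hk x hx
    have hr := har x hx.1
    have h2 := hab x hx.1
    try simp only [map_mul, map_sub, map_neg, map_one, Complex.conj_conj, k1, hr]
    first
    | constructor
      · linear_combination k x ^ 2 * h2 + k2
      · linear_combination k x ^ 2 * h2 + k2
    | constructor
      · linear_combination -k x * h2
      · ring
    | constructor
      · ring
      · linear_combination k x * h2
    | ring

theorem exists_eigenframe {W : Set ℝ⁵} (hW : IsOpen W) {y : ℝ⁵} (hy : y ∈ W) {a b : ℝ⁵ → ℂ}
    (ha : ∀ x ∈ W, ContDiffAt ℝ ∞ a x) (hb : ∀ x ∈ W, ContDiffAt ℝ ∞ b x)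
    (har : ∀ x ∈ W, conj (a x) = a x) (hab : ∀ x ∈ W, a x ^ 2 + b x * conj (b x) = 1) :
    ∃ W' ⊆ W, IsOpen W' ∧ y ∈ W' ∧ ∃ c c' d d', IsEigenframe W' a b c c' d d' := by
  by_cases h1 : a y = 1
  -- Exchanging the two coordinates of ℂ² replaces (a, b) by (-a, conj b), so the excluded value a =
  -- 1 becomes -1.
  · obtain ⟨W', hW', ho, hy', c, c', d, d', h⟩ := exists_eigenframe_of_ne hW hy
      (a := fun x => -a x) (b := fun x => conj (b x)) (fun x hx => (ha x hx).neg)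
      (fun x hx => contDiffAt_conj (hb x hx)) (fun x hx => by rw [map_neg, har x hx])
      (fun x hx => by
        rw [Complex.conj_conj]
        linear_combination hab x hx)
      (by rw [h1]; norm_num)
    refine ⟨W', hW', ho, hy', c', c, d', d, ⟨fun x hx => ?_, fun x hx => ?_, fun x hx => ?_,
      fun x hx => ?_, fun x hx => ?_⟩⟩
    · obtain ⟨h1, h2, h3, h4⟩ := h.smooth x hx
      exact ⟨h2, h1, h4, h3⟩
    · have := h.unit x hx
      rwa [add_comm, add_comm (conj (d' x) * _)]
    · rw [add_comm]; exact h.orthogonal x hx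
    · obtain ⟨h1, h2⟩ := h.neg x hx
      rw [Complex.conj_conj] at h2
      exact ⟨by linear_combination h2, by linear_combination h1⟩
    · obtain ⟨h1, h2⟩ := h.pos x hx
      rw [Complex.conj_conj] at h2
      exact ⟨by linear_combination h2, by linear_combination h1⟩
  · exact exists_eigenframe_of_ne hW hy ha hb har hab h1

theorem contDiff_rankOne : ContDiff ℝ ∞ fun q : C4 × C4 => (rankOne ℂ q.1 q.2 : Op4) :=
  CP3.isBoundedBilinearMap_rankOne.contDiff

theorem contDiffAt_comp_pair {F : C4 × C4 → Op4} (hF : ContDiff ℝ ∞ F) {a b : ℝ⁵ → C4} {y : ℝ⁵}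
    (ha : ContDiffAt ℝ ∞ a y) (hb : ContDiffAt ℝ ∞ b y) :
    ContDiffAt ℝ ∞ (fun x => F (a x, b x)) y :=
  hF.contDiffAt.comp y (ha.prodMk hb)

theorem contDiffAt_rankOne {a b : ℝ⁵ → C4} {y : ℝ⁵} (ha : ContDiffAt ℝ ∞ a y)
    (hb : ContDiffAt ℝ ∞ b y) : ContDiffAt ℝ ∞ (fun x => (rankOne ℂ (a x) (b x) : Op4)) y :=
  contDiffAt_comp_pair contDiff_rankOne ha hb

/-- A hypersurface with equality in the bound of the Ricci curvature of the structure vector has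
local smooth frames in which the second fundamental form is diagonal. -/
theorem exists_diagonal_frame {p : ℝ⁵ → CP3} {V : Set ℝ⁵} (hV : IsOpen V) {y : ℝ⁵} (hy : y ∈ V)
    (hG : ∀ y ∈ V, ContDiffAt ℝ ∞ (fun x => proj (p x)) y)
    (inj : ∀ y ∈ V, ∀ v, fderiv ℝ (fun x => proj (p x)) y v = 0 → v = 0)
    (hp : ∀ y ∈ V, HasEqualityAt p y) :
    ∃ W ⊆ V, IsOpen W ∧ y ∈ W ∧ ∃ (ξ : ℝ⁵ → Op4) (E : Fin 5 → ℝ⁵ → ℝ⁵),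
      (∀ x ∈ W, ContDiffAt ℝ ∞ ξ x) ∧ (∀ a, ∀ x ∈ W, ContDiffAt ℝ ∞ (E a) x) ∧ ∀ x ∈ W,
        HyperplaneAt (p x) (fderiv ℝ (fun x => proj (p x)) x) (ξ x) ∧
        IsOrthoFrame (fderiv ℝ (fun x => proj (p x)) x) (fun a => E a x) ∧
        fderiv ℝ (fun x => proj (p x)) x (E 2 x) =
          J (p x) (fderiv ℝ (fun x => proj (p x)) x (E 0 x)) ∧
        fderiv ℝ (fun x => proj (p x)) x (E 3 x) =
          J (p x) (fderiv ℝ (fun x => proj (p x)) x (E 1 x)) ∧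
        ∀ a b, hs p x (ξ x) (E a x) (E b x) =
          Matrix.diagonal ![(1 : ℝ), -1, 1, -1, 0] a b := by
  obtain ⟨W₁, h₁, hy₁, Z, hZ⟩ := exists_adapted hV hy hG inj
  have hp₁ := fun x hx => hp x (h₁ hx)
  have hh := hZ.isHopf hp₁
  have hs' := hZ.isShape hp₁
  obtain ⟨W, hW, hWo, hyW, c, c', d, d', hc⟩ := exists_eigenframe hZ.isOpen hy₁
    (a := shapeLin p Z 2 2) (b := shapeLin p Z 2 3)
    (fun x hx => (hs'.smooth_s 2 2).contDiffAt (hZ.isOpen.mem_nhds hx))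
    (fun x hx => (hs'.smooth_s 2 3).contDiffAt (hZ.isOpen.mem_nhds hx))
    (fun x hx => (hs'.linear_relations hh hZ.isOpen hx).1)
    (fun x hx => (hs'.antilinear_eq_zero hh hZ.isOpen hx).1)
  refine ⟨W, hW.trans h₁, hWo, hyW, fun x => tvec (Z 0 x) (Z 1 x), fun i x =>
    ![frameVec p Z x 0 (c x) (c' x), frameVec p Z x 0 (d x) (d' x),
      frameVec p Z x 0 (Complex.I * c x) (Complex.I * c' x),
      frameVec p Z x 0 (Complex.I * d x) (Complex.I * d' x), frameVec p Z x 1 0 0] i,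
    fun x hx => ?_, fun i x hx => ?_, fun x hx => ⟨?_, ?_, ?_, ?_, fun i j => ?_⟩⟩
  · have hz (i : Fin 4) := hZ.smooth i x (hW hx)
    exact (contDiffAt_rankOne (hz 1) (hz 0)).add (contDiffAt_rankOne (hz 0) (hz 1))
  · obtain ⟨s1, s2, s3, s4⟩ := hc.smooth x hx
    fin_cases i
    exacts [hZ.contDiffAt_frameVec (hW hx) s1 s2, hZ.contDiffAt_frameVec (hW hx) s3 s4,
      hZ.contDiffAt_frameVec (hW hx) (contDiffAt_const.mul s1) (contDiffAt_const.mul s2),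
      hZ.contDiffAt_frameVec (hW hx) (contDiffAt_const.mul s3) (contDiffAt_const.mul s4),
      hZ.contDiffAt_frameVec (hW hx) contDiffAt_const contDiffAt_const]
  · exact hZ.hyperplaneAt (hW hx)
  · exact hZ.isOrthoFrame (hW hx) (hc.unit x hx).1 (hc.unit x hx).2 (hc.orthogonal x hx)
  · exact hZ.fderiv_frameVec_I (hW hx) (c x) (c' x)
  · exact hZ.fderiv_frameVec_I (hW hx) (d x) (d' x)
  · have k (v : ℝ⁵) := hZ.structureVec_kernel (hW hx) (hp₁ x (hW hx)) v
    have k' (v : ℝ⁵) := (hs_comm (hZ.smooth_proj x (hW hx)) _ _).trans (k v)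
    -- `shape_eq` carries a minus sign, so the eigenvalue -1 yields the entry 1 for the first pair
    -- e, Je.
    obtain ⟨n1, n2⟩ := hc.neg x hx
    obtain ⟨q1, q2⟩ := hc.pos x hx
    have e (w a b : ℂ) : shapeLin p Z 2 2 x * (w * a) + shapeLin p Z 2 3 x * (w * b) =
      w * (shapeLin p Z 2 2 x * a + shapeLin p Z 2 3 x * b) := by ring
    have e' (w a b : ℂ) : conj (shapeLin p Z 2 3 x) * (w * a) - shapeLin p Z 2 2 x * (w * b) =
      w * (conj (shapeLin p Z 2 3 x) * a - shapeLin p Z 2 2 x * b) := by ring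
    obtain ⟨u1, u2⟩ := hc.unit x hx
    have u3 := hc.orthogonal x hx
    have r1 := congrArg Complex.re u1
    have r2 := congrArg Complex.re u2
    have r3 := congrArg Complex.re u3
    have i3 := congrArg Complex.im u3
    simp at r1 r2 r3 i3
    fin_cases i <;> fin_cases j <;>
      simp [Matrix.diagonal_apply, k, k', hZ.shape_eq hp₁ (hW hx), e, e', n1, n2, q1, q2] <;>
      linarith

end MovingFrame
end

/-! ### Independence of the chart -/

noncomputable section

namespace CP3

open MovingFrame

local notation "ℝ⁵" => EuclideanSpace ℝ (Fin 5)

theorem fderiv_comp_change {G H : ℝ⁵ → Op4} {ψ : ℝ⁵ → ℝ⁵} {y : ℝ⁵} (hH : ContDiffAt ℝ ∞ H (ψ y))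
    (hψ : ContDiffAt ℝ ∞ ψ y) (e : G =ᶠ[nhds y] fun x => H (ψ x)) (u : ℝ⁵) :
    fderiv ℝ G y u = fderiv ℝ H (ψ y) (fderiv ℝ ψ y u) := by
  rw [e.fderiv_eq]
  exact congrArg (fun L => L u) (fderiv_comp y (hH.differentiableAt (by simp))
    (hψ.differentiableAt (by simp)))

theorem secondDeriv_comp_change {G H : ℝ⁵ → Op4} {ψ : ℝ⁵ → ℝ⁵} {y : ℝ⁵}
    (hH : ContDiffAt ℝ ∞ H (ψ y)) (hψ : ContDiffAt ℝ ∞ ψ y) (e : G =ᶠ[nhds y] fun x => H (ψ x))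
    (u v : ℝ⁵) : secondDeriv G y u v = secondDeriv H (ψ y) (fderiv ℝ ψ y u) (fderiv ℝ ψ y v) +
      fderiv ℝ H (ψ y) (secondDeriv ψ y u v) := by
  have e1 : (fun x => fderiv ℝ G x v) =ᶠ[nhds y] fun x => fderiv ℝ H (ψ x) (fderiv ℝ ψ x v) := by
    have h1 := hψ.continuousAt.eventually (eventually_contDiffAt hH)
    filter_upwards [e.eventuallyEq_nhds, h1, eventually_contDiffAt hψ] with x hx hx1 hx2
    rw [hx.fderiv_eq]
    exact congrArg (fun L => L v) (fderiv_comp x (hx1.differentiableAt (by simp))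
      (hx2.differentiableAt (by simp)))
  have hG : ContDiffAt ℝ ∞ G y := (hH.comp y hψ).congr_of_eventuallyEq e
  have hd : DifferentiableAt ℝ (fun x => fderiv ℝ H (ψ x)) y :=
    (differentiableAt_fderiv hH).comp y (hψ.differentiableAt (by simp))
  have hd2 : fderiv ℝ (fun x => fderiv ℝ H (ψ x)) y =
      (fderiv ℝ (fderiv ℝ H) (ψ y)).comp (fderiv ℝ ψ y) :=
    fderiv_comp y (differentiableAt_fderiv hH) (hψ.differentiableAt (by simp))
  rw [← fderiv_fderiv_apply hG, e1.fderiv_eq,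
    fderiv_clm_apply hd (hasFDerivAt_fderiv_apply hψ v), hd2, ← fderiv_fderiv_apply hψ]
  simp only [add_apply, ContinuousLinearMap.comp_apply, ContinuousLinearMap.flip_apply]
  rw [add_comm]
  rfl

variable {p q : ℝ⁵ → CP3} {ψ : ℝ⁵ → ℝ⁵} {y : ℝ⁵}
  (hq : ContDiffAt ℝ ∞ (fun x => proj (q x)) (ψ y)) (hψ : ContDiffAt ℝ ∞ ψ y)
  (e : ∀ᶠ x in nhds y, p x = q (ψ x))

include hq hψ e

theorem fderiv_proj_change (u : ℝ⁵) : fderiv ℝ (fun x => proj (p x)) y u =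
    fderiv ℝ (fun x => proj (q x)) (ψ y) (fderiv ℝ ψ y u) :=
  fderiv_comp_change hq hψ (e.mono fun x hx => by rw [hx]) u

/-- The extra chain-rule term, the first derivative applied to the second derivative of ψ, is
tangent to the hypersurface and so is annihilated by ξ. -/
theorem hs_change {ξ : Op4} (hξ : HyperplaneAt (q (ψ y)) (fderiv ℝ (fun x => proj (q x)) (ψ y)) ξ)
    (u v : ℝ⁵) : hs p y ξ u v = hs q (ψ y) ξ (fderiv ℝ ψ y u) (fderiv ℝ ψ y v) := by
  rw [hs, secondDeriv_comp_change (H := fun x => proj (q x)) hq hψ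
    (e.mono fun x hx => by rw [hx]), inner_add_left, inner_comm (fderiv ℝ _ _ _), hξ.normal,
    add_zero, hs]

theorem hyperplaneAt_change {L : ℝ⁵ → ℝ⁵} (hL : ∀ v, fderiv ℝ ψ y (L v) = v)
    {ξ : Op4} (hξ : HyperplaneAt (p y) (fderiv ℝ (fun x => proj (p x)) y) ξ) :
    HyperplaneAt (q (ψ y)) (fderiv ℝ (fun x => proj (q x)) (ψ y)) ξ := by
  have h1 (v : ℝ⁵) : fderiv ℝ (fun x => proj (q x)) (ψ y) v =
      fderiv ℝ (fun x => proj (p x)) y (L v) := by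
    rw [fderiv_proj_change hq hψ e, hL]
  have hpq := e.self_of_nhds
  refine ⟨fun v => ?_, fun v hv => ?_, ?_, fun v => ?_, hξ.unit⟩
  · rw [h1, ← hpq]; exact hξ.mem _
  · rw [h1] at hv
    rw [← hL v, hξ.inj _ hv, map_zero]
  · rw [← hpq]; exact hξ.tangent
  · rw [h1]; exact hξ.normal _

theorem hasEqualityAt_change {L : ℝ⁵ → ℝ⁵} (hL : ∀ v, fderiv ℝ ψ y (L v) = v)
    (h : HasEqualityAt q (ψ y)) : HasEqualityAt p y := by
  intro ξ hξ
  have hξ' := hyperplaneAt_change hq hψ e hL hξ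
  obtain ⟨h1, h2⟩ := h ξ hξ'
  refine ⟨fun u hu v => ?_, fun E hE => ?_⟩
  · rw [hs_change hq hψ e hξ']
    refine h1 _ ?_ _
    rw [← fderiv_proj_change hq hψ e, hu, e.self_of_nhds]
  · simp only [hs_change hq hψ e hξ']
    refine h2 (fun a => fderiv ℝ ψ y (E a)) fun a b => ?_
    rw [← fderiv_proj_change hq hψ e, ← fderiv_proj_change hq hψ e, hE a b]

end CP3

namespace RealHypersurface

open CP3 MovingFrame

local notation "ℝ⁵" => EuclideanSpace ℝ (Fin 5)

variable {N : Type*} [TopologicalSpace N] [ChartedSpace ℝ⁵ N]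

/-- The change from the preferred chart at `x₀` to the preferred chart at `x`. -/
def chartChange (x₀ x : N) (y : ℝ⁵) : ℝ⁵ := extChartAt (𝓡 5) x ((extChartAt (𝓡 5) x₀).symm y)

variable [IsManifold (𝓡 5) ∞ N] {f : N → CP3}

section

variable {x₀ x : N} (hx : x ∈ (extChartAt (𝓡 5) x₀).source)

include hx

theorem chartChange_self : chartChange x₀ x (extChartAt (𝓡 5) x₀ x) = extChartAt (𝓡 5) x x := by
  rw [chartChange, (extChartAt (𝓡 5) x₀).left_inv hx]

theorem contDiffAt_chartChange : ContDiffAt ℝ ∞ (chartChange x₀ x) (extChartAt (𝓡 5) x₀ x) := by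
  rw [← contMDiffAt_iff_contDiffAt]
  have h1 : ContMDiffAt 𝓘(ℝ, ℝ⁵) (𝓡 5) ∞ (extChartAt (𝓡 5) x₀).symm (extChartAt (𝓡 5) x₀ x) :=
    (contMDiffOn_extChartAt_symm x₀).contMDiffAt ((isOpen_target x₀).mem_nhds
      ((extChartAt (𝓡 5) x₀).map_source hx))
  have h2 : ContMDiffAt (𝓡 5) 𝓘(ℝ, ℝ⁵) ∞ (extChartAt (𝓡 5) x)
      ((extChartAt (𝓡 5) x₀).symm (extChartAt (𝓡 5) x₀ x)) := by
    rw [(extChartAt (𝓡 5) x₀).left_inv hx]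
    exact contMDiffAt_extChartAt
  exact h2.comp _ h1

theorem localMap_change (f : N → CP3) : ∀ᶠ y in nhds (extChartAt (𝓡 5) x₀ x),
    localMap f x₀ y = localMap f x (chartChange x₀ x y) := by
  have h1 := continuousAt_extChartAt_symm' hx
  have h2 : (extChartAt (𝓡 5) x).source ∈
      nhds ((extChartAt (𝓡 5) x₀).symm (extChartAt (𝓡 5) x₀ x)) := by
    rw [(extChartAt (𝓡 5) x₀).left_inv hx]
    exact extChartAt_source_mem_nhds x
  filter_upwards [h1.eventually h2] with y hy
  rw [localMap, localMap, chartChange, (extChartAt (𝓡 5) x).left_inv hy]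

theorem fderiv_chartChange :
    fderiv ℝ (chartChange x₀ x) (extChartAt (𝓡 5) x₀ x) = tangentCoordChange (𝓡 5) x₀ x x := by
  rw [tangentCoordChange_def]
  simp only [modelWithCornersSelf_coe, Set.range_id, fderivWithin_univ]
  rfl

theorem tangentCoordChange_left_inv (v : ℝ⁵) :
    tangentCoordChange (𝓡 5) x x₀ x (tangentCoordChange (𝓡 5) x₀ x x v) = v := by
  rw [tangentCoordChange_comp ⟨⟨hx, mem_extChartAt_source x⟩, hx⟩, tangentCoordChange_self hx]

theorem tangentCoordChange_right_inv (v : ℝ⁵) :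
    tangentCoordChange (𝓡 5) x₀ x x (tangentCoordChange (𝓡 5) x x₀ x v) = v := by
  have hxx := mem_extChartAt_source (I := 𝓡 5) x
  rw [tangentCoordChange_comp ⟨⟨hxx, hx⟩, hxx⟩, tangentCoordChange_self hxx]

end

/-- Tangent vectors at x are written in the preferred chart of x, whence the coordinate change; in
the trivialisation at x₀ it is undone and the section becomes E composed with the chart. -/
theorem contMDiffOn_coordField {x₀ : N} {W : Set ℝ⁵} (hW : IsOpen W) {E : ℝ⁵ → ℝ⁵}
    (hE : ∀ y ∈ W, ContDiffAt ℝ ∞ E y) :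
    ContMDiffOn (𝓡 5) (𝓡 5).tangent ∞ (fun x => (⟨x, tangentCoordChange (𝓡 5) x₀ x x
      (E (extChartAt (𝓡 5) x₀ x))⟩ : TangentBundle (𝓡 5) N))
      ((extChartAt (𝓡 5) x₀).source ∩ extChartAt (𝓡 5) x₀ ⁻¹' W) := by
  have hs : (extChartAt (𝓡 5) x₀).source = (chartAt ℝ⁵ x₀).source := extChartAt_source _ x₀
  refine ((trivializationAt ℝ⁵ (TangentSpace (𝓡 5)) x₀).contMDiffOn_section_iff
    (isOpen_extChartAt_preimage' (I := 𝓡 5) x₀ hW) (fun x hx => ?_)).2 ?_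
  · rw [TangentBundle.trivializationAt_baseSet, ← hs]; exact hx.1
  · have h1 : ContMDiffOn (𝓡 5) 𝓘(ℝ, ℝ⁵) ∞ (fun x => E (extChartAt (𝓡 5) x₀ x))
        ((extChartAt (𝓡 5) x₀).source ∩ extChartAt (𝓡 5) x₀ ⁻¹' W) := fun x hx =>
      ((hE _ hx.2).contMDiffAt.comp x
        (contMDiffAt_extChartAt' (by rw [← hs]; exact hx.1))).contMDiffWithinAt
    exact h1.congr fun x hx => tangentCoordChange_left_inv hx.1 _

end RealHypersurface
end

/-! ### Local adapted frames on the hypersurface -/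

noncomputable section

namespace RealHypersurface

open CP3 MovingFrame

local notation "ℝ⁵" => EuclideanSpace ℝ (Fin 5)

variable {N : Type*} [TopologicalSpace N] [ChartedSpace ℝ⁵ N] [IsManifold (𝓡 5) ∞ N] {f : N → CP3}

theorem isUnitNormal_of_hyperplaneAt (hf : IsHypersurface f) {x : N} {ξ : Op4}
    (h : HyperplaneAt (localMap f x (extChartAt (𝓡 5) x x))
      (fderiv ℝ (fun y => proj (localMap f x y)) (extChartAt (𝓡 5) x x)) ξ) :
    IsUnitNormal f x ξ where
  tangent := localMap_self f x ▸ h.tangent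
  normal u := (congrArg (inner ξ) (differential_eq hf x u)).trans (h.normal u)
  unit := h.unit

theorem hasEqualityAt_of_ricci_eq (hf : IsHypersurface f) {x : N}
    (h : ∀ (ξ : Op4) (u : TangentSpace (𝓡 5) x), IsUnitNormal f x ξ →
      differential f x u = J (f x) ξ → ricci f x u u = 25 / 2 * sqMeanCurvature f x + 4) :
    HasEqualityAt (localMap f x) (extChartAt (𝓡 5) x x) := by
  intro ξ hξ
  have hn := isUnitNormal_of_hyperplaneAt hf hξ
  have key (u : ℝ⁵) (hu : fderiv ℝ (fun y => proj (localMap f x y)) (extChartAt (𝓡 5) x x) u =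
      J (localMap f x (extChartAt (𝓡 5) x x)) ξ) := by
    have hu' : differential f x u = J (f x) ξ :=
      (differential_eq hf x u).trans (by rw [hu, localMap_self])
    exact (ricci_le hf hn hu').2 (h ξ u hn hu')
  refine ⟨fun u hu => (key u hu).1, ?_⟩
  -- Jξ is orthogonal to ξ, hence tangent to the hypersurface: a vector u to which the equality
  -- hypothesis applies does exist, so the trace condition is not vacuous.
  obtain ⟨u, hu⟩ := hξ.exists_decomp (J_mem hξ.tangent)
  have h0 : inner (J (localMap f x (extChartAt (𝓡 5) x x)) ξ) ξ = 0 := by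
    have h1 := inner_J_left hξ.tangent hξ.tangent
    rw [CP3.inner_comm ξ] at h1
    linarith
  rw [h0, op_zero_smul, add_zero] at hu
  exact (key u hu.symm).2

/-- A hypersurface with equality in the bound of the Ricci curvature of the structure vector has
local smooth adapted frames in which the second fundamental form is diagonal. -/
theorem exists_adaptedFrameOn (hf : IsHypersurface f)
    (h : ∀ x, HasEqualityAt (localMap f x) (extChartAt (𝓡 5) x x)) (x₀ : N) :
    ∃ U : Set N, IsOpen U ∧ x₀ ∈ U ∧
      ∃ (ξ : N → Op4) (e : Fin 5 → (x : N) → TangentSpace (𝓡 5) x), IsAdaptedFrameOn f U ξ e ∧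
        ∀ x ∈ U, ∀ a b : Fin 5, sff f x (e a x) (e b x) =
          Matrix.diagonal ![(1 : ℝ), -1, 1, -1, 0] a b • ξ x := by
  have hG (x : N) := contDiffAt_localMap hf x (mem_extChartAt_target x)
  -- The geometric data at x are defined in the preferred chart of x, while a smooth frame must be
  -- built in the single chart of x₀; this compares the two differentials.
  have change {x : N} (hx : x ∈ (extChartAt (𝓡 5) x₀).source) (u : ℝ⁵) :
      fderiv ℝ (fun y => proj (localMap f x₀ y)) (extChartAt (𝓡 5) x₀ x) u =
        fderiv ℝ (fun y => proj (localMap f x y)) (extChartAt (𝓡 5) x x)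
          (tangentCoordChange (𝓡 5) x₀ x x u) := by
    rw [fderiv_proj_change (q := localMap f x) (by rw [chartChange_self hx]; exact hG x)
      (contDiffAt_chartChange hx) (localMap_change hx f), chartChange_self hx,
      fderiv_chartChange hx]
  obtain ⟨W, hWV, hWo, hyW, ξ, E, hξ, hE, hW⟩ := exists_diagonal_frame (isOpen_target x₀)
    (p := localMap f x₀) (mem_extChartAt_target x₀) (fun y hy => contDiffAt_localMap hf x₀ hy)
    (fun y hy v hv => by
      obtain ⟨x, hx, rfl⟩ : ∃ x ∈ (extChartAt (𝓡 5) x₀).source, extChartAt (𝓡 5) x₀ x = y :=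
        ⟨_, (extChartAt (𝓡 5) x₀).map_target hy, (extChartAt (𝓡 5) x₀).right_inv hy⟩
      rw [change hx] at hv
      rw [← tangentCoordChange_left_inv hx v, differential_inj hf x _ hv, map_zero])
    (fun y hy => by
      obtain ⟨x, hx, rfl⟩ : ∃ x ∈ (extChartAt (𝓡 5) x₀).source, extChartAt (𝓡 5) x₀ x = y :=
        ⟨_, (extChartAt (𝓡 5) x₀).map_target hy, (extChartAt (𝓡 5) x₀).right_inv hy⟩
      refine hasEqualityAt_change (q := localMap f x) (by rw [chartChange_self hx]; exact hG x)
        (contDiffAt_chartChange hx) (localMap_change hx f)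
        (L := fun v => tangentCoordChange (𝓡 5) x x₀ x v) (fun v => ?_)
        (by rw [chartChange_self hx]; exact h x)
      rw [fderiv_chartChange hx, tangentCoordChange_right_inv hx])
  have hdiff {x : N} (hx : x ∈ (extChartAt (𝓡 5) x₀).source) (u : ℝ⁵) :
      differential f x (tangentCoordChange (𝓡 5) x₀ x x u) =
        fderiv ℝ (fun y => proj (localMap f x₀ y)) (extChartAt (𝓡 5) x₀ x) u :=
    (differential_eq hf x _).trans (change hx u).symm
  have hpt {x : N} (hx : x ∈ (extChartAt (𝓡 5) x₀).source) :
      localMap f x₀ (extChartAt (𝓡 5) x₀ x) = f x := by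
    rw [localMap, (extChartAt (𝓡 5) x₀).left_inv hx]
  have hH {x : N} (hx : x ∈ (extChartAt (𝓡 5) x₀).source) (hxW : extChartAt (𝓡 5) x₀ x ∈ W) :=
    hyperplaneAt_change (q := localMap f x) (by rw [chartChange_self hx]; exact hG x)
      (contDiffAt_chartChange hx) (localMap_change hx f)
      (L := fun v => tangentCoordChange (𝓡 5) x x₀ x v)
      (fun v => by rw [fderiv_chartChange hx, tangentCoordChange_right_inv hx])
      (hW _ hxW).1
  have hN {x : N} (hx : x ∈ (extChartAt (𝓡 5) x₀).source) (hxW : extChartAt (𝓡 5) x₀ x ∈ W) :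
      IsUnitNormal f x (ξ (extChartAt (𝓡 5) x₀ x)) := by
    have h1 := hH hx hxW
    rw [chartChange_self hx] at h1
    exact isUnitNormal_of_hyperplaneAt hf h1
  refine ⟨(extChartAt (𝓡 5) x₀).source ∩ extChartAt (𝓡 5) x₀ ⁻¹' W,
    isOpen_extChartAt_preimage' x₀ hWo, ⟨mem_extChartAt_source x₀, hyW⟩,
    fun x => ξ (extChartAt (𝓡 5) x₀ x),
    fun a x => tangentCoordChange (𝓡 5) x₀ x x (E a (extChartAt (𝓡 5) x₀ x)),
    ⟨fun x hx => ?_, fun x hx => hN hx.1 hx.2, fun a => contMDiffOn_coordField hWo (hE a),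
      fun x hx a b => ?_, fun x hx => ?_, fun x hx => ?_⟩, fun x hx a b => ?_⟩
  · have hs : (extChartAt (𝓡 5) x₀).source = (chartAt ℝ⁵ x₀).source := extChartAt_source _ x₀
    exact ((hξ _ hx.2).contMDiffAt.comp x
      (contMDiffAt_extChartAt' (by rw [← hs]; exact hx.1))).contMDiffWithinAt
  · have := (hW _ hx.2).2.1 a b
    rw [← hdiff hx.1, ← hdiff hx.1] at this
    exact this
  · rw [hdiff hx.1, hdiff hx.1, ← hpt hx.1]
    exact (hW _ hx.2).2.2.1
  · rw [hdiff hx.1, hdiff hx.1, ← hpt hx.1]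
    exact (hW _ hx.2).2.2.2.1
  · have h1 := hs_change (q := localMap f x) (by rw [chartChange_self hx.1]; exact hG x)
      (contDiffAt_chartChange hx.1) (localMap_change hx.1 f) (hH hx.1 hx.2)
      (E a (extChartAt (𝓡 5) x₀ x)) (E b (extChartAt (𝓡 5) x₀ x))
    rw [chartChange_self hx.1, fderiv_chartChange hx.1, (hW _ hx.2).2.2.2.2 a b] at h1
    exact (sff_eq hf (hN hx.1 hx.2) _ _).trans (by rw [← h1])

end RealHypersurface
end

theorem proposition7p1 {N : Type*} [TopologicalSpace N]
    [ChartedSpace (EuclideanSpace ℝ (Fin 5)) N] [IsManifold (𝓡 5) ∞ N]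
    (f : N → CP3) (hf : RealHypersurface.IsHypersurface f) :
    (∀ (x : N) (ξ : Op4) (u : TangentSpace (𝓡 5) x),
      RealHypersurface.IsUnitNormal f x ξ →
      RealHypersurface.differential f x u = CP3.J (f x) ξ →
      RealHypersurface.ricci f x u u ≤ 25 / 2 * RealHypersurface.sqMeanCurvature f x + 4) ∧
    ((∀ (x : N) (ξ : Op4) (u : TangentSpace (𝓡 5) x),
      RealHypersurface.IsUnitNormal f x ξ →
      RealHypersurface.differential f x u = CP3.J (f x) ξ →
      RealHypersurface.ricci f x u u = 25 / 2 * RealHypersurface.sqMeanCurvature f x + 4) ↔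
    ∀ p : N, ∃ U : Set N, IsOpen U ∧ p ∈ U ∧
      ∃ (ξ : N → Op4) (e : Fin 5 → (x : N) → TangentSpace (𝓡 5) x) (l : N → ℝ),
        RealHypersurface.IsAdaptedFrameOn f U ξ e ∧
        ContMDiffOn (𝓡 5) 𝓘(ℝ, ℝ) ∞ l U ∧
        (∀ x ∈ U, l x ≠ 0) ∧
        ∀ x ∈ U, ∀ a b : Fin 5, RealHypersurface.sff f x (e a x) (e b x) =
          Matrix.diagonal ![l x, -l x, 1 / l x, -(1 / l x), 0] a b • ξ x) := by
  refine ⟨fun x ξ u hξ hu => (RealHypersurface.ricci_le hf hξ hu).1, fun h p => ?_,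
    fun h x ξ u hξ hu => ?_⟩
  · obtain ⟨U, hU, hp, ξ, e, he, hσ⟩ := RealHypersurface.exists_adaptedFrameOn hf
      (fun x => RealHypersurface.hasEqualityAt_of_ricci_eq hf (h x)) p
    -- The principal curvatures are ±1 on the holomorphic distribution, so λ may be taken constant
    -- equal to 1.
    refine ⟨U, hU, hp, ξ, e, fun _ => 1, he, contMDiffOn_const, fun _ _ => one_ne_zero,
      fun x hx a b => ?_⟩
    rw [hσ x hx a b, div_one]
  · obtain ⟨U, -, hx, ξ₀, e, l, he, -, -, hσ⟩ := h x
    exact RealHypersurface.ricci_eq_of_frame hf hξ hu (fun a => e a x) (l x)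
      (he.orthonormal x hx) (he.e₃_eq x hx) (he.e₄_eq x hx) (hσ x hx)
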